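/- Let $\Gamma$ be a compact connected metric graph that is not a single point, given as the realization of a finite graph $G=(V,E)$ (loops and multiple edges allowed) with edge lengths $\ell(e)>0$. Let $D_0$ be an effective divisor on $\Gamma$ of degree $d$, let $R(D_0)$ be the tropical module of rational functions $f$ on $\Gamma$ (continuous piecewise linear with integral slopes) with $D_0+\operatorname{div}(f)\ge 0$, where $\operatorname{div}(f)(x)$ is the sum of the outgoing slopes of $f$ at $x$, and let $|D_0|$ be the set of effective divisors linearly equivalent to $D_0$, with the topology induced from $\operatorname{Div}^+_d(\Gamma)=\Gamma^d/S_d$. Let $\mathfrak d\subseteq|D_0|$ be a tropical linear system, that is, $\mathfrak d=\{D_0+\operatorname{div}(f): f\in N\}$ for a set $N\subseteq R(D_0)$ that is stable under pointwise maximum and under addition of real constants. Its rank $r(\mathfrak d)$ is the greatest $k\in\mathbb N$ such that for every effective divisor $E$ of degree $k$ there is some $D\in\mathfrak d$ with $D-E\ge 0$; if $\mathfrak d=\emptyset$, then $r(\mathfrak d)=-1$. An abstract polyhedral complex structure on a Hausdorff space $X$ is a finite set $\mathcal K$ of closed subspaces of $X$ (faces) that cover $X$, with $\sigma\cap\tau\in\mathcal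 K$ for all $\sigma,\tau\in\mathcal K$, together with a homeomorphism from each $\sigma\in\mathcal K$ onto a convex rational polyhedron $|\sigma|\subseteq\mathbb R^{n_\sigma}$ (a finite intersection of half-spaces with integral normal vectors and real constant terms), such that $\tau\mapsto$ (image of $\tau$ in $|\sigma|$) is an isomorphism from the poset $\{\tau\in\mathcal K:\tau\subseteq\sigma\}$ to the poset of faces of $|\sigma|$ (including $\emptyset$ and $|\sigma|$), and $|\tau|$ is isometric to the face of $|\sigma|$ corresponding to $\tau$. The dimension of $\sigma$ is that of the affine hull of $|\sigma|$ ($-1$ if $\sigma=\emptyset$). (1) For every abstract polyhedral complex structure on $\mathfrak d$, every inclusion-wise maximal face has dimension at least $r(\mathfrak d)$. (2) Suppose that $\mathfrak d$ is finitely generated, that is, the tropical module $R(\mathfrak d,D_0)=\{f\in R(D_0): D_0+\operatorname{div}(f)\in\mathfrak d\}$ is finitely generated. Then $\mathfrak d$ is closed in $|D_0|$ and definable, and $\mathfrak d$ admits an abstract polyhedral complex structure, all of whose maximal faces have dimension at least $r(\mathfrak d)$; moreover the isometries between $|\tau|$ and the corresponding face of $|\sigma|$ can be taken to be those induced by the homeomorphisms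 $\tau\cong|\tau|$ and $\sigma\cong|\sigma|$. Here a subset of $\mathbb R^n$ is definable if it is a finite expression in intersections, unions and complements of closed half-spaces, and $X\subseteq|D_0|$ is definable if its image in each cell of $|D_0|$ is definable. The relative interior of a cell of $\Gamma^d/S_d$ is the set of divisors with prescribed multiplicities at the vertices and prescribed sequence of multiplicities along each open edge, with the positions of the distinct points on the open edges as coordinates. The cells of $|D_0|$ are the closures of the connected components of the intersections of $|D_0|$ with these relative interiors, with the same coordinates. -/

import Mathlib

noncomputable section

open scoped Topology

/-- A finite graph with vertex set `V`, edge set `E` (loops and parallel edges are allowed), a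
reference orientation of every edge, and positive edge lengths. -/
structure WeightedGraph (V E : Type*) where
  src : E → V
  tgt : E → V
  len : E → ℝ
  len_pos : ∀ e, 0 < len e

namespace WeightedGraph

variable {V E : Type*}

/-- The points of the metric graph `Γ` realizing `G`: the vertices, and for every edge `e` the
points of the open interval `(0, len e)`. -/
inductive Point (G : WeightedGraph V E) : Type _
  | vertex (v : V) : Point G
  | inner (e : E) (y : ℝ) (h0 : 0 < y) (h1 : y < G.len e) : Point G

variable (G : WeightedGraph V E)

open Classical in
/-- The parametrization of the closed edge `e` by `[0, len e]`; it sends `0` to the source and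
`len e` to the target. -/
def pt (e : E) (y : ℝ) : G.Point :=
  if h0 : 0 < y then
    if h1 : y < G.len e then Point.inner e y h0 h1 else Point.vertex (G.tgt e)
  else Point.vertex (G.src e)

/-- The quotient topology of the disjoint union of the closed edges, glued along the vertices: a set
is open when its trace on each closed edge is open. -/
instance : TopologicalSpace G.Point :=
  ⨆ e : E, TopologicalSpace.coinduced (fun y : Set.Icc (0 : ℝ) (G.len e) => G.pt e y) inferInstance

/-- Rational functions: continuous, and piecewise linear with integral slopes on every edge. -/
def IsRational (f : G.Point → ℝ) : Prop :=
  Continuous f ∧ ∀ e : E, ∃ B : Finset ℝ, ∀ a b : ℝ, 0 ≤ a → a < b → b ≤ G.len e →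
    (∀ c ∈ B, c ∉ Set.Ioo a b) →
      ∃ k : ℤ, ∀ y ∈ Set.Icc a b, f (G.pt e y) = f (G.pt e a) + k * (y - a)

/-- Slope of `f` at the point with parameter `y` of `e`, in the direction of increasing parameter. -/
def slopeFwd (f : G.Point → ℝ) (e : E) (y : ℝ) : ℝ :=
  derivWithin (fun z => f (G.pt e z)) (Set.Ioi y) y

/-- Slope of `f` at the point with parameter `y` of `e`, in the direction of decreasing parameter. -/
def slopeBwd (f : G.Point → ℝ) (e : E) (y : ℝ) : ℝ :=
  -derivWithin (fun z => f (G.pt e z)) (Set.Iio y) y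

open Classical in
/-- The order of `f` at a point: the sum of the outgoing slopes over all tangent directions. -/
def ord [Fintype E] (f : G.Point → ℝ) : G.Point → ℝ
  | .vertex v => ∑ e : E, ((if G.src e = v then G.slopeFwd f e 0 else 0) +
      (if G.tgt e = v then G.slopeBwd f e (G.len e) else 0))
  | .inner e y _ _ => G.slopeFwd f e y + G.slopeBwd f e y

/-- Divisors on the metric graph. -/
abbrev Divisor : Type _ := G.Point →₀ ℤ

/-- Effective divisors of degree `d`. -/
@[ext]
structure EffDiv (d : ℕ) where
  toDiv : G.Divisor
  nonneg : 0 ≤ toDiv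
  degree_eq : (toDiv.sum fun _ n => n) = (d : ℤ)

/-- The map `Γ^d → Div_d^+(Γ)`, `(x₁, …, x_d) ↦ x₁ + ⋯ + x_d`. -/
def sumPoints (d : ℕ) (x : Fin d → G.Point) : G.EffDiv d :=
  ⟨∑ i, Finsupp.single (x i) 1,
    Finset.sum_nonneg fun i _ => by simp,
    by
      classical
      rw [← Finsupp.sum_finsetSum_index (by simp) (by simp)]
      simp⟩

/-- The topology of the symmetric product `Γ^d / S_d`. -/
instance (d : ℕ) : TopologicalSpace (G.EffDiv d) :=
  TopologicalSpace.coinduced (G.sumPoints d) inferInstance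

variable {G} {d : ℕ}

/-- `D' = D + div f`. -/
def IsTranslate [Fintype E] (D : G.EffDiv d) (f : G.Point → ℝ) (D' : G.EffDiv d) : Prop :=
  ∀ x, (D'.toDiv x : ℝ) = D.toDiv x + G.ord f x

/-- `R(D)`, the rational functions with `D + div f ≥ 0`. Here and below the element `-∞` of a
tropical module of functions is left implicit. -/
def ratSpace [Fintype E] (D : G.EffDiv d) : Set (G.Point → ℝ) :=
  {f | G.IsRational f ∧ ∀ x, 0 ≤ (D.toDiv x : ℝ) + G.ord f x}

/-- The complete linear system `|D|`. -/
def linSystem [Fintype E] (D : G.EffDiv d) : Set (G.EffDiv d) :=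
  {D' | ∃ f, G.IsRational f ∧ IsTranslate D f D'}

/-- Stability under tropical addition (pointwise maximum) and tropical scaling (adding a real
constant). -/
structure IsTropicalModule {X : Type*} (N : Set (X → ℝ)) : Prop where
  sup_mem : ∀ f ∈ N, ∀ g ∈ N, f ⊔ g ∈ N
  shift_mem : ∀ f ∈ N, ∀ c : ℝ, (fun x => c + f x) ∈ N

/-- The tropical module generated by a set of functions. -/
def tropicalSpan {X : Type*} (S : Set (X → ℝ)) : Set (X → ℝ) :=
  ⋂₀ {N | IsTropicalModule N ∧ S ⊆ N}

/-- `𝔡 ⊆ |D|` is a tropical linear system: the tropical projectivization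
`{D + div f | f ∈ N}` of a tropical submodule `N` of `R(D)`. -/
def IsTropicalLinearSystem [Fintype E] (D : G.EffDiv d) (𝔡 : Set (G.EffDiv d)) : Prop :=
  ∃ N : Set (G.Point → ℝ), IsTropicalModule N ∧ N ⊆ ratSpace D ∧
    𝔡 = {D' | ∃ f ∈ N, IsTranslate D f D'}

/-- `R(𝔡, D) = {f ∈ R(D) | D + div f ∈ 𝔡}`, the cone over `𝔡`. -/
def cone [Fintype E] (D : G.EffDiv d) (𝔡 : Set (G.EffDiv d)) : Set (G.Point → ℝ) :=
  {f | f ∈ ratSpace D ∧ ∃ D' ∈ 𝔡, IsTranslate D f D'}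

/-- `𝔡` is finitely generated: the tropical module `R(𝔡, D)` is. -/
def IsFinGen [Fintype E] (D : G.EffDiv d) (𝔡 : Set (G.EffDiv d)) : Prop :=
  ∃ S : Set (G.Point → ℝ), S.Finite ∧ tropicalSpan S = cone D 𝔡

/-- `𝔡(-E)`, the divisors `D ∈ 𝔡` with `D - E ≥ 0`. -/
def subSystem (𝔡 : Set (G.EffDiv d)) {k : ℕ} (F : G.EffDiv k) : Set (G.EffDiv d) :=
  {D | D ∈ 𝔡 ∧ 0 ≤ D.toDiv - F.toDiv}

open Classical in
/-- The rank of `𝔡`: the greatest `k` such that `𝔡(-E)` is nonempty for all effective `E` of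
degree `k`, and `-1` if `𝔡` is empty. -/
def rank (𝔡 : Set (G.EffDiv d)) : ℤ :=
  if 𝔡 = ∅ then -1
  else ((sSup {k : ℕ | ∀ F : G.EffDiv k, (subSystem 𝔡 F).Nonempty} : ℕ) : ℤ)

/-- For nonempty `𝔡` the maximum in the definition of the rank exists. -/
theorem rank_isGreatest [Nonempty G.Point] {𝔡 : Set (G.EffDiv d)} (h : 𝔡.Nonempty) :
    ∃ r : ℕ, rank 𝔡 = r ∧
      IsGreatest {k : ℕ | ∀ F : G.EffDiv k, (subSystem 𝔡 F).Nonempty} r := by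
  classical
  have hdeg : ∀ {k : ℕ} (F : G.EffDiv k) (D : G.EffDiv d), 0 ≤ D.toDiv - F.toDiv → k ≤ d := by
    intro k F D hDF
    have h1 : (0 : ℤ) ≤ (D.toDiv - F.toDiv).sum fun _ n => n :=
      Finset.sum_nonneg fun x _ => hDF x
    rw [Finsupp.sum_sub_index (by simp), D.degree_eq, F.degree_eq] at h1
    omega
  refine ⟨sSup {k : ℕ | ∀ F : G.EffDiv k, (subSystem 𝔡 F).Nonempty},
    by simp [rank, h.ne_empty], ?_, ?_⟩
  · refine Nat.sSup_mem ⟨0, ?_⟩ ⟨d, ?_⟩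
    · intro F
      obtain ⟨D, hD⟩ := h
      refine ⟨D, hD, ?_⟩
      have h0 : F.toDiv = 0 := by
        ext x
        have hs := F.degree_eq
        rw [Finsupp.sum, Nat.cast_zero, Finset.sum_eq_zero_iff_of_nonneg (fun i _ => F.nonneg i)] at hs
        by_cases hx : x ∈ F.toDiv.support
        · simpa using hs x hx
        · simpa using hx
      rw [h0, sub_zero]
      exact D.nonneg
    · intro k hk
      obtain ⟨D, hD⟩ := hk (G.sumPoints k fun _ => Classical.arbitrary _)
      exact hdeg _ D hD.2
  · intro k hk
    refine le_csSup ⟨d, ?_⟩ hk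
    intro k hk
    obtain ⟨D, hD⟩ := hk (G.sumPoints k fun _ => Classical.arbitrary _)
    exact hdeg _ D hD.2

/-- A cell of `Γ^d / S_d`: the multiplicities of the chips at the vertices, and on each edge `e` the
multiplicities of `num e` distinct points of its interior, listed along the orientation of `e`. -/
structure CellType (V E : Type*) where
  multV : V → ℕ
  num : E → ℕ
  multE : (e : E) → Fin (num e) → ℕ
  multE_pos : ∀ e j, 0 < multE e j

namespace CellType

/-- The coordinate space of a cell: one coordinate for each point in the interior of an edge. -/
abbrev Coord (c : CellType V E) : Type _ := EuclideanSpace ℝ (Σ e : E, Fin (c.num e))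

/-- The relative interior of the cell, in coordinates. -/
def openCell (c : CellType V E) (G : WeightedGraph V E) : Set c.Coord :=
  {y | ∀ e, StrictMono (fun j : Fin (c.num e) => y ⟨e, j⟩) ∧
    ∀ j : Fin (c.num e), 0 < y ⟨e, j⟩ ∧ y ⟨e, j⟩ < G.len e}

/-- The divisor with given coordinates; also used on the closure of the open cell. -/
def divisor [Fintype V] [Fintype E] (c : CellType V E) (G : WeightedGraph V E) (y : c.Coord) :
    G.Divisor :=
  ∑ v, Finsupp.single (Point.vertex v) (c.multV v : ℤ) +
    ∑ e, ∑ j, Finsupp.single (G.pt e (y ⟨e, j⟩)) (c.multE e j : ℤ)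

/-- The points of the cell, in coordinates, whose divisor belongs to `X`. -/
def trace [Fintype V] [Fintype E] (c : CellType V E) (X : Set (G.EffDiv d)) : Set c.Coord :=
  {y | ∃ D ∈ X, D.toDiv = c.divisor G y}

end CellType

/-- Subsets of a Euclidean space given by a finite expression in intersections, unions and
complements of closed half-spaces. -/
inductive IsDefinable {ι : Type*} [Fintype ι] : Set (EuclideanSpace ℝ ι) → Prop
  | halfSpace (v : EuclideanSpace ℝ ι) (a : ℝ) : IsDefinable {u | inner ℝ u v ≥ a}
  | inter {A B : Set (EuclideanSpace ℝ ι)} : IsDefinable A → IsDefinable B → IsDefinable (A ∩ B)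
  | union {A B : Set (EuclideanSpace ℝ ι)} : IsDefinable A → IsDefinable B → IsDefinable (A ∪ B)
  | compl {A : Set (EuclideanSpace ℝ ι)} : IsDefinable A → IsDefinable Aᶜ

/-- `X ⊆ |D|` is definable. The cells of `|D|` are the closures of the connected components `C` of
the intersections of `|D|` with the relative interiors of the cells `c` of `Γ^d / S_d`; in the
coordinates of `c` such a cell is the closure of `C` in `ℝⁿ`. The image of `X` in each of
them has to be definable. -/
def IsDefinableIn [Fintype V] [Fintype E] (D : G.EffDiv d) (X : Set (G.EffDiv d)) : Prop :=
  ∀ (c : CellType V E), ∀ y₀ ∈ c.openCell G ∩ c.trace (linSystem D),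
    IsDefinable (closure (connectedComponentIn (c.openCell G ∩ c.trace (linSystem D)) y₀) ∩
      c.trace X)

end WeightedGraph

/-- Convex rational polyhedra in `ℝⁿ`: finite intersections of closed half-spaces with integral
normal vectors (and arbitrary real constant terms). -/
def IsRationalPolyhedron {n : ℕ} (P : Set (EuclideanSpace ℝ (Fin n))) : Prop :=
  ∃ (m : ℕ) (a : Fin m → Fin n → ℤ) (b : Fin m → ℝ),
    P = {x | ∀ i, ∑ j, (a i j : ℝ) * x j ≤ b i}

/-- An abstract polyhedral complex structure on a Hausdorff space `X`. The faces of a polyhedron are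
its exposed subsets `IsExposed`, including the empty set and the polyhedron itself. -/
structure AbstractPolyhedralComplex (X : Type*) [TopologicalSpace X] where
  t2 : T2Space X
  /-- the faces of the complex -/
  cells : Set (Set X)
  finite : cells.Finite
  cover : ⋃₀ cells = Set.univ
  isClosed : ∀ σ ∈ cells, IsClosed σ
  /-- the dimension of the space in which `|σ|` lives -/
  amb : cells → ℕ
  /-- the polyhedron `|σ|` -/
  poly : (σ : cells) → Set (EuclideanSpace ℝ (Fin (amb σ)))
  isRational : ∀ σ, IsRationalPolyhedron (poly σ)
  /-- the homeomorphism `σ ≅ |σ|` -/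
  chart : (σ : cells) → (σ : Set X) ≃ₜ poly σ
  /-- `τ ↦ chart σ (τ)` is an isomorphism from `{τ ∈ cells | τ ⊆ σ}` to the poset of faces
  of `|σ|` -/
  faces : ∀ σ : cells,
    {η | ∃ τ : cells, (τ : Set X) ⊆ σ ∧
      η = {p | ∃ x : (σ : Set X), (x : X) ∈ (τ : Set X) ∧ (chart σ x : EuclideanSpace ℝ _) = p}} =
    {η | IsExposed ℝ (poly σ) η}
  isometric : ∀ σ τ : cells, (τ : Set X) ⊆ σ →
    Nonempty (poly τ ≃ᵢ {p : EuclideanSpace ℝ (Fin (amb σ)) |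
      ∃ x : (σ : Set X), (x : X) ∈ (τ : Set X) ∧ (chart σ x : EuclideanSpace ℝ _) = p})
  inter : ∀ σ ∈ cells, ∀ τ ∈ cells, σ ∩ τ ∈ cells

namespace AbstractPolyhedralComplex

variable {X : Type*} [TopologicalSpace X] (K : AbstractPolyhedralComplex X)

/-- The isometries between `|τ|` and the face of `|σ|` corresponding to `τ ⊆ σ` can be taken to be
the ones induced by the charts. -/
def ChartsIsometric : Prop :=
  ∀ (σ τ : K.cells) (h : (τ : Set X) ⊆ σ) (x y : (τ : Set X)),
    dist (K.chart τ x) (K.chart τ y) = dist (K.chart σ ⟨x, h x.2⟩) (K.chart σ ⟨y, h y.2⟩)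

open Classical in
/-- The dimension of the smallest affine subspace containing `|σ|` (`-1` for the empty face). -/
def dim (σ : K.cells) : ℤ :=
  if K.poly σ = ∅ then -1
  else (Module.finrank ℝ (affineSpan ℝ (K.poly σ)).direction : ℤ)

/-- Inclusion-wise maximal faces. -/
def IsMaximalFace (σ : K.cells) : Prop := Maximal (· ∈ K.cells) (σ : Set X)

end AbstractPolyhedralComplex

end

/-! Let r be the rank. For the lower bound on dimensions, let U be an open set meeting 𝔡, and
suppose that D = D₀ + div F lies in U, where F is a maximum of s + 1 ≤ r functions of N, each
strictly larger than the others on a nonempty open region. Pick in each region a point inside an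
edge and off D. The rank provides g in N such that D₀ + div g contains all these points. Shift g by
a constant until it touches F from below. It cannot coincide with F on a whole region, since the two
divisors differ there. Hence for small ε > 0 the maximum of F and g + ε has s + 2 terms, none
redundant, and its divisor is still in U. Iteration gives r + 1 irredundant terms
(`exists_irredundant_max`), and varying r of their coefficients embeds an r-cube in U ∩ 𝔡
(`exists_cube`).

A nonempty maximal face contains a nonempty open set, because a convex set is not a finite union of
proper exposed faces. So it contains an r-cube, and its dimension is at least r by
`le_of_cube_map_disjoint_facets`, a form of invariance of dimension that follows from the
Poincaré–Miranda theorem.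

If finitely many functions generate the cone over 𝔡, each tropical combination has, up to a
constant, a unique normal form in which every term attains the maximum somewhere and the first
coefficient is 0. The normalized coefficient vectors form a compact set, semilinear by quantifier
elimination. Since a function is determined by its divisor up to a constant, and the divisor depends
continuously on the function, this set is homeomorphic to 𝔡 (`exists_homeomorph`). A hyperplane
arrangement cuts it into polyhedra. Definability is quantifier elimination again: on a cell of |D₀|
the slopes at the sources of the edges can be held constant, so a function with the given divisor is
piecewise affine in the coordinates, and being a combination of the generators is a first-order
condition (`Generates.isDefinableIn`).

Both halves need to pass between divisors and functions. This is done by Green's formula on the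
graph, which expresses the values of div f on suitable test functions through finitely many values
of f. -/

/-! ### The Poincaré–Miranda theorem, by a cochain argument modulo 2 -/

section PoincareMiranda

variable {ι : Type*} [DecidableEq ι]

/-- The sum, modulo 2, over all orderings `j₁, j₂, …` of (part of) the directions in `J`, of the
product of the increments of the successive functions along the lattice path that starts at `v` and
takes the steps `j₁, j₂, …`. -/
def stepSum : List ((ι → ℕ) → ZMod 2) → Finset ι → (ι → ℕ) → ZMod 2
  | [], _, _ => 1
  | a :: as, J, v =>
    ∑ j ∈ J, (a (v + Pi.single j 1) + a v) * stepSum as (J.erase j) (v + Pi.single j 1)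

theorem Finset.sum_sum_erase_eq_zero_of_symm (J : Finset ι) (T : ι → ι → ZMod 2)
    (hT : ∀ i j, T i j = T j i) : ∑ j ∈ J, ∑ i ∈ J.erase j, T i j = 0 := by
  rw [Finset.sum_sigma']
  refine Finset.sum_involution (fun p _ => ⟨p.2, p.1⟩) ?_ ?_ ?_ ?_
  · rintro ⟨i, j⟩ _
    simp only
    rw [hT, CharTwo.add_self_eq_zero]
  · rintro ⟨i, j⟩ h _ h'
    simp only [Finset.mem_sigma, Finset.mem_erase] at h
    simp only [Sigma.mk.injEq, heq_eq_eq] at h'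
    exact h.2.1 h'.1
  · rintro ⟨i, j⟩ h
    simp only [Finset.mem_sigma, Finset.mem_erase] at h ⊢
    exact ⟨h.2.2, Ne.symm h.2.1, h.1⟩
  · rintro ⟨i, j⟩ _
    rfl

/-- View `stepSum as` as a cubical cochain ω modulo 2. The definition of `stepSum (a :: as)` is the
cup product δa ∪ ω and the right-hand side is δ(aω); they differ by `a v` times δω, which `h` makes
zero. -/
theorem stepSum_cons_of_closed (a : (ι → ℕ) → ZMod 2) (as : List ((ι → ℕ) → ZMod 2))
    (J : Finset ι) (v : ι → ℕ)
    (h : ∑ j ∈ J, (stepSum as (J.erase j) (v + Pi.single j 1) + stepSum as (J.erase j) v) = 0) :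
    stepSum (a :: as) J v = ∑ j ∈ J, (a (v + Pi.single j 1) *
      stepSum as (J.erase j) (v + Pi.single j 1) + a v * stepSum as (J.erase j) v) := by
  rw [← sub_eq_zero, stepSum, ← Finset.sum_sub_distrib]
  trans a v * ∑ j ∈ J, (stepSum as (J.erase j) (v + Pi.single j 1) + stepSum as (J.erase j) v)
  · rw [Finset.mul_sum]
    refine Finset.sum_congr rfl fun j _ => ?_
    rw [CharTwo.sub_eq_add]
    have := CharTwo.add_self_eq_zero
      (a (v + Pi.single j 1) * stepSum as (J.erase j) (v + Pi.single j 1))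
    linear_combination this
  · rw [h, mul_zero]

/-- This is δδ = 0: by induction every face term is a coboundary, so the total is a sum over ordered
pairs of directions. -/
theorem stepSum_closed (as : List ((ι → ℕ) → ZMod 2)) : ∀ (J : Finset ι) (v : ι → ℕ),
    ∑ j ∈ J, (stepSum as (J.erase j) (v + Pi.single j 1) + stepSum as (J.erase j) v) = 0 := by
  induction as with
  | nil => intro J v; simp [stepSum, CharTwo.add_self_eq_zero]
  | cons b bs ih =>
    intro J v
    -- The summand adds up the four corners of the square spanned at `v` by the directions `i` and
    -- `j`, hence is symmetric.
    rw [← Finset.sum_sum_erase_eq_zero_of_symm J (fun i j =>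
      b (v + Pi.single j 1 + Pi.single i 1) *
        stepSum bs ((J.erase j).erase i) (v + Pi.single j 1 + Pi.single i 1) +
      b (v + Pi.single j 1) * stepSum bs ((J.erase j).erase i) (v + Pi.single j 1) +
      (b (v + Pi.single i 1) * stepSum bs ((J.erase j).erase i) (v + Pi.single i 1) +
      b v * stepSum bs ((J.erase j).erase i) v))]
    · refine Finset.sum_congr rfl fun j _ => ?_
      rw [stepSum_cons_of_closed b bs _ _ (ih _ _), stepSum_cons_of_closed b bs _ _ (ih _ _),
        ← Finset.sum_add_distrib]
    · intro i j
      rw [Finset.erase_right_comm, add_right_comm v]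
      ring

theorem stepSum_cons (a : (ι → ℕ) → ZMod 2) (as : List ((ι → ℕ) → ZMod 2))
    (J : Finset ι) (v : ι → ℕ) :
    stepSum (a :: as) J v = ∑ j ∈ J, (a (v + Pi.single j 1) *
      stepSum as (J.erase j) (v + Pi.single j 1) + a v * stepSum as (J.erase j) v) :=
  stepSum_cons_of_closed a as J v (stepSum_closed as J v)

/-- As `j ∉ J`, the lattice paths never leave the hyperplane on which `a` is constant, so every
product has a zero increment. -/
theorem stepSum_eq_zero_of_const {j : ι} {k : ℕ} {c : ZMod 2} {a : (ι → ℕ) → ZMod 2}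
    (ha : ∀ v : ι → ℕ, v j = k → a v = c) (as : List ((ι → ℕ) → ZMod 2)) (has : a ∈ as) :
    ∀ (J : Finset ι) (v : ι → ℕ), j ∉ J → v j = k → stepSum as J v = 0 := by
  induction as with
  | nil => simp at has
  | cons b bs ih =>
    intro J v hj hv
    refine Finset.sum_eq_zero fun i hi => ?_
    have hij : j ≠ i := fun h => hj (h ▸ hi)
    have hv' : (v + Pi.single i 1 : ι → ℕ) j = k := by simp [hv, Pi.single_eq_of_ne hij]
    rcases List.mem_cons.1 has with rfl | hb
    · rw [ha _ hv, ha _ hv', CharTwo.add_self_eq_zero, zero_mul]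
    · rw [ih hb _ _ (fun h => hj (Finset.mem_of_mem_erase h)) hv', mul_zero]

/-- Some path has a nonzero product, so every function changes along one of its steps. -/
theorem exists_change_of_stepSum_ne_zero (as : List ((ι → ℕ) → ZMod 2)) :
    ∀ (J : Finset ι) (v : ι → ℕ), stepSum as J v ≠ 0 → ∀ a ∈ as, ∃ w : ι → ℕ, ∃ i,
      (∀ j, v j ≤ w j ∧ w j ≤ v j + as.length) ∧ a (w + Pi.single i 1) ≠ a w := by
  induction as with
  | nil => simp
  | cons b bs ih =>
    intro J v h a ha
    obtain ⟨i, hi, hne⟩ := Finset.exists_ne_zero_of_sum_ne_zero h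
    rcases List.mem_cons.1 ha with rfl | hb
    · refine ⟨v, i, fun j => ⟨le_rfl, by simp⟩, fun h => hne ?_⟩
      rw [h, CharTwo.add_self_eq_zero, zero_mul]
    · obtain ⟨w, i', hw, hne'⟩ := ih _ _ (right_ne_zero_of_mul hne) a hb
      refine ⟨w, i', fun j => ?_, hne'⟩
      have h1 := hw j
      have h2 : (Pi.single i 1 : ι → ℕ) j ≤ 1 := by
        by_cases hj : j = i
        · subst hj; simp
        · simp [Pi.single_eq_of_ne hj]
      simp only [Pi.add_apply, List.length_cons] at h1 ⊢
      omega

variable [Fintype ι]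

/-- Lattice points with coordinates in `[0, N)` in the directions of `J`, and `N` in the others. -/
def latticeBox (N : ℕ) (J : Finset ι) : Finset (ι → ℕ) :=
  Fintype.piFinset fun i => if i ∈ J then Finset.range N else {N}

theorem sum_latticeBox_telescope (N : ℕ) {J : Finset ι} {j : ι} (hj : j ∈ J)
    (F : (ι → ℕ) → ZMod 2) :
    ∑ v ∈ latticeBox N J, (F (v + Pi.single j 1) + F v) =
      ∑ v ∈ latticeBox N (J.erase j), (F v + F (Function.update v j 0)) := by
  have key : ∑ v ∈ latticeBox N J, (F (v + Pi.single j 1) + F v) =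
      ∑ p ∈ latticeBox N (J.erase j) ×ˢ Finset.range N,
        (F (Function.update p.1 j (p.2 + 1)) + F (Function.update p.1 j p.2)) := by
    refine Finset.sum_bij' (fun v _ => (Function.update v j N, v j))
      (fun p _ => Function.update p.1 j p.2) ?_ ?_ ?_ ?_ ?_
    · intro v hv
      simp only [latticeBox, Fintype.mem_piFinset, Finset.mem_product] at hv ⊢
      refine ⟨fun i => ?_, by simpa [hj] using hv j⟩
      by_cases hi : i = j
      · subst hi; simp
      · simpa [hi] using hv i
    · rintro ⟨u, k⟩ hp
      simp only [latticeBox, Fintype.mem_piFinset, Finset.mem_product] at hp ⊢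
      intro i
      by_cases hi : i = j
      · subst hi; simpa [hj] using hp.2
      · simpa [hi] using hp.1 i
    · intro v _; simp
    · rintro ⟨u, k⟩ hp
      simp only [latticeBox, Fintype.mem_piFinset, Finset.mem_product] at hp ⊢
      have h1 := hp.1 j
      simp only [Finset.notMem_erase, if_false, Finset.mem_singleton] at h1
      simp [← h1]
    · intro v _
      have h1 : v + Pi.single j 1 = Function.update v j (v j + 1) := by
        ext i
        by_cases hi : i = j
        · subst hi; simp
        · simp [hi]
      simp [h1]
  rw [key, Finset.sum_product]
  refine Finset.sum_congr rfl fun u hu => ?_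
  have h1 : Function.update u j N = u := by
    simp only [latticeBox, Fintype.mem_piFinset] at hu
    have := hu j
    simp only [Finset.notMem_erase, if_false, Finset.mem_singleton] at this
    simp [← this]
  have := Finset.sum_range_sub (fun k => F (Function.update u j k)) N
  simp only [CharTwo.sub_eq_add, h1] at this
  simpa using this

/-- Discrete Stokes: the cochain is a coboundary, so its sum over the box reduces to the facets.
Facets in a direction `j ≠ i` contribute nothing because `a j` is constant on them. In direction `i`
the factor `a i` is 0 on the near facet and 1 on the far one, which leaves the same sum for the
shorter list. -/
theorem sum_stepSum_eq_one (N : ℕ) (a : ι → (ι → ℕ) → ZMod 2)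
    (h0 : ∀ i v, v i = 0 → a i v = 0) (h1 : ∀ i v, v i = N → a i v = 1) :
    ∀ l : List ι, l.Nodup → ∑ v ∈ latticeBox N l.toFinset, stepSum (l.map a) l.toFinset v = 1 := by
  intro l
  induction l with
  | nil => intro _; simp [stepSum, latticeBox]
  | cons i l ih =>
    intro hl
    rw [List.nodup_cons] at hl
    simp only [List.map_cons, stepSum_cons]
    rw [Finset.sum_comm]
    have hi : i ∈ (i :: l).toFinset := by simp
    rw [Finset.sum_eq_single_of_mem i hi]
    · rw [sum_latticeBox_telescope N hi
        (fun v => a i v * stepSum (l.map a) ((i :: l).toFinset.erase i) v)]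
      have : (i :: l).toFinset.erase i = l.toFinset := by
        rw [List.toFinset_cons, Finset.erase_insert (by simpa using hl.1)]
      rw [this, ← ih hl.2]
      refine Finset.sum_congr rfl fun v hv => ?_
      have hv' : v i = N := by
        simp only [latticeBox, Fintype.mem_piFinset] at hv
        simpa [hl.1] using hv i
      rw [h1 i v hv', h0 i _ (by simp)]
      simp
    · intro j hj hji
      have hjl : a j ∈ l.map a := by
        simp only [List.toFinset_cons, Finset.mem_insert, List.mem_toFinset] at hj
        exact List.mem_map_of_mem (hj.resolve_left hji)
      rw [sum_latticeBox_telescope N hj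
        (fun v => a i v * stepSum (l.map a) ((i :: l).toFinset.erase j) v)]
      refine Finset.sum_eq_zero fun v hv => ?_
      have hv' : v j = N := by
        simp only [latticeBox, Fintype.mem_piFinset] at hv
        simpa using hv j
      rw [stepSum_eq_zero_of_const (h1 j) _ hjl _ _ (by simp) hv',
        stepSum_eq_zero_of_const (h0 j) _ hjl _ _ (by simp) (by simp)]
      simp

/-- A discrete form of the Poincaré–Miranda theorem. -/
theorem exists_lattice_change (N : ℕ) (s : ι → Set (ι → ℕ))
    (h0 : ∀ i v, v i = 0 → v ∉ s i) (h1 : ∀ i v, v i = N → v ∈ s i) :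
    ∃ v : ι → ℕ, (∀ j, v j ≤ N) ∧ ∀ i, ∃ w w' : ι → ℕ, w ∈ s i ∧ w' ∉ s i ∧
      ∀ j, v j ≤ w j ∧ w j ≤ v j + (Fintype.card ι + 1) ∧ v j ≤ w' j ∧
        w' j ≤ v j + (Fintype.card ι + 1) := by
  classical
  set a : ι → (ι → ℕ) → ZMod 2 := fun i v => if v ∈ s i then 1 else 0 with ha
  have hsum := sum_stepSum_eq_one N a (fun i v hv => by simp [ha, h0 i v hv])
    (fun i v hv => by simp [ha, h1 i v hv]) Finset.univ.toList (Finset.nodup_toList _)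
  obtain ⟨v, hvN, hv⟩ := Finset.exists_ne_zero_of_sum_ne_zero (hsum ▸ one_ne_zero)
  refine ⟨v, fun j => ?_, fun i => ?_⟩
  · simp only [latticeBox, Fintype.mem_piFinset] at hvN
    have := hvN j
    simp only [Finset.mem_toList, List.mem_toFinset, Finset.mem_univ, if_true,
      Finset.mem_range] at this
    exact this.le
  obtain ⟨w, j, hw, hne⟩ := exists_change_of_stepSum_ne_zero _ _ _ hv (a i)
    (List.mem_map_of_mem (by simp))
  simp only [List.length_map, Finset.length_toList, Finset.card_univ] at hw
  have hw' : ∀ k, v k ≤ (w + Pi.single j 1 : ι → ℕ) k ∧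
      (w + Pi.single j 1 : ι → ℕ) k ≤ v k + (Fintype.card ι + 1) := by
    intro k
    have h2 : (Pi.single j 1 : ι → ℕ) k ≤ 1 := by
      by_cases hj : k = j
      · subst hj; simp
      · simp [Pi.single_eq_of_ne hj]
    have := hw k
    simp only [Pi.add_apply]
    omega
  by_cases hws : w ∈ s i
  · refine ⟨w, w + Pi.single j 1, hws, fun h => hne (by simp [ha, hws, h]), fun k => ?_⟩
    have := hw k; have := hw' k; omega
  · refine ⟨w + Pi.single j 1, w, ?_, hws, fun k => ?_⟩
    · by_contra h; exact hne (by simp [ha, hws, h])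
    · have := hw k; have := hw' k; omega

/-- The Poincaré–Miranda theorem. -/
theorem poincareMiranda (g : ι → (ι → ℝ) → ℝ) (hg : ∀ i, Continuous (g i))
    (h0 : ∀ i x, x i = 0 → g i x < 0) (h1 : ∀ i x, x i = 1 → 0 < g i x) :
    ∃ x ∈ Set.Icc (0 : ι → ℝ) 1, ∀ i, g i x = 0 := by
  have approx : ∀ ε > 0, ∃ x ∈ Set.Icc (0 : ι → ℝ) 1, ∀ i, |g i x| < ε := by
    intro ε hε
    -- The lattice points supplied below may leave the unit cube, by at most `K / N < 1`; hence the
    -- cube of side 2.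
    have huc : UniformContinuousOn (fun x i => g i x) (Set.Icc (0 : ι → ℝ) 2) :=
      isCompact_Icc.uniformContinuousOn_of_continuous (continuous_pi hg).continuousOn
    obtain ⟨δ, hδ, H⟩ := Metric.uniformContinuousOn_iff.1 huc ε hε
    set K : ℝ := Fintype.card ι + 1 with hK
    have hK0 : 0 < K := by positivity
    obtain ⟨N, hN⟩ := exists_nat_gt (max K (K / δ))
    have hKN : K < N := (le_max_left _ _).trans_lt hN
    have hN0 : (0 : ℝ) < N := hK0.trans hKN
    have hKδ : K / N < δ := by
      rw [div_lt_iff₀ hN0, mul_comm, ← div_lt_iff₀ hδ]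
      exact (le_max_right _ _).trans_lt hN
    set q : (ι → ℕ) → ι → ℝ := fun v i => v i / N with hq
    obtain ⟨v, hvN, hv⟩ := exists_lattice_change N (fun i => {v | 0 < g i (q v)})
      (fun i v hv => not_lt.2 (h0 i _ (by simp [hq, hv])).le)
      (fun i v hv => h1 i _ (by simp [hq, hv, hN0.ne']))
    have hvN' : ∀ j, (v j : ℝ) / N ≤ 1 := fun j => by
      rw [div_le_one hN0]; exact_mod_cast hvN j
    have near : ∀ w : ι → ℕ, (∀ j, v j ≤ w j ∧ w j ≤ v j + (Fintype.card ι + 1)) →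
        ∀ i, |g i (q w) - g i (q v)| < ε := by
      intro w hw i
      have hw1 : ∀ j, (v j : ℝ) / N ≤ w j / N := fun j => by
        gcongr; exact_mod_cast (hw j).1
      have hw2 : ∀ j, (w j : ℝ) / N ≤ v j / N + K / N := fun j => by
        rw [← add_div, hK]; gcongr; exact_mod_cast (hw j).2
      have hKN1 : K / N < 1 := (div_lt_one hN0).2 hKN
      have := H (q w) ⟨fun j => by simp only [hq, Pi.zero_apply]; positivity, fun j => by
        simp only [hq, Pi.ofNat_apply]; linarith [hw2 j, hvN' j]⟩ (q v)
        ⟨fun j => by simp only [hq, Pi.zero_apply]; positivity, fun j => by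
        simp only [hq, Pi.ofNat_apply]; linarith [hvN' j]⟩ ?_
      · exact (dist_le_pi_dist (fun i => g i (q w)) (fun i => g i (q v)) i).trans_lt this
      · rw [dist_pi_lt_iff hδ]
        intro j
        rw [Real.dist_eq, abs_of_nonneg (by simp only [hq]; linarith [hw1 j])]
        simp only [hq]
        linarith [hw2 j]
    refine ⟨q v, ⟨fun j => by simp only [hq, Pi.zero_apply]; positivity, hvN'⟩, fun i => ?_⟩
    obtain ⟨w, w', hw, hw', hb⟩ := hv i
    have n1 := near w (fun j => ⟨(hb j).1, (hb j).2.1⟩) i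
    have n2 := near w' (fun j => ⟨(hb j).2.2.1, (hb j).2.2.2⟩) i
    simp only [Set.mem_ofPred_eq, not_lt] at hw hw'
    rw [abs_lt] at n1 n2 ⊢
    constructor <;> linarith [n1.1, n1.2, n2.1, n2.2]
  have hcont : Continuous fun x => ∑ i, |g i x| := by fun_prop
  obtain ⟨x, hx, hmin⟩ := (isCompact_Icc (a := (0 : ι → ℝ)) (b := 1)).exists_isMinOn
    ⟨0, Set.left_mem_Icc.2 zero_le_one⟩ hcont.continuousOn
  refine ⟨x, hx, ?_⟩
  by_contra! hne
  obtain ⟨i, hi⟩ := hne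
  have hpos : 0 < ∑ i, |g i x| :=
    Finset.sum_pos' (fun _ _ => abs_nonneg _) ⟨i, Finset.mem_univ _, abs_pos.2 hi⟩
  -- With this tolerance the sum of the absolute values at `y` is strictly below its positive
  -- minimum.
  obtain ⟨y, hy, hyε⟩ := approx ((∑ i, |g i x|) / (Fintype.card ι + 1)) (by positivity)
  have h2 : ∑ i, |g i y| ≤ ∑ _i : ι, (∑ i, |g i x|) / (Fintype.card ι + 1) :=
    Finset.sum_le_sum fun i _ => (hyε i).le
  rw [Finset.sum_const, Finset.card_univ, nsmul_eq_mul, mul_div_assoc',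
    le_div_iff₀ (by positivity)] at h2
  have h3 : ∑ i, |g i x| ≤ ∑ i, |g i y| := hmin hy
  nlinarith

end PoincareMiranda

/-! ### A lower bound for the dimension of Euclidean space -/

section Dimension

/-- Cover `A` by finitely many sup-norm balls with rational radius and centres in (ℚ + c)ᵐ. The
least signed distance to these balls separates, and it vanishes only on faces of boxes, where some
coordinate lies in ℚ + c. -/
theorem exists_separating_function {m : ℕ} (A B : Set (Fin m → ℝ)) (hA : IsCompact A)
    (hB : IsCompact B) (hAB : Disjoint A B) (hne : A.Nonempty) (c : ℝ) :
    ∃ h : (Fin m → ℝ) → ℝ, Continuous h ∧ (∀ x ∈ A, h x < 0) ∧ (∀ x ∈ B, 0 < h x) ∧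
      ∀ x, h x = 0 → ∃ j, ∃ q : ℚ, x j = q + c := by
  obtain ⟨δ, hδ, hdist⟩ : ∃ δ > 0, ∀ x ∈ A, ∀ y ∈ B, δ ≤ dist x y := by
    obtain ⟨δ, hδ, h⟩ := hAB.exists_thickenings hA hB.isClosed
    refine ⟨δ, hδ, fun x hx y hy => ?_⟩
    by_contra! hlt
    exact h.le_bot ⟨Metric.mem_thickening_iff.2 ⟨x, hx, by rwa [dist_comm]⟩,
      Metric.self_subset_thickening hδ _ hy⟩
  -- Since 2ρ < δ, a ball of radius ρ that meets `A` misses `B`.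
  obtain ⟨ρ, hρ0, hρ⟩ := exists_rat_btwn (half_pos hδ)
  have hc : ∀ x : Fin m → ℝ, ∃ z : Fin m → ℝ, (∀ j, ∃ q : ℚ, z j = q + c) ∧ dist x z < ρ := by
    intro x
    have : ∀ j, ∃ q : ℚ, |x j - (q + c)| < ρ := fun j => by
      obtain ⟨q, h1, h2⟩ := exists_rat_btwn (show x j - c < x j - c + ρ by linarith)
      exact ⟨q, by rw [abs_lt]; constructor <;> linarith⟩
    choose q hq using this
    exact ⟨fun j => q j + c, fun j => ⟨q j, rfl⟩, (dist_pi_lt_iff hρ0).2 hq⟩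
  choose z hzq hz using hc
  obtain ⟨t, htA, htc⟩ := hA.elim_nhds_subcover (fun x => Metric.ball (z x) ρ)
    (fun x _ => Metric.isOpen_ball.mem_nhds (hz x))
  have htne : t.Nonempty := by
    rw [Finset.nonempty_iff_ne_empty]
    rintro rfl
    simp [hne.ne_empty] at htc
  refine ⟨fun x => t.inf' htne fun p => dist x (z p) - ρ, ?_, ?_, ?_, ?_⟩
  · exact Continuous.finset_inf'_apply htne fun p _ => by fun_prop
  · intro x hx
    obtain ⟨p, hp, hxp⟩ := Set.mem_iUnion₂.1 (htc hx)
    rw [Finset.inf'_lt_iff]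
    exact ⟨p, hp, sub_neg.2 hxp⟩
  · intro x hx
    rw [Finset.lt_inf'_iff]
    intro p hp
    have h1 := hdist p (htA p hp) x hx
    have h2 := dist_triangle p (z p) x
    have h3 := hz p
    rw [dist_comm (z p) x] at h2
    linarith
  · intro x hx
    obtain ⟨p, hp, hpx⟩ := t.exists_mem_eq_inf' htne fun p => dist x (z p) - ρ
    simp only at hx
    rw [hpx, sub_eq_zero] at hx
    have hall : ¬ dist x (z p) < ρ := hx.not_lt
    rw [dist_pi_lt_iff hρ0] at hall
    push Not at hall
    obtain ⟨j, hj⟩ := hall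
    have hj' : |x j - z p j| = ρ :=
      le_antisymm (hx ▸ dist_le_pi_dist x (z p) j) hj
    obtain ⟨q, hq⟩ := hzq p j
    rcases abs_eq hρ0.le |>.1 hj' with h | h
    · exact ⟨j, q + ρ, by push_cast; linarith⟩
    · exact ⟨j, q - ρ, by push_cast; linarith⟩

/-- A lower bound for the topological dimension of `ℝᵐ`: it admits no continuous map from an
`r`-dimensional cube with `r > m` under which the images of opposite facets are disjoint. -/
theorem le_of_cube_map_disjoint_facets {r m : ℕ} (φ : (Fin r → ℝ) → Fin m → ℝ)
    (hφ : ContinuousOn φ (Set.Icc 0 1))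
    (hd : ∀ i, ∀ x ∈ Set.Icc (0 : Fin r → ℝ) 1, ∀ y ∈ Set.Icc (0 : Fin r → ℝ) 1,
      x i = 0 → y i = 1 → φ x ≠ φ y) : r ≤ m := by
  set F : Fin r → ℝ → Set (Fin m → ℝ) := fun i c => φ '' (Set.Icc 0 1 ∩ {x | x i = c}) with hF
  have hFc : ∀ i c, IsCompact (F i c) := fun i c =>
    (isCompact_Icc.inter_right (isClosed_eq (continuous_apply i) continuous_const)).image_of_continuousOn
      (hφ.mono Set.inter_subset_left)
  -- The shifts `i * √2` lie in distinct classes modulo ℚ. At a common zero of all separating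
  -- functions, distinct `i` therefore involve distinct coordinates of ℝᵐ, and there are only `m` of
  -- them.
  have hsep := fun i : Fin r => exists_separating_function (F i 0) (F i 1) (hFc i 0) (hFc i 1)
    (by
      rw [Set.disjoint_left]
      rintro _ ⟨x, ⟨hx, hx0⟩, rfl⟩ ⟨y, ⟨hy, hy1⟩, hxy⟩
      exact hd i x hx y hy hx0 hy1 hxy.symm)
    ⟨φ 0, 0, ⟨Set.left_mem_Icc.2 zero_le_one, rfl⟩, rfl⟩ (i * √2)
  choose h hhc hh0 hh1 hhz using hsep
  -- Retraction onto the cube: `poincareMiranda` asks for functions continuous, and of known sign,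
  -- on entire hyperplanes.
  set cl : (Fin r → ℝ) → Fin r → ℝ := fun x i => Set.projIcc 0 1 zero_le_one (x i) with hcl
  have hclc : Continuous cl := continuous_pi fun i =>
    continuous_subtype_val.comp (continuous_projIcc.comp (continuous_apply i))
  have hclm : ∀ x, cl x ∈ Set.Icc (0 : Fin r → ℝ) 1 := fun x =>
    ⟨fun i => (Set.projIcc (0 : ℝ) 1 zero_le_one (x i)).2.1,
      fun i => (Set.projIcc (0 : ℝ) 1 zero_le_one (x i)).2.2⟩
  have hφc : Continuous fun x => φ (cl x) := hφ.comp_continuous hclc hclm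
  obtain ⟨x, -, hx⟩ := poincareMiranda (fun i x => h i (φ (cl x)))
    (fun i => (hhc i).comp hφc)
    (fun i x hx => hh0 i _ ⟨cl x, ⟨hclm x, by simp [hcl, hx]⟩, rfl⟩)
    (fun i x hx => hh1 i _ ⟨cl x, ⟨hclm x, by simp [hcl, hx]⟩, rfl⟩)
  choose j q hjq using fun i => hhz i _ (hx i)
  have hinj : Function.Injective j := by
    intro i i' hii
    have h1 := hjq i
    rw [hii, hjq i'] at h1
    by_contra hne
    have hne' : ((i : ℕ) : ℚ) - ((i' : ℕ) : ℚ) ≠ 0 := by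
      rw [sub_ne_zero]; exact_mod_cast fun h => hne (Fin.ext h)
    refine irrational_sqrt_two ⟨(q i' - q i) / (((i : ℕ) : ℚ) - ((i' : ℕ) : ℚ)), ?_⟩
    have hne'' : ((i : ℕ) : ℝ) - ((i' : ℕ) : ℝ) ≠ 0 := by exact_mod_cast hne'
    push_cast
    rw [div_eq_iff hne'']
    linarith
  simpa using Fintype.card_le_of_injective j hinj

end Dimension

noncomputable section

open SignType

/-! ### Semilinear sets and quantifier elimination -/

section Semilinear

/-- The affine function with integral linear part `a.1` and constant term `-a.2`. -/
def affEval {ι : Type*} [Fintype ι] (a : (ι → ℤ) × ℝ) (x : ι → ℝ) : ℝ :=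
  ∑ i, (a.1 i : ℝ) * x i - a.2

/-- Sets for which membership is determined by the signs of finitely many affine functions with
integral linear parts. -/
def IsSemilin {ι : Type*} [Fintype ι] (s : Set (ι → ℝ)) : Prop :=
  ∃ A : Finset ((ι → ℤ) × ℝ), ∀ x y,
    (∀ a ∈ A, sign (affEval a x) = sign (affEval a y)) → x ∈ s → y ∈ s

variable {ι κ : Type*} [Fintype ι] [Fintype κ]

theorem affEval_add (a b : (ι → ℤ) × ℝ) (x : ι → ℝ) :
    affEval (a + b) x = affEval a x + affEval b x := by
  simp only [affEval, Prod.fst_add, Prod.snd_add, Pi.add_apply, Int.cast_add, add_mul,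
    Finset.sum_add_distrib]
  ring

theorem affEval_zsmul (k : ℤ) (a : (ι → ℤ) × ℝ) (x : ι → ℝ) :
    affEval (k • a) x = k * affEval a x := by
  simp only [affEval, Prod.smul_fst, Prod.smul_snd, Pi.smul_apply, smul_eq_mul, Int.cast_mul,
    mul_sub, Finset.mul_sum, mul_assoc]
  rw [zsmul_eq_mul]

theorem affEval_sub (a b : (ι → ℤ) × ℝ) (x : ι → ℝ) :
    affEval (a - b) x = affEval a x - affEval b x := by
  have := affEval_add (a - b) b x
  rw [sub_add_cancel] at this
  linarith

theorem affEval_combo (a : (ι → ℤ) × ℝ) (x y : ι → ℝ) (t : ℝ) :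
    affEval a ((1 - t) • x + t • y) = (1 - t) * affEval a x + t * affEval a y := by
  simp only [affEval, Pi.add_apply, Pi.smul_apply, smul_eq_mul, mul_add, Finset.sum_add_distrib,
    mul_sub, Finset.mul_sum]
  have h1 : ∀ i, (a.1 i : ℝ) * ((1 - t) * x i) = (1 - t) * (a.1 i * x i) := fun i => by ring
  have h2 : ∀ i, (a.1 i : ℝ) * (t * y i) = t * (a.1 i * y i) := fun i => by ring
  simp only [h1, h2]
  ring

@[fun_prop]
theorem continuous_affEval (a : (ι → ℤ) × ℝ) : Continuous (affEval a) := by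
  unfold affEval; fun_prop

theorem affEval_update [DecidableEq ι] (a : (ι → ℤ) × ℝ) (x : ι → ℝ) (i : ι) (t : ℝ) :
    affEval a (Function.update x i t) = affEval (Function.update a.1 i 0, a.2) x + a.1 i * t := by
  simp only [affEval]
  rw [← Finset.add_sum_erase _ _ (Finset.mem_univ i), ← Finset.add_sum_erase (a := i)
    (f := fun j => ((Function.update a.1 i 0 j : ℤ) : ℝ) * x j) _ (Finset.mem_univ i)]
  have : ∑ j ∈ Finset.univ.erase i, (a.1 j : ℝ) * Function.update x i t j =
      ∑ j ∈ Finset.univ.erase i, ((Function.update a.1 i 0 j : ℤ) : ℝ) * x j :=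
    Finset.sum_congr rfl fun j hj => by simp [Finset.ne_of_mem_erase hj]
  rw [this]
  simp
  ring

namespace IsSemilin

theorem compl {s : Set (ι → ℝ)} (hs : IsSemilin s) : IsSemilin sᶜ := by
  obtain ⟨A, hA⟩ := hs
  exact ⟨A, fun x y h hx hy => hx (hA y x (fun a ha => (h a ha).symm) hy)⟩

theorem inter {s t : Set (ι → ℝ)} (hs : IsSemilin s) (ht : IsSemilin t) : IsSemilin (s ∩ t) := by
  classical
  obtain ⟨A, hA⟩ := hs
  obtain ⟨B, hB⟩ := ht
  exact ⟨A ∪ B, fun x y h hx => ⟨hA x y (fun a ha => h a (Finset.mem_union_left _ ha)) hx.1,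
    hB x y (fun a ha => h a (Finset.mem_union_right _ ha)) hx.2⟩⟩

theorem union {s t : Set (ι → ℝ)} (hs : IsSemilin s) (ht : IsSemilin t) : IsSemilin (s ∪ t) := by
  rw [← compl_compl (s ∪ t), Set.compl_union]
  exact (hs.compl.inter ht.compl).compl

theorem univ : IsSemilin (Set.univ : Set (ι → ℝ)) := ⟨∅, fun _ _ _ _ => trivial⟩

theorem empty : IsSemilin (∅ : Set (ι → ℝ)) := ⟨∅, fun _ _ _ h => h⟩

theorem biUnion {α : Type*} (J : Finset α) {s : α → Set (ι → ℝ)} (hs : ∀ a ∈ J, IsSemilin (s a)) :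
    IsSemilin (⋃ a ∈ J, s a) := by
  classical
  induction J using Finset.induction_on with
  | empty => simpa using empty
  | insert a J _ ih =>
    rw [Finset.set_biUnion_insert]
    exact (hs a (Finset.mem_insert_self _ _)).union
      (ih fun b hb => hs b (Finset.mem_insert_of_mem hb))

theorem exists_mem {α : Type*} (J : Finset α) {s : α → (ι → ℝ) → Prop}
    (hs : ∀ a ∈ J, IsSemilin {x | s a x}) : IsSemilin {x | ∃ a ∈ J, s a x} := by
  convert biUnion J hs using 1
  ext x; simp

theorem exists_fintype {α : Type*} [Finite α] {s : α → (ι → ℝ) → Prop}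
    (hs : ∀ a, IsSemilin {x | s a x}) : IsSemilin {x | ∃ a, s a x} := by
  have := Fintype.ofFinite α
  simpa using exists_mem (Finset.univ : Finset α) (s := s) fun a _ => hs a

theorem forall_fintype {α : Type*} [Finite α] {s : α → (ι → ℝ) → Prop}
    (hs : ∀ a, IsSemilin {x | s a x}) : IsSemilin {x | ∀ a, s a x} := by
  have := (exists_fintype (s := fun a x => ¬ s a x) fun a => (hs a).compl).compl
  convert this using 1
  ext x; simp

theorem and {p q : (ι → ℝ) → Prop} (hp : IsSemilin {x | p x}) (hq : IsSemilin {x | q x}) :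
    IsSemilin {x | p x ∧ q x} := hp.inter hq

theorem imp {p q : (ι → ℝ) → Prop} (hp : IsSemilin {x | p x}) (hq : IsSemilin {x | q x}) :
    IsSemilin {x | p x → q x} := by
  convert hp.compl.union hq using 1
  ext x; simp [imp_iff_not_or]

theorem affEval_nonpos (a : (ι → ℤ) × ℝ) : IsSemilin {x | affEval a x ≤ 0} := by
  refine ⟨{a}, fun x y h hx => ?_⟩
  have h1 := h a (by simp)
  simp only [Set.mem_ofPred_eq, ← not_lt, ← sign_eq_one_iff] at hx ⊢
  rwa [← h1]

theorem affEval_le (a b : (ι → ℤ) × ℝ) : IsSemilin {x | affEval a x ≤ affEval b x} := by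
  convert affEval_nonpos (a - b) using 3
  rw [affEval_sub, sub_nonpos]

theorem affEval_eq (a b : (ι → ℤ) × ℝ) : IsSemilin {x | affEval a x = affEval b x} := by
  convert (affEval_le a b).and (affEval_le b a) using 3
  exact le_antisymm_iff

theorem _root_.cmp_eq_cmp_of_sign_eq {a b c d : ℝ} (h : sign (a - b) = sign (c - d)) :
    cmp a b = cmp c d := by
  rcases lt_trichotomy a b with h1 | h1 | h1
  · rw [sign_neg (sub_neg.2 h1), eq_comm, sign_eq_neg_one_iff, sub_neg] at h
    rw [(cmp_eq_lt_iff _ _).2 h1, (cmp_eq_lt_iff _ _).2 h]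
  · rw [sub_eq_zero.2 h1, sign_zero, eq_comm, sign_eq_zero_iff, sub_eq_zero] at h
    rw [(cmp_eq_eq_iff _ _).2 h1, (cmp_eq_eq_iff _ _).2 h]
  · rw [sign_pos (sub_pos.2 h1), eq_comm, sign_eq_one_iff, sub_pos] at h
    rw [(cmp_eq_gt_iff _ _).2 h1, (cmp_eq_gt_iff _ _).2 h]

theorem _root_.sign_sub_eq_of_cmp_eq {a b c d : ℝ} (h : cmp a b = cmp c d) :
    sign (b - a) = sign (d - c) := by
  rcases lt_trichotomy a b with h1 | h1 | h1
  · rw [(cmp_eq_lt_iff _ _).2 h1, eq_comm, cmp_eq_lt_iff] at h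
    rw [sign_pos (sub_pos.2 h1), sign_pos (sub_pos.2 h)]
  · rw [(cmp_eq_eq_iff _ _).2 h1, eq_comm, cmp_eq_eq_iff] at h
    rw [sub_eq_zero.2 h1.symm, sub_eq_zero.2 h.symm]
  · rw [(cmp_eq_gt_iff _ _).2 h1, eq_comm, cmp_eq_gt_iff] at h
    rw [sign_neg (sub_neg.2 h1), sign_neg (sub_neg.2 h)]

/-- Elimination of an existential quantifier over one real variable. -/
theorem exists_update [DecidableEq ι] {s : Set (ι → ℝ)} (hs : IsSemilin s) (i : ι) :
    IsSemilin {x | ∃ t, Function.update x i t ∈ s} := by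
  classical
  obtain ⟨A, hA⟩ := hs
  -- `e a` is `a` without its term in the eliminated variable. The new list records the signs of all
  -- `e a` and of the differences `b i • e a - a i • e b`, which decide the order of the roots of
  -- `a` and `b` in that variable.
  set e : (ι → ℤ) × ℝ → (ι → ℤ) × ℝ := fun a => (Function.update a.1 i 0, a.2) with he
  refine ⟨A.image e ∪ (A ×ˢ A).image (fun p => p.2.1 i • e p.1 - p.1.1 i • e p.2), ?_⟩
  rintro x y h ⟨t, ht⟩
  have h1 : ∀ a ∈ A, sign (affEval (e a) x) = sign (affEval (e a) y) := fun a ha =>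
    h _ (Finset.mem_union_left _ (Finset.mem_image_of_mem e ha))
  have h2 : ∀ a ∈ A, ∀ b ∈ A, sign (b.1 i * affEval (e a) x - a.1 i * affEval (e b) x) =
      sign (b.1 i * affEval (e a) y - a.1 i * affEval (e b) y) := fun a ha b hb => by
    have := h _ (Finset.mem_union_right _
      (Finset.mem_image_of_mem (fun p : ((ι → ℤ) × ℝ) × ((ι → ℤ) × ℝ) =>
        p.2.1 i • e p.1 - p.1.1 i • e p.2) (Finset.mk_mem_product ha hb)))
    simpa only [affEval_sub, affEval_zsmul] using this
  set root : (ι → ℝ) → (ι → ℤ) × ℝ → ℝ := fun x a => -affEval (e a) x / a.1 i with hroot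
  have hr : ∀ z : ι → ℝ, ∀ a b : (ι → ℤ) × ℝ, a.1 i ≠ 0 → b.1 i ≠ 0 →
      sign (root z a - root z b) = sign (-((a.1 i * b.1 i : ℝ))⁻¹) *
        sign (b.1 i * affEval (e a) z - a.1 i * affEval (e b) z) := fun z a b ha hb => by
    have ha' : (a.1 i : ℝ) ≠ 0 := by exact_mod_cast ha
    have hb' : (b.1 i : ℝ) ≠ 0 := by exact_mod_cast hb
    rw [← sign_mul]
    congr 1
    simp only [hroot]
    field_simp
    ring
  -- The roots over `x` and those over `y` are ordered alike, so this finite partial isomorphism of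
  -- dense orders extends to `t`. Its image `t'` sits among the roots over `y` as `t` does among
  -- those over `x`.
  obtain ⟨t', ht'⟩ := Order.PartialIso.exists_across (α := ℝ) (β := ℝ)
    ⟨(A.filter fun a => a.1 i ≠ 0).image fun a => (root x a, root y a), by
      intro p hp q hq
      simp only [Finset.mem_image, Finset.mem_filter] at hp hq
      obtain ⟨a, ⟨ha, ha0⟩, rfl⟩ := hp
      obtain ⟨b, ⟨hb, hb0⟩, rfl⟩ := hq
      apply cmp_eq_cmp_of_sign_eq
      rw [hr x a b ha0 hb0, hr y a b ha0 hb0, h2 a ha b hb]⟩ t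
  refine ⟨t', hA _ _ (fun a ha => ?_) ht⟩
  rw [affEval_update, affEval_update]
  by_cases ha0 : a.1 i = 0
  · simpa [ha0] using h1 a ha
  · have h3 := sign_sub_eq_of_cmp_eq (ht' (root x a, root y a)
      (Finset.mem_image.2 ⟨a, Finset.mem_filter.2 ⟨ha, ha0⟩, rfl⟩))
    have ha' : (a.1 i : ℝ) ≠ 0 := by exact_mod_cast ha0
    have h4 : ∀ z u, affEval (e a) z + a.1 i * u = a.1 i * (u - root z a) := fun z u => by
      simp only [hroot]; field_simp; ring
    rw [h4, h4, sign_mul, sign_mul, h3]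

theorem exists_piecewise [DecidableEq ι] {s : Set (ι → ℝ)} (hs : IsSemilin s) (J : Finset ι) :
    IsSemilin {x | ∃ z : ι → ℝ, (fun i => if i ∈ J then z i else x i) ∈ s} := by
  induction J using Finset.induction_on with
  | empty => simpa using! hs
  | insert j J hj ih =>
    convert ih.exists_update j using 1
    ext x
    simp only [Set.mem_ofPred_eq]
    constructor
    · rintro ⟨z, hz⟩
      refine ⟨z j, z, ?_⟩
      convert hz using 2 with i
      by_cases hi : i = j
      · subst hi; simp [hj]
      · simp [hi]
    · rintro ⟨t, z, hz⟩
      refine ⟨Function.update z j t, ?_⟩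
      convert hz using 2 with i
      by_cases hi : i = j
      · subst hi; simp [hj]
      · simp [hi]

theorem comap_elim {s : Set (ι ⊕ κ → ℝ)} (hs : IsSemilin s) (z : κ → ℝ) :
    IsSemilin {y : ι → ℝ | Sum.elim y z ∈ s} := by
  classical
  obtain ⟨A, hA⟩ := hs
  refine ⟨A.image fun a => (a.1 ∘ Sum.inl, a.2 - ∑ k, (a.1 (Sum.inr k) : ℝ) * z k),
    fun x y h hx => hA _ _ (fun a ha => ?_) hx⟩
  have h1 := h _ (Finset.mem_image_of_mem _ ha)
  convert h1 using 2 <;> simp [affEval] <;> ring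

/-- Elimination of an existential quantifier over several real variables. -/
theorem exists_elim {s : Set (ι ⊕ κ → ℝ)} (hs : IsSemilin s) :
    IsSemilin {y : ι → ℝ | ∃ z : κ → ℝ, Sum.elim y z ∈ s} := by
  classical
  convert (hs.exists_piecewise (Finset.univ.image Sum.inr)).comap_elim (0 : κ → ℝ) using 1
  ext y
  simp only [Set.mem_ofPred_eq]
  constructor
  · rintro ⟨z, hz⟩
    refine ⟨Sum.elim 0 z, ?_⟩
    convert hz using 2 with i
    rcases i with i | i <;> simp
  · rintro ⟨z, hz⟩
    refine ⟨z ∘ Sum.inr, ?_⟩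
    convert hz using 2 with i
    rcases i with i | i <;> simp

/-- Elimination of a universal quantifier over several real variables. -/
theorem forall_elim {s : Set (ι ⊕ κ → ℝ)} (hs : IsSemilin s) :
    IsSemilin {y : ι → ℝ | ∀ z : κ → ℝ, Sum.elim y z ∈ s} := by
  convert hs.compl.exists_elim.compl using 1
  ext y; simp

end IsSemilin

/-- Piecewise affine functions with finitely many pieces, integral linear parts, and semilinear
pieces. -/
def IsPiecewiseAff (F : (ι → ℝ) → ℝ) : Prop :=
  ∃ L : Finset ((ι → ℤ) × ℝ), (∀ x, ∃ l ∈ L, F x = affEval l x) ∧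
    ∀ l ∈ L, IsSemilin {x | F x = affEval l x}

theorem isPiecewiseAff_affEval (a : (ι → ℤ) × ℝ) : IsPiecewiseAff (affEval a) :=
  ⟨{a}, fun x => ⟨a, by simp⟩, fun l _ => IsSemilin.affEval_eq a l⟩

theorem isPiecewiseAff_const (c : ℝ) : IsPiecewiseAff fun _ : ι → ℝ => c := by
  convert isPiecewiseAff_affEval (ι := ι) (0, -c) using 2
  simp [affEval]

theorem isPiecewiseAff_apply (i : ι) : IsPiecewiseAff fun x : ι → ℝ => x i := by
  classical
  convert isPiecewiseAff_affEval (ι := ι) (Pi.single i 1, 0) using 2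
  simp [affEval, Pi.single_apply]

namespace IsPiecewiseAff

variable {F H : (ι → ℝ) → ℝ}

theorem setOf_rel (hF : IsPiecewiseAff F) (hH : IsPiecewiseAff H) {r : ℝ → ℝ → Prop}
    (hr : ∀ a b : (ι → ℤ) × ℝ, IsSemilin {x | r (affEval a x) (affEval b x)}) :
    IsSemilin {x | r (F x) (H x)} := by
  obtain ⟨L, hL, hLs⟩ := hF
  obtain ⟨M, hM, hMs⟩ := hH
  convert IsSemilin.exists_mem L (s := fun l x => F x = affEval l x ∧
    ∃ m ∈ M, H x = affEval m x ∧ r (affEval l x) (affEval m x))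
    (fun l hl => (hLs l hl).and (IsSemilin.exists_mem M fun m hm => (hMs m hm).and (hr l m))) using 1
  ext x
  simp only [Set.mem_ofPred_eq]
  constructor
  · intro h
    obtain ⟨l, hl, hx⟩ := hL x
    obtain ⟨m, hm, hx'⟩ := hM x
    exact ⟨l, hl, hx, m, hm, hx', hx ▸ hx' ▸ h⟩
  · rintro ⟨l, hl, hx, m, hm, hx', h⟩
    rwa [hx, hx']

theorem setOf_le (hF : IsPiecewiseAff F) (hH : IsPiecewiseAff H) : IsSemilin {x | F x ≤ H x} :=
  hF.setOf_rel hH fun a b => IsSemilin.affEval_le a b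

theorem setOf_eq (hF : IsPiecewiseAff F) (hH : IsPiecewiseAff H) : IsSemilin {x | F x = H x} :=
  hF.setOf_rel hH fun a b => IsSemilin.affEval_eq a b

theorem add (hF : IsPiecewiseAff F) (hH : IsPiecewiseAff H) :
    IsPiecewiseAff fun x => F x + H x := by
  classical
  obtain ⟨L, hL, -⟩ := id hF
  obtain ⟨M, hM, -⟩ := id hH
  refine ⟨(L ×ˢ M).image fun p => p.1 + p.2, fun x => ?_, fun l _ => ?_⟩
  · obtain ⟨l, hl, hx⟩ := hL x
    obtain ⟨m, hm, hx'⟩ := hM x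
    exact ⟨l + m, Finset.mem_image.2 ⟨(l, m), Finset.mk_mem_product hl hm, rfl⟩,
      by simp only [affEval_add, hx, hx']⟩
  · convert IsSemilin.exists_mem L (s := fun a x => F x = affEval a x ∧
      ∃ b ∈ M, H x = affEval b x ∧ affEval (a + b) x = affEval l x)
      (fun a _ => (hF.setOf_eq (isPiecewiseAff_affEval a)).and (IsSemilin.exists_mem M fun b _ =>
        (hH.setOf_eq (isPiecewiseAff_affEval b)).and (IsSemilin.affEval_eq _ _))) using 1
    ext x
    simp only [Set.mem_ofPred_eq]
    constructor
    · intro h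
      obtain ⟨a, ha, hx⟩ := hL x
      obtain ⟨b, hb, hx'⟩ := hM x
      exact ⟨a, ha, hx, b, hb, hx', by rw [affEval_add, ← hx, ← hx', h]⟩
    · rintro ⟨a, ha, hx, b, hb, hx', h⟩
      rw [hx, hx', ← h, affEval_add]

theorem zmul (hF : IsPiecewiseAff F) (k : ℤ) : IsPiecewiseAff fun x => k * F x := by
  classical
  obtain ⟨L, hL, -⟩ := id hF
  refine ⟨L.image fun l => k • l, fun x => ?_, fun l _ => ?_⟩
  · obtain ⟨l, hl, hx⟩ := hL x
    exact ⟨k • l, Finset.mem_image_of_mem _ hl, by simp only [affEval_zsmul, hx]⟩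
  · refine hF.setOf_rel (isPiecewiseAff_affEval l) (r := fun u v => k * u = v) fun a b => ?_
    simpa only [affEval_zsmul] using IsSemilin.affEval_eq (k • a) b

theorem posPart (hF : IsPiecewiseAff F) : IsPiecewiseAff fun x => max (F x) 0 := by
  classical
  obtain ⟨L, hL, -⟩ := id hF
  have h0 : ∀ x : ι → ℝ, affEval 0 x = 0 := fun x => by simp [affEval]
  refine ⟨insert 0 L, fun x => ?_, fun l _ => ?_⟩
  · obtain ⟨l, hl, hx⟩ := hL x
    rcases le_total (F x) 0 with h | h
    · exact ⟨0, by simp, by simp only [h0, max_eq_right h]⟩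
    · exact ⟨l, by simp [hl], by rw [← hx]; exact max_eq_left h⟩
  · refine hF.setOf_rel (isPiecewiseAff_affEval l) (r := fun u v => max u 0 = v) fun a b => ?_
    convert ((IsSemilin.affEval_le a 0).and (IsSemilin.affEval_eq 0 b)).union
      ((IsSemilin.affEval_le 0 a).and (IsSemilin.affEval_eq a b)) using 1
    ext x
    simp only [Set.mem_ofPred_eq, Set.mem_union, h0]
    grind

theorem sum {α : Type*} (J : Finset α) {F : α → (ι → ℝ) → ℝ} (hF : ∀ a ∈ J, IsPiecewiseAff (F a)) :
    IsPiecewiseAff fun x => ∑ a ∈ J, F a x := by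
  classical
  induction J using Finset.induction_on with
  | empty => simpa using isPiecewiseAff_const 0
  | insert a J ha ih =>
    simp only [Finset.sum_insert ha]
    exact (hF a (Finset.mem_insert_self _ _)).add
      (ih fun b hb => hF b (Finset.mem_insert_of_mem hb))

end IsPiecewiseAff

end Semilinear

/-! ### Semilinear sets are definable -/

namespace WeightedGraph

variable {ι : Type*} [Fintype ι]

theorem IsDefinable.univ : IsDefinable (Set.univ : Set (EuclideanSpace ℝ ι)) := by
  convert IsDefinable.halfSpace (0 : EuclideanSpace ℝ ι) 0
  simp

theorem IsDefinable.biUnion {α : Type*} (J : Finset α) {s : α → Set (EuclideanSpace ℝ ι)}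
    (hs : ∀ a ∈ J, IsDefinable (s a)) : IsDefinable (⋃ a ∈ J, s a) := by
  classical
  induction J using Finset.induction_on with
  | empty => simpa using IsDefinable.univ.compl
  | insert a J _ ih =>
    rw [Finset.set_biUnion_insert]
    exact (hs a (Finset.mem_insert_self _ _)).union
      (ih fun b hb => hs b (Finset.mem_insert_of_mem hb))

theorem IsDefinable.biInter {α : Type*} (J : Finset α) {s : α → Set (EuclideanSpace ℝ ι)}
    (hs : ∀ a ∈ J, IsDefinable (s a)) : IsDefinable (⋂ a ∈ J, s a) := by
  classical
  induction J using Finset.induction_on with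
  | empty => simpa using IsDefinable.univ
  | insert a J _ ih =>
    rw [Finset.set_biInter_insert]
    exact (hs a (Finset.mem_insert_self _ _)).inter
      (ih fun b hb => hs b (Finset.mem_insert_of_mem hb))

theorem isDefinable_affEval_nonneg (a : (ι → ℤ) × ℝ) :
    IsDefinable {y : EuclideanSpace ℝ ι | 0 ≤ affEval a y.ofLp} := by
  convert IsDefinable.halfSpace (WithLp.toLp 2 fun i => (a.1 i : ℝ)) a.2 using 3 with y
  simp [affEval, PiLp.inner_apply]

theorem isDefinable_sign_affEval (a : (ι → ℤ) × ℝ) (s : SignType) :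
    IsDefinable {y : EuclideanSpace ℝ ι | sign (affEval a y.ofLp) = s} := by
  have h1 := isDefinable_affEval_nonneg a
  have h2 := isDefinable_affEval_nonneg ((-1 : ℤ) • a)
  simp only [affEval_zsmul, Int.cast_neg, Int.cast_one, neg_mul, one_mul, Left.nonneg_neg_iff] at h2
  rcases s.trichotomy with rfl | rfl | rfl
  · convert h1.compl using 1
    ext; simp [sign_eq_neg_one_iff]
  · convert h1.inter h2 using 1
    ext
    simp only [sign_eq_zero_iff, Set.mem_ofPred_eq, Set.mem_inter_iff]
    rw [eq_comm, le_antisymm_iff]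
  · convert h2.compl using 1
    ext; simp [sign_eq_one_iff]

/-- The set is the finite union, over the sign vectors realized on `s`, of the sets of points with
that sign vector. -/
theorem IsSemilin.isDefinable {s : Set (ι → ℝ)} (hs : IsSemilin s) :
    IsDefinable {y : EuclideanSpace ℝ ι | y.ofLp ∈ s} := by
  classical
  obtain ⟨A, hA⟩ := hs
  convert IsDefinable.biUnion (Finset.univ.filter fun σ : A → SignType =>
      ∃ x ∈ s, ∀ a : A, sign (affEval a.1 x) = σ a)
    (s := fun σ => ⋂ a ∈ (Finset.univ : Finset A),
      {y : EuclideanSpace ℝ ι | sign (affEval a.1 y.ofLp) = σ a})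
    (fun σ _ => IsDefinable.biInter _ fun a _ => isDefinable_sign_affEval _ _) using 1
  ext y
  simp only [Set.mem_ofPred_eq, Finset.mem_filter, Finset.mem_univ, true_and, Set.mem_iUnion,
    Set.iInter_true, Set.mem_iInter, exists_prop]
  constructor
  · intro hy
    exact ⟨fun a => sign (affEval a.1 y.ofLp), ⟨_, hy, fun _ => rfl⟩, fun _ => rfl⟩
  · rintro ⟨σ, ⟨x, hx, hxσ⟩, hyσ⟩
    exact hA x _ (fun a ha => (hxσ ⟨a, ha⟩).trans (hyσ ⟨a, ha⟩).symm) hx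

end WeightedGraph

end

noncomputable section

open Set Filter Topology

/-! ### One-sided slopes of piecewise linear functions -/

section Slopes

/-- `u` is affine with slope `k` immediately to the right of `t`. -/
def HasRightSlope (u : ℝ → ℝ) (t k : ℝ) : Prop :=
  ∃ ε > 0, ∀ z ∈ Icc t (t + ε), u z = u t + k * (z - t)

/-- `u` is affine with outgoing slope `k` immediately to the left of `t`. -/
def HasLeftSlope (u : ℝ → ℝ) (t k : ℝ) : Prop :=
  ∃ ε > 0, ∀ z ∈ Icc (t - ε) t, u z = u t + k * (t - z)

variable {u v : ℝ → ℝ} {t k l : ℝ}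

theorem HasRightSlope.derivWithin (h : HasRightSlope u t k) : derivWithin u (Ioi t) t = k := by
  obtain ⟨ε, hε, h⟩ := h
  have h1 : HasDerivAt (fun z => u t + k * (z - t)) k t := by
    simpa using! (((hasDerivAt_id t).sub_const t).const_mul k).const_add (u t)
  refine HasDerivWithinAt.derivWithin ?_ (uniqueDiffWithinAt_Ioi t)
  refine h1.hasDerivWithinAt.congr_of_eventuallyEq ?_ (by simp)
  filter_upwards [Ioo_mem_nhdsGT (show t < t + ε by linarith)] with z hz
  exact h z ⟨hz.1.le, hz.2.le⟩

theorem HasLeftSlope.derivWithin (h : HasLeftSlope u t k) : -derivWithin u (Iio t) t = k := by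
  obtain ⟨ε, hε, h⟩ := h
  have h1 : HasDerivAt (fun z => u t + -k * (z - t)) (-k) t := by
    simpa using! (((hasDerivAt_id t).sub_const t).const_mul (-k)).const_add (u t)
  rw [neg_eq_iff_eq_neg]
  refine HasDerivWithinAt.derivWithin ?_ (uniqueDiffWithinAt_Iio t)
  refine h1.hasDerivWithinAt.congr_of_eventuallyEq ?_ (by simp)
  filter_upwards [Ioo_mem_nhdsLT (show t - ε < t by linarith)] with z hz
  rw [h z ⟨hz.1.le, hz.2.le⟩]
  ring

theorem HasRightSlope.unique (h : HasRightSlope u t k) (h' : HasRightSlope u t l) : k = l :=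
  h.derivWithin.symm.trans h'.derivWithin

theorem HasLeftSlope.unique (h : HasLeftSlope u t k) (h' : HasLeftSlope u t l) : k = l :=
  h.derivWithin.symm.trans h'.derivWithin

theorem HasRightSlope.congr (h : HasRightSlope u t k) {b : ℝ} (hb : t < b)
    (huv : ∀ z ∈ Icc t b, v z = u z) : HasRightSlope v t k := by
  obtain ⟨ε, hε, h⟩ := h
  refine ⟨min ε (b - t), lt_min hε (sub_pos.2 hb), fun z hz => ?_⟩
  have h1 : z ≤ t + ε := hz.2.trans (by gcongr; exact min_le_left _ _)
  have h2 : z ≤ b := by linarith [hz.2, min_le_right ε (b - t)]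
  rw [huv z ⟨hz.1, h2⟩, huv t ⟨le_rfl, hb.le⟩, h z ⟨hz.1, h1⟩]

theorem HasLeftSlope.congr (h : HasLeftSlope u t k) {a : ℝ} (ha : a < t)
    (huv : ∀ z ∈ Icc a t, v z = u z) : HasLeftSlope v t k := by
  obtain ⟨ε, hε, h⟩ := h
  refine ⟨min ε (t - a), lt_min hε (sub_pos.2 ha), fun z hz => ?_⟩
  have h1 : t - ε ≤ z := by linarith [hz.1, min_le_left ε (t - a)]
  have h2 : a ≤ z := by linarith [hz.1, min_le_right ε (t - a)]
  rw [huv z ⟨h2, hz.2⟩, huv t ⟨ha.le, le_rfl⟩, h z ⟨h1, hz.2⟩]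

theorem HasRightSlope.add (hu : HasRightSlope u t k) (hv : HasRightSlope v t l) :
    HasRightSlope (fun z => u z + v z) t (k + l) := by
  obtain ⟨ε, hε, hu⟩ := hu
  obtain ⟨δ, hδ, hv⟩ := hv
  refine ⟨min ε δ, lt_min hε hδ, fun z hz => ?_⟩
  simp only
  rw [hu z ⟨hz.1, hz.2.trans (by gcongr; exact min_le_left _ _)⟩,
    hv z ⟨hz.1, hz.2.trans (by gcongr; exact min_le_right _ _)⟩]
  ring

theorem HasLeftSlope.add (hu : HasLeftSlope u t k) (hv : HasLeftSlope v t l) :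
    HasLeftSlope (fun z => u z + v z) t (k + l) := by
  obtain ⟨ε, hε, hu⟩ := hu
  obtain ⟨δ, hδ, hv⟩ := hv
  refine ⟨min ε δ, lt_min hε hδ, fun z hz => ?_⟩
  simp only
  rw [hu z ⟨by linarith [hz.1, min_le_left ε δ], hz.2⟩,
    hv z ⟨by linarith [hz.1, min_le_right ε δ], hz.2⟩]
  ring

theorem HasRightSlope.const_mul (c : ℝ) (hu : HasRightSlope u t k) :
    HasRightSlope (fun z => c * u z) t (c * k) := by
  obtain ⟨ε, hε, hu⟩ := hu
  refine ⟨ε, hε, fun z hz => ?_⟩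
  simp only [hu z hz]
  ring

theorem HasLeftSlope.const_mul (c : ℝ) (hu : HasLeftSlope u t k) :
    HasLeftSlope (fun z => c * u z) t (c * k) := by
  obtain ⟨ε, hε, hu⟩ := hu
  refine ⟨ε, hε, fun z hz => ?_⟩
  simp only [hu z hz]
  ring

theorem hasRightSlope_affine (a k t : ℝ) : HasRightSlope (fun z => a + k * z) t k :=
  ⟨1, one_pos, fun z _ => by ring⟩

theorem hasLeftSlope_affine (a k t : ℝ) : HasLeftSlope (fun z => a + k * z) t (-k) :=
  ⟨1, one_pos, fun z _ => by ring⟩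

theorem HasRightSlope.sum {α : Type*} (J : Finset α) {u : α → ℝ → ℝ} {k : α → ℝ}
    (h : ∀ a ∈ J, HasRightSlope (u a) t (k a)) :
    HasRightSlope (fun z => ∑ a ∈ J, u a z) t (∑ a ∈ J, k a) := by
  classical
  induction J using Finset.induction_on with
  | empty => simpa using hasRightSlope_affine 0 0 t
  | insert a J ha ih =>
    simp only [Finset.sum_insert ha]
    exact (h a (Finset.mem_insert_self _ _)).add
      (ih fun b hb => h b (Finset.mem_insert_of_mem hb))

theorem HasLeftSlope.sum {α : Type*} (J : Finset α) {u : α → ℝ → ℝ} {k : α → ℝ}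
    (h : ∀ a ∈ J, HasLeftSlope (u a) t (k a)) :
    HasLeftSlope (fun z => ∑ a ∈ J, u a z) t (∑ a ∈ J, k a) := by
  classical
  induction J using Finset.induction_on with
  | empty => simpa using hasLeftSlope_affine 0 0 t
  | insert a J ha ih =>
    simp only [Finset.sum_insert ha]
    exact (h a (Finset.mem_insert_self _ _)).add
      (ih fun b hb => h b (Finset.mem_insert_of_mem hb))

theorem hasRightSlope_posPart (y t : ℝ) :
    HasRightSlope (fun z => max (z - y) 0) t (if y ≤ t then 1 else 0) := by
  split_ifs with h
  · refine ⟨1, one_pos, fun z hz => ?_⟩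
    simp only
    rw [max_eq_left (by linarith [hz.1]), max_eq_left (by linarith)]
    ring
  · push Not at h
    refine ⟨y - t, by linarith, fun z hz => ?_⟩
    simp only
    rw [max_eq_right (by linarith [hz.2]), max_eq_right (by linarith)]
    ring

theorem hasLeftSlope_posPart (y t : ℝ) :
    HasLeftSlope (fun z => max (z - y) 0) t (-if y < t then 1 else 0) := by
  split_ifs with h
  · refine ⟨t - y, by linarith, fun z hz => ?_⟩
    simp only
    rw [max_eq_left (by linarith [hz.1]), max_eq_left (by linarith)]
    ring
  · push Not at h
    refine ⟨1, one_pos, fun z hz => ?_⟩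
    simp only
    rw [max_eq_right (by linarith [hz.2]), max_eq_right (by linarith)]
    ring

theorem hasRightSlope_posPart_rev (y t : ℝ) :
    HasRightSlope (fun z => max (y - z) 0) t (-if t < y then 1 else 0) := by
  split_ifs with h
  · refine ⟨y - t, by linarith, fun z hz => ?_⟩
    simp only
    rw [max_eq_left (by linarith [hz.2]), max_eq_left (by linarith)]
    ring
  · push Not at h
    refine ⟨1, one_pos, fun z hz => ?_⟩
    simp only
    rw [max_eq_right (by linarith [hz.1]), max_eq_right (by linarith)]
    ring

theorem hasLeftSlope_posPart_rev (y t : ℝ) :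
    HasLeftSlope (fun z => max (y - z) 0) t (if t ≤ y then 1 else 0) := by
  split_ifs with h
  · refine ⟨1, one_pos, fun z hz => ?_⟩
    simp only
    rw [max_eq_left (by linarith [hz.2]), max_eq_left (by linarith)]
    ring
  · push Not at h
    refine ⟨t - y, by linarith, fun z hz => ?_⟩
    simp only
    rw [max_eq_right (by linarith [hz.1]), max_eq_right (by linarith)]
    ring

/-- Real induction on the set of `t` such that `h` vanishes on `[0, t]`: it is closed, and it
extends to the right of each of its points because the slope never changes. -/
theorem eqOn_zero_of_slopes {h : ℝ → ℝ} {L : ℝ} (hc : ContinuousOn h (Icc 0 L)) (h0 : h 0 = 0)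
    (hs : ∀ t ∈ Ico 0 L, ∃ k, HasRightSlope h t k ∧ (t = 0 → k = 0) ∧
      (0 < t → HasLeftSlope h t (-k))) :
    ∀ t ∈ Icc 0 L, h t = 0 := by
  rcases lt_or_ge L 0 with hL | hL
  · intro t ht
    linarith [ht.1, ht.2]
  have key : Icc 0 L ⊆ {t | ∀ z ∈ Icc 0 t, h z = 0} := by
    refine IsClosed.Icc_subset_of_forall_mem_nhdsWithin ?_ ?_ ?_
    · rw [← isSeqClosed_iff_isClosed]
      intro x p hx hxp
      have hp : p ∈ Icc 0 L := isClosed_Icc.mem_of_tendsto hxp (.of_forall fun n => (hx n).2)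
      refine ⟨fun z hz => ?_, hp⟩
      rcases hz.2.lt_or_eq with hzp | rfl
      · obtain ⟨n, hn⟩ := (hxp.eventually (lt_mem_nhds hzp)).exists
        exact (hx n).1 z ⟨hz.1, hn.le⟩
      · have h1 : Tendsto (fun n => h (x n)) atTop (𝓝 (h z)) :=
          (hc z hp).tendsto.comp (tendsto_nhdsWithin_iff.2 ⟨hxp, .of_forall fun n => (hx n).2⟩)
        have h2 : (fun n => h (x n)) = fun _ => 0 := by
          ext n
          exact (hx n).1 _ ⟨(hx n).2.1, le_rfl⟩
        rw [h2] at h1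
        exact tendsto_nhds_unique h1 tendsto_const_nhds
    · intro z hz
      rw [le_antisymm hz.2 hz.1, h0]
    · rintro t ⟨ht, htL⟩
      obtain ⟨k, hr, hk0, hl⟩ := hs t htL
      have hk : k = 0 := by
        rcases htL.1.eq_or_lt with hpos | hpos
        · exact hk0 hpos.symm
        · have : HasLeftSlope h t 0 := by
            refine ⟨t, hpos, fun z hz => ?_⟩
            rw [ht z ⟨by linarith [hz.1], hz.2⟩, ht t ⟨hpos.le, le_rfl⟩]
            ring
          have := (hl hpos).unique this
          linarith
      obtain ⟨ε, hε, hr⟩ := hr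
      refine mem_of_superset (Ioo_mem_nhdsGT (show t < t + ε by linarith)) ?_
      intro z hz w hw
      rcases le_total w t with hwt | hwt
      · exact ht w ⟨hw.1, hwt⟩
      · rw [hr w ⟨hwt, hw.2.trans hz.2.le⟩, hk, ht t ⟨htL.1, le_rfl⟩]
        ring
  intro t ht
  exact key ht t ⟨ht.1, le_rfl⟩

end Slopes

/-! ### The topology of the metric graph, and divisors as functionals -/

namespace WeightedGraph

variable {V E : Type*} (G : WeightedGraph V E)

theorem pt_of_nonpos (e : E) {y : ℝ} (h : y ≤ 0) : G.pt e y = .vertex (G.src e) := by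
  simp [pt, not_lt.2 h]

@[simp] theorem pt_zero (e : E) : G.pt e 0 = .vertex (G.src e) := G.pt_of_nonpos e le_rfl

theorem pt_of_len_le (e : E) {y : ℝ} (h : G.len e ≤ y) : G.pt e y = .vertex (G.tgt e) := by
  simp [pt, not_lt.2 h, (G.len_pos e).trans_le h]

@[simp] theorem pt_len (e : E) : G.pt e (G.len e) = .vertex (G.tgt e) := G.pt_of_len_le e le_rfl

theorem pt_of_mem_Ioo (e : E) {y : ℝ} (h0 : 0 < y) (h1 : y < G.len e) :
    G.pt e y = .inner e y h0 h1 := by simp [pt, h0, h1]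

theorem pt_projIcc (e : E) (y : ℝ) :
    G.pt e (projIcc 0 (G.len e) (G.len_pos e).le y) = G.pt e y := by
  rcases le_total y 0 with h | h
  · rw [projIcc_of_le_left _ h, G.pt_of_nonpos e h, pt_zero]
  rcases le_total (G.len e) y with h' | h'
  · rw [projIcc_of_right_le _ h', G.pt_of_len_le e h', pt_len]
  · rw [projIcc_of_mem _ ⟨h, h'⟩]

theorem continuous_pt (e : E) : Continuous (G.pt e) := by
  have h : Continuous fun y : Icc (0 : ℝ) (G.len e) => G.pt e y :=
    continuous_iff_coinduced_le.2 (le_iSup (fun e : E => TopologicalSpace.coinduced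
      (fun y : Icc (0 : ℝ) (G.len e) => G.pt e y) inferInstance) e)
  convert h.comp (continuous_projIcc (h := (G.len_pos e).le)) using 1
  ext y
  exact (G.pt_projIcc e y).symm

theorem continuous_of_pt {Y : Type*} [TopologicalSpace Y] {f : G.Point → Y}
    (h : ∀ e, ContinuousOn (fun y => f (G.pt e y)) (Icc 0 (G.len e))) : Continuous f := by
  rw [continuous_iSup_dom]
  intro e
  rw [continuous_coinduced_dom]
  exact (h e).domRestrict

theorem isOpen_of_pt {s : Set G.Point}
    (h : ∀ e, IsOpen {y : Icc (0 : ℝ) (G.len e) | G.pt e y ∈ s}) : IsOpen s := by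
  rw [isOpen_iSup_iff]
  intro e
  rw [isOpen_coinduced]
  exact h e

/-- The level sets of `f` are clopen. -/
theorem eq_of_forall_edge [ConnectedSpace G.Point] {f : G.Point → ℝ} (h : ∀ e, ∀ t ∈ Icc 0 (G.len e),
    f (G.pt e t) = f (.vertex (G.src e))) (x y : G.Point) : f x = f y := by
  have hc : IsClopen (f ⁻¹' {f y}) := by
    constructor
    · exact isClosed_singleton.preimage (G.continuous_of_pt fun e =>
        continuousOn_const.congr (h e))
    · refine G.isOpen_of_pt fun e => ?_
      by_cases hs : f (.vertex (G.src e)) = f y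
      · convert isOpen_univ
        ext t
        simp [h e t t.2, hs]
      · convert isOpen_empty
        ext t
        simp [h e t t.2, hs]
  rcases isClopen_iff.1 hc with h' | h'
  · exact absurd (show y ∈ f ⁻¹' {f y} from rfl) (h' ▸ notMem_empty y)
  · exact (h' ▸ mem_univ x : x ∈ f ⁻¹' {f y})

section Connected

variable [ConnectedSpace G.Point] [Nontrivial G.Point]

/-- A point on no closed edge is both open and closed, so by connectedness it would be the whole
graph. -/
theorem exists_pt_eq (x : G.Point) : ∃ e, ∃ t ∈ Icc 0 (G.len e), G.pt e t = x := by
  by_contra! hx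
  have h : IsClopen ({x} : Set G.Point) := by
    constructor
    · rw [← isOpen_compl_iff]
      refine G.isOpen_of_pt fun e => ?_
      convert isOpen_univ
      ext y
      simpa using! hx e y y.2
    · refine G.isOpen_of_pt fun e => ?_
      convert isOpen_empty
      ext y
      simpa using! hx e y y.2
  rcases isClopen_iff.1 h with h | h
  · exact (singleton_nonempty x).ne_empty h
  · exact nontrivial_univ.ne_singleton h.symm

theorem compactSpace_point [Finite E] : CompactSpace G.Point := by
  refine ⟨?_⟩
  have : (univ : Set G.Point) = ⋃ e, G.pt e '' Icc 0 (G.len e) := by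
    ext x
    obtain ⟨e, t, ht, rfl⟩ := G.exists_pt_eq x
    simp only [mem_univ, true_iff, mem_iUnion]
    exact ⟨e, t, ht, rfl⟩
  rw [this]
  exact isCompact_iUnion fun e => isCompact_Icc.image (G.continuous_pt e)

end Connected

/-- The function with given values at the vertices and given restrictions to the open edges. -/
def glue (p : V → ℝ) (u : E → ℝ → ℝ) : G.Point → ℝ
  | .vertex v => p v
  | .inner e y _ _ => u e y

theorem glue_pt {p : V → ℝ} {u : E → ℝ → ℝ} {e : E} (h0 : u e 0 = p (G.src e))
    (h1 : u e (G.len e) = p (G.tgt e)) {t : ℝ} (ht : t ∈ Icc 0 (G.len e)) :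
    G.glue p u (G.pt e t) = u e t := by
  rcases ht.1.eq_or_lt with rfl | h
  · simp [glue, h0]
  rcases ht.2.eq_or_lt with rfl | h'
  · simp [glue, h1]
  · rw [G.pt_of_mem_Ioo e h h']; rfl

theorem continuous_glue {p : V → ℝ} {u : E → ℝ → ℝ} (h0 : ∀ e, u e 0 = p (G.src e))
    (h1 : ∀ e, u e (G.len e) = p (G.tgt e)) (hu : ∀ e, ContinuousOn (u e) (Icc 0 (G.len e))) :
    Continuous (G.glue p u) :=
  G.continuous_of_pt fun e => (hu e).congr fun _ ht => G.glue_pt (h0 e) (h1 e) ht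

/-! ### Pairing divisors with functions -/

/-- The sum of the values of a function over a divisor. -/
def pairing (P : G.Divisor) (φ : G.Point → ℝ) : ℝ := P.sum fun x n => (n : ℝ) * φ x

theorem pairing_add (P Q : G.Divisor) (φ : G.Point → ℝ) :
    G.pairing (P + Q) φ = G.pairing P φ + G.pairing Q φ :=
  Finsupp.sum_add_index' (by simp) (by intros; push_cast; ring)

theorem pairing_sub (P Q : G.Divisor) (φ : G.Point → ℝ) :
    G.pairing (P - Q) φ = G.pairing P φ - G.pairing Q φ := by
  have := G.pairing_add (P - Q) Q φ
  rw [sub_add_cancel] at this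
  linarith

@[simp] theorem pairing_zero (φ : G.Point → ℝ) : G.pairing 0 φ = 0 := Finsupp.sum_zero_index

@[simp] theorem pairing_single (x : G.Point) (n : ℤ) (φ : G.Point → ℝ) :
    G.pairing (Finsupp.single x n) φ = n * φ x := Finsupp.sum_single_index (by simp)

theorem pairing_sum {α : Type*} (J : Finset α) (P : α → G.Divisor) (φ : G.Point → ℝ) :
    G.pairing (∑ a ∈ J, P a) φ = ∑ a ∈ J, G.pairing (P a) φ := by
  classical
  induction J using Finset.induction_on with
  | empty => simp
  | insert a J ha ih => rw [Finset.sum_insert ha, Finset.sum_insert ha, pairing_add, ih]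

theorem pairing_linear (P : G.Divisor) (φ ψ : G.Point → ℝ) (a b : ℝ) :
    G.pairing P (fun x => a * φ x + b * ψ x) = a * G.pairing P φ + b * G.pairing P ψ := by
  simp only [pairing, Finsupp.sum, Finset.mul_sum, ← Finset.sum_add_distrib]
  exact Finset.sum_congr rfl fun x _ => by ring

open Classical in
/-- The function `F` of the parameter on the open edge `e`, extended by zero. -/
def onEdge (e : E) (F : ℝ → ℝ) : G.Point → ℝ
  | .vertex _ => 0
  | .inner e' y _ _ => if e' = e then F y else 0

theorem onEdge_congr {e : E} {F F' : ℝ → ℝ} (h : ∀ y ∈ Ioo 0 (G.len e), F y = F' y) :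
    G.onEdge e F = G.onEdge e F' := by
  ext x
  rcases x with v | ⟨e', y, h0, h1⟩
  · rfl
  · simp only [onEdge]
    split_ifs with he
    · subst he; exact h y ⟨h0, h1⟩
    · rfl

theorem onEdge_linear (e : E) (F F' : ℝ → ℝ) (a b : ℝ) :
    G.onEdge e (fun y => a * F y + b * F' y) =
      fun x => a * G.onEdge e F x + b * G.onEdge e F' x := by
  ext x
  rcases x with v | ⟨e', y, h0, h1⟩
  · simp [onEdge]
  · simp only [onEdge]
    split_ifs <;> simp

/-- The sum of `F` over the part of a divisor in the open edge `e`. -/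
def edgePairing (P : G.Divisor) (e : E) (F : ℝ → ℝ) : ℝ := G.pairing P (G.onEdge e F)

theorem edgePairing_linear (P : G.Divisor) (e : E) (F F' : ℝ → ℝ) (a b : ℝ) :
    G.edgePairing P e (fun y => a * F y + b * F' y) =
      a * G.edgePairing P e F + b * G.edgePairing P e F' := by
  rw [edgePairing, onEdge_linear, pairing_linear]; rfl

theorem edgePairing_congr {P : G.Divisor} {e : E} {F F' : ℝ → ℝ}
    (h : ∀ y ∈ Ioo 0 (G.len e), F y = F' y) : G.edgePairing P e F = G.edgePairing P e F' := by
  rw [edgePairing, G.onEdge_congr h]; rfl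

theorem edgePairing_add (P Q : G.Divisor) (e : E) (F : ℝ → ℝ) :
    G.edgePairing (P + Q) e F = G.edgePairing P e F + G.edgePairing Q e F :=
  G.pairing_add P Q _

theorem edgePairing_sub (P Q : G.Divisor) (e : E) (F : ℝ → ℝ) :
    G.edgePairing (P - Q) e F = G.edgePairing P e F - G.edgePairing Q e F :=
  G.pairing_sub P Q _

theorem edgePairing_eq_inner (P : G.Divisor) (e : E) {t : ℝ} (h0 : 0 < t) (h1 : t < G.len e) :
    G.edgePairing P e (fun y => if y = t then 1 else 0) = P (.inner e t h0 h1) := by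
  classical
  have : ∀ x, G.onEdge e (fun y => if y = t then 1 else 0) x =
      if x = .inner e t h0 h1 then 1 else 0 := by
    rintro (v | ⟨e', y, h0, h1⟩)
    · simp [onEdge]
    · simp only [onEdge, Point.inner.injEq]
      split_ifs <;> simp_all
  simp only [edgePairing, pairing, this]
  by_cases h : P (.inner e t h0 h1) = 0 <;> simp [Finsupp.sum, h]

theorem edgePairing_hasRightSlope (P : G.Divisor) (e : E) {F : ℝ → ℝ → ℝ} {K : ℝ → ℝ} {t : ℝ}
    (h : ∀ y ∈ Ioo 0 (G.len e), HasRightSlope (F y) t (K y)) :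
    HasRightSlope (fun z => G.edgePairing P e fun y => F y z) t (G.edgePairing P e K) := by
  refine HasRightSlope.sum _ fun x _ => HasRightSlope.const_mul _ ?_
  rcases x with v | ⟨e', y, h0, h1⟩
  · simpa [onEdge] using hasRightSlope_affine 0 0 t
  · simp only [onEdge]
    split_ifs with he
    · subst he; exact h y ⟨h0, h1⟩
    · simpa using hasRightSlope_affine 0 0 t

theorem edgePairing_hasLeftSlope (P : G.Divisor) (e : E) {F : ℝ → ℝ → ℝ} {K : ℝ → ℝ} {t : ℝ}
    (h : ∀ y ∈ Ioo 0 (G.len e), HasLeftSlope (F y) t (K y)) :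
    HasLeftSlope (fun z => G.edgePairing P e fun y => F y z) t (G.edgePairing P e K) := by
  refine HasLeftSlope.sum _ fun x _ => HasLeftSlope.const_mul _ ?_
  rcases x with v | ⟨e', y, h0, h1⟩
  · simpa [onEdge] using hasLeftSlope_affine 0 0 t
  · simp only [onEdge]
    split_ifs with he
    · subst he; exact h y ⟨h0, h1⟩
    · simpa using hasLeftSlope_affine 0 0 t

theorem continuous_edgePairing (P : G.Divisor) (e : E) {F : ℝ → ℝ → ℝ}
    (h : ∀ y, Continuous (F y)) : Continuous fun z => G.edgePairing P e fun y => F y z := by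
  refine continuous_finsetSum _ fun x _ => Continuous.mul continuous_const ?_
  rcases x with v | ⟨e', y, h0, h1⟩
  · exact continuous_const
  · simp only [onEdge]
    split_ifs with he
    · exact h y
    · exact continuous_const

theorem pairing_eq_sum [Fintype V] [Fintype E] (P : G.Divisor) (φ : G.Point → ℝ) :
    G.pairing P φ = ∑ v, (P (.vertex v) : ℝ) * φ (.vertex v) +
      ∑ e, G.edgePairing P e fun y => φ (G.pt e y) := by
  classical
  induction P using Finsupp.induction_linear with
  | zero => simp [edgePairing]
  | add P Q hP hQ =>
    simp only [pairing_add, edgePairing_add, Finsupp.add_apply, Int.cast_add, add_mul,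
      Finset.sum_add_distrib, hP, hQ]
    ring
  | single x n =>
    rcases x with v | ⟨e, y, h0, h1⟩
    · simp [edgePairing, onEdge, Finsupp.single_apply, Finset.sum_ite_eq]
    · simp [edgePairing, onEdge, Finset.sum_ite_eq, G.pt_of_mem_Ioo e h0 h1]

end WeightedGraph

end

/-! ### Rational functions, their divisors, and Green's formula -/

noncomputable section

open Set Filter Topology

theorem Finset.exists_pos_forall_le_abs_sub (B : Finset ℝ) (t : ℝ) :
    ∃ ε > 0, ∀ c ∈ B, c ≠ t → ε ≤ |c - t| := by
  classical
  induction B using Finset.induction_on with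
  | empty => exact ⟨1, one_pos, by simp⟩
  | insert b B _ ih =>
    obtain ⟨ε, hε, h⟩ := ih
    by_cases hb : b = t
    · refine ⟨ε, hε, fun c hc hct => ?_⟩
      rcases Finset.mem_insert.1 hc with rfl | hc
      · exact absurd hb hct
      · exact h c hc hct
    · refine ⟨min ε |b - t|, lt_min hε (abs_pos.2 (sub_ne_zero.2 hb)), fun c hc hct => ?_⟩
      rcases Finset.mem_insert.1 hc with rfl | hc
      · exact min_le_right _ _
      · exact (min_le_left _ _).trans (h c hc hct)

namespace WeightedGraph

variable {V E : Type*} {G : WeightedGraph V E}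

namespace IsRational

variable {f g : G.Point → ℝ}

theorem exists_hasRightSlope (hf : G.IsRational f) (e : E) {t : ℝ} (ht : t ∈ Ico 0 (G.len e)) :
    ∃ k : ℤ, HasRightSlope (fun z => f (G.pt e z)) t k := by
  obtain ⟨B, hB⟩ := hf.2 e
  obtain ⟨ε, hε, hεB⟩ := B.exists_pos_forall_le_abs_sub t
  obtain ⟨k, hk⟩ := hB t (min (t + ε) (G.len e)) ht.1 (lt_min (by linarith) ht.2)
    (min_le_right _ _) fun c hc hct => by
      have h1 := hεB c hc hct.1.ne'
      rw [abs_of_pos (sub_pos.2 hct.1)] at h1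
      have h2 := hct.2.trans_le (min_le_left _ _)
      linarith
  refine ⟨k, min ε (G.len e - t), lt_min hε (sub_pos.2 ht.2), fun z hz => hk z ⟨hz.1, ?_⟩⟩
  refine le_min (hz.2.trans (by gcongr; exact min_le_left _ _)) ?_
  linarith [hz.2, min_le_right ε (G.len e - t)]

theorem exists_hasLeftSlope (hf : G.IsRational f) (e : E) {t : ℝ} (ht : t ∈ Ioc 0 (G.len e)) :
    ∃ k : ℤ, HasLeftSlope (fun z => f (G.pt e z)) t k := by
  obtain ⟨B, hB⟩ := hf.2 e
  obtain ⟨ε, hε, hεB⟩ := B.exists_pos_forall_le_abs_sub t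
  have hlt : max (t - ε) 0 < t := max_lt (by linarith) ht.1
  obtain ⟨k, hk⟩ := hB (max (t - ε) 0) t (le_max_right _ _) hlt ht.2 fun c hc hct => by
      have h1 := hεB c hc hct.2.ne
      rw [abs_of_neg (sub_neg.2 hct.2)] at h1
      have h2 := (le_max_left _ _).trans_lt hct.1
      linarith
  refine ⟨-k, min ε t, lt_min hε ht.1, fun z hz => ?_⟩
  have h1 : max (t - ε) 0 ≤ z := max_le (by linarith [hz.1, min_le_left ε t])
    (by linarith [hz.1, min_le_right ε t])
  change f (G.pt e z) = f (G.pt e t) + _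
  rw [hk z ⟨h1, hz.2⟩, hk t ⟨hlt.le, le_rfl⟩]
  push_cast
  ring

theorem hasRightSlope (hf : G.IsRational f) (e : E) {t : ℝ} (ht : t ∈ Ico 0 (G.len e)) :
    HasRightSlope (fun z => f (G.pt e z)) t (G.slopeFwd f e t) := by
  obtain ⟨k, hk⟩ := hf.exists_hasRightSlope e ht
  rwa [slopeFwd, hk.derivWithin]

theorem hasLeftSlope (hf : G.IsRational f) (e : E) {t : ℝ} (ht : t ∈ Ioc 0 (G.len e)) :
    HasLeftSlope (fun z => f (G.pt e z)) t (G.slopeBwd f e t) := by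
  obtain ⟨k, hk⟩ := hf.exists_hasLeftSlope e ht
  rwa [slopeBwd, hk.derivWithin]

theorem exists_int_slopeFwd (hf : G.IsRational f) (e : E) {t : ℝ} (ht : t ∈ Ico 0 (G.len e)) :
    ∃ k : ℤ, G.slopeFwd f e t = k := by
  obtain ⟨k, hk⟩ := hf.exists_hasRightSlope e ht
  exact ⟨k, hk.derivWithin⟩

theorem exists_int_slopeBwd (hf : G.IsRational f) (e : E) {t : ℝ} (ht : t ∈ Ioc 0 (G.len e)) :
    ∃ k : ℤ, G.slopeBwd f e t = k := by
  obtain ⟨k, hk⟩ := hf.exists_hasLeftSlope e ht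
  exact ⟨k, hk.derivWithin⟩

theorem exists_int_ord [Fintype E] (hf : G.IsRational f) (x : G.Point) :
    ∃ k : ℤ, G.ord f x = k := by
  classical
  rcases x with v | ⟨e, y, h0, h1⟩
  · choose a ha using fun e => hf.exists_int_slopeFwd e (t := 0) ⟨le_rfl, G.len_pos e⟩
    choose b hb using fun e => hf.exists_int_slopeBwd e (t := G.len e) ⟨G.len_pos e, le_rfl⟩
    refine ⟨∑ e, ((if G.src e = v then a e else 0) + (if G.tgt e = v then b e else 0)), ?_⟩
    simp only [ord, ha, hb]
    push_cast
    refine Finset.sum_congr rfl fun e _ => ?_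
    split_ifs <;> simp
  · obtain ⟨a, ha⟩ := hf.exists_int_slopeFwd e (t := y) ⟨h0.le, h1⟩
    obtain ⟨b, hb⟩ := hf.exists_int_slopeBwd e (t := y) ⟨h0, h1.le⟩
    exact ⟨a + b, by simp [ord, ha, hb]⟩

theorem finite_support_ord [Fintype V] [Fintype E] (hf : G.IsRational f) :
    (Function.support (G.ord f)).Finite := by
  choose B hB using hf.2
  refine Set.Finite.subset ((Set.finite_range Point.vertex).union
    (Set.finite_iUnion fun e => ((B e).finite_toSet.image (G.pt e)))) ?_
  rintro (v | ⟨e, y, h0, h1⟩) hx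
  · exact Or.inl ⟨v, rfl⟩
  · refine Or.inr (mem_iUnion.2 ⟨e, y, ?_, G.pt_of_mem_Ioo e h0 h1⟩)
    by_contra hy
    refine hx ?_
    obtain ⟨ε, hε, hεB⟩ := (B e).exists_pos_forall_le_abs_sub y
    have h2 : max (y - ε) 0 < y := max_lt (by linarith) h0
    have h3 : y < min (y + ε) (G.len e) := lt_min (by linarith) h1
    obtain ⟨k, hk⟩ := hB e (max (y - ε) 0) (min (y + ε) (G.len e)) (le_max_right _ _)
      (h2.trans h3) (min_le_right _ _) fun c hc hct => by
        have h4 := hεB c hc fun h => hy (h ▸ hc)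
        have h5 : |c - y| < ε := abs_lt.2 ⟨by linarith [(le_max_left _ _).trans_lt hct.1],
          by linarith [hct.2.trans_le (min_le_left _ _)]⟩
        linarith
    set a := max (y - ε) 0
    set b := min (y + ε) (G.len e)
    have hr : HasRightSlope (fun z => f (G.pt e z)) y k :=
      (hasRightSlope_affine (f (G.pt e a) - k * a) k y).congr h3 fun z hz => by
        rw [hk z ⟨h2.le.trans hz.1, hz.2⟩]; ring
    have hl : HasLeftSlope (fun z => f (G.pt e z)) y (-k) :=
      (hasLeftSlope_affine (f (G.pt e a) - k * a) k y).congr h2 fun z hz => by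
        rw [hk z ⟨hz.1, hz.2.trans h3.le⟩]; ring
    simp only [ord, slopeFwd, slopeBwd, hr.derivWithin, hl.derivWithin]
    ring

end IsRational

theorem edgePairing_const (P : G.Divisor) (e : E) (F : ℝ → ℝ) (c : ℝ) :
    G.edgePairing P e (fun y => c * F y) = c * G.edgePairing P e F := by
  have h1 := G.edgePairing_linear P e F F c 0
  simpa using h1

/-- `P` is the divisor of the function `f`. -/
def IsDivOf [Fintype E] (P : G.Divisor) (f : G.Point → ℝ) : Prop := ∀ x, (P x : ℝ) = G.ord f x

theorem isTranslate_iff [Fintype E] {d : ℕ} {D D' : G.EffDiv d} {f : G.Point → ℝ} :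
    IsTranslate D f D' ↔ IsDivOf (D'.toDiv - D.toDiv) f := by
  refine forall_congr' fun x => ?_
  simp only [Finsupp.sub_apply, Int.cast_sub]
  constructor <;> intro h <;> linarith

variable [Fintype E]

theorem IsRational.exists_isDivOf [Fintype V] {f : G.Point → ℝ} (hf : G.IsRational f) :
    ∃ P : G.Divisor, IsDivOf P f := by
  choose k hk using hf.exists_int_ord
  refine ⟨Finsupp.ofSupportFinite k (hf.finite_support_ord.subset fun x hx => ?_), fun x => ?_⟩
  · rw [Function.mem_support, hk]
    exact_mod_cast hx
  · rw [hk]; rfl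

/-- The difference of the two sides has value and slope 0 at the source. Its slope does not change
along the open edge, because `P` records the changes of slope of `f`. -/
theorem IsRational.eq_on_edge {f : G.Point → ℝ} (hf : G.IsRational f) {P : G.Divisor}
    (hP : IsDivOf P f) (e : E) {t : ℝ} (ht : t ∈ Icc 0 (G.len e)) :
    f (G.pt e t) = f (.vertex (G.src e)) + G.slopeFwd f e 0 * t +
      G.edgePairing P e fun y => max (t - y) 0 := by
  set m := G.slopeFwd f e 0
  have hsl : ∀ t, ∀ k, HasRightSlope (fun z => f (G.pt e z)) t k → HasRightSlope
      (fun z => f (G.pt e z) + (-f (.vertex (G.src e)) + -m * z +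
        (-1) * G.edgePairing P e fun y => max (z - y) 0)) t
      (k + (-m + (-1) * G.edgePairing P e fun y => if y ≤ t then 1 else 0)) := fun t k hk =>
    hk.add ((hasRightSlope_affine _ _ t).add
      ((G.edgePairing_hasRightSlope P e fun y _ => hasRightSlope_posPart y t).const_mul _))
  have hsl' : ∀ t, ∀ k, HasLeftSlope (fun z => f (G.pt e z)) t k → HasLeftSlope
      (fun z => f (G.pt e z) + (-f (.vertex (G.src e)) + -m * z +
        (-1) * G.edgePairing P e fun y => max (z - y) 0)) t
      (k + (- -m + (-1) * G.edgePairing P e fun y => -if y < t then 1 else 0)) := fun t k hk =>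
    hk.add ((hasLeftSlope_affine _ _ t).add
      ((G.edgePairing_hasLeftSlope P e fun y _ => hasLeftSlope_posPart y t).const_mul _))
  have hz : ∀ F : ℝ → ℝ, (∀ y ∈ Ioo 0 (G.len e), F y = 0) → G.edgePairing P e F = 0 := by
    intro F hF
    have h1 := G.edgePairing_linear P e F F 0 0
    rw [← G.edgePairing_congr (P := P) (F := F) (F' := fun y => 0 * F y + 0 * F y)] at h1
    · linarith
    · intro y hy; rw [hF y hy]; ring
  have key := eqOn_zero_of_slopes (L := G.len e) (h := fun z => f (G.pt e z) +
    (-f (.vertex (G.src e)) + -m * z + (-1) * G.edgePairing P e fun y => max (z - y) 0)) ?_ ?_ ?_ t ht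
  · linarith
  · have h1 : Continuous fun z => f (G.pt e z) := hf.1.comp (G.continuous_pt e)
    have h2 := G.continuous_edgePairing P e (F := fun y z => max (z - y) 0) (by fun_prop)
    exact (h1.add ((by fun_prop : Continuous fun z => -f (.vertex (G.src e)) + -m * z).add
      (continuous_const.mul h2))).continuousOn
  · simp only [pt_zero]
    rw [hz _ fun y hy => max_eq_right (by linarith [hy.1])]
    ring
  · intro t ht
    refine ⟨_, hsl t _ (hf.hasRightSlope e ht), ?_, fun h0 => ?_⟩
    · rintro rfl
      rw [hz _ fun y hy => if_neg (not_le.2 hy.1)]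
      simp [m]
    · convert hsl' t _ (hf.hasLeftSlope e ⟨h0, ht.2.le⟩) using 1
      -- The coefficient of `P` at the point is the jump of slope of `f`, and it is also the
      -- difference of the pairings with the indicators of `y ≤ t` and `y < t`.
      have h1 := hP (.inner e t h0 ht.2)
      rw [← G.edgePairing_eq_inner] at h1
      simp only [ord] at h1
      have h2 := G.edgePairing_linear P e (fun y => if y < t then 1 else 0)
        (fun y => if y = t then 1 else 0) 1 1
      have h3 := G.edgePairing_linear P e (fun y => if y < t then 1 else 0)
        (fun y => if y < t then 1 else 0) (-1) 0
      rw [← G.edgePairing_congr (F := fun y => if y ≤ t then (1 : ℝ) else 0)] at h2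
      · rw [← G.edgePairing_congr (F := fun y => -if y < t then (1 : ℝ) else 0)] at h3
        · rw [h2, h3, h1]; ring
        · intro y _; ring
      · intro y _
        rcases lt_trichotomy y t with h | h | h
        · simp [h, h.le, h.ne]
        · simp [h]
        · simp [h.not_ge, h.not_gt, h.ne']

theorem IsRational.slopeBwd_len {f : G.Point → ℝ} (hf : G.IsRational f) {P : G.Divisor}
    (hP : IsDivOf P f) (e : E) :
    G.slopeBwd f e (G.len e) = -(G.slopeFwd f e 0 + G.edgePairing P e fun _ => 1) := by
  have h1 : HasLeftSlope (fun z => f (G.pt e z)) (G.len e)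
      (-G.slopeFwd f e 0 + G.edgePairing P e fun y => -if y < G.len e then 1 else 0) :=
    ((hasLeftSlope_affine (f (.vertex (G.src e))) (G.slopeFwd f e 0) (G.len e)).add
      (G.edgePairing_hasLeftSlope P e fun y _ => hasLeftSlope_posPart y (G.len e))).congr
      (G.len_pos e) fun z hz => hf.eq_on_edge hP e hz
  rw [(hf.hasLeftSlope e ⟨G.len_pos e, le_rfl⟩).unique h1,
    G.edgePairing_congr (F' := fun _ => -1 * 1), edgePairing_const]
  · ring
  · intro y hy; simp [hy.2]

variable [Fintype V]

/-- Green's formula. -/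
theorem IsRational.pairing_eq {f : G.Point → ℝ} (hf : G.IsRational f) {P : G.Divisor}
    (hP : IsDivOf P f) (φ : G.Point → ℝ) :
    G.pairing P φ = ∑ e, (G.slopeFwd f e 0 * (φ (.vertex (G.src e)) - φ (.vertex (G.tgt e))) +
      G.edgePairing P e fun y => φ (G.pt e y) - φ (.vertex (G.tgt e))) := by
  classical
  rw [pairing_eq_sum]
  have h1 : ∑ v, (P (.vertex v) : ℝ) * φ (.vertex v) =
      ∑ e, (G.slopeFwd f e 0 * φ (.vertex (G.src e)) +
        G.slopeBwd f e (G.len e) * φ (.vertex (G.tgt e))) := by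
    simp only [hP _, ord, Finset.sum_mul]
    rw [Finset.sum_comm]
    refine Finset.sum_congr rfl fun e _ => ?_
    simp only [add_mul, Finset.sum_add_distrib, ite_mul, zero_mul]
    simp
  rw [h1, ← Finset.sum_add_distrib]
  refine Finset.sum_congr rfl fun e _ => ?_
  have h2 := G.edgePairing_linear P e (fun y => φ (G.pt e y)) (fun _ => 1) 1
    (-φ (.vertex (G.tgt e)))
  have h3 : (fun y => φ (G.pt e y) - φ (.vertex (G.tgt e))) =
      fun y => 1 * φ (G.pt e y) + -φ (.vertex (G.tgt e)) * 1 := by ext y; ring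
  rw [h3, h2, hf.slopeBwd_len hP]
  ring

/-- Green's formula with the test function 1. -/
theorem IsRational.degree_eq_zero {f : G.Point → ℝ} (hf : G.IsRational f) {P : G.Divisor}
    (hP : IsDivOf P f) : (P.sum fun _ n => n) = 0 := by
  have h := hf.pairing_eq hP fun _ => 1
  simp only [sub_self, mul_zero, zero_add] at h
  have h2 : ∀ e, G.edgePairing P e (fun _ => 0) = 0 := fun e => by
    simpa using edgePairing_const P e (fun _ => 0) 0
  simp only [h2, Finset.sum_const_zero, pairing, mul_one] at h
  simp only [Finsupp.sum] at h ⊢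
  exact_mod_cast h

/-- A rational function is determined by its divisor up to a constant. -/
theorem IsRational.eq_add_const_of_isDivOf [ConnectedSpace G.Point] {f g : G.Point → ℝ}
    (hf : G.IsRational f) (hg : G.IsRational g) {P : G.Divisor} (hPf : IsDivOf P f)
    (hPg : IsDivOf P g) : ∃ c, ∀ x, f x = c + g x := by
  have hedge : ∀ e, ∀ t ∈ Icc 0 (G.len e), f (G.pt e t) - g (G.pt e t) =
      f (.vertex (G.src e)) - g (.vertex (G.src e)) +
        (G.slopeFwd f e 0 - G.slopeFwd g e 0) * t := by
    intro e t ht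
    rw [hf.eq_on_edge hPf e ht, hg.eq_on_edge hPg e ht]
    ring
  -- An energy argument: Green's formula for `f` and for `g`, both tested on `f - g`, has the same
  -- divisor terms. Subtracting leaves the Dirichlet energy of `f - g`, which must be 0.
  have h1 := hf.pairing_eq hPf fun x => f x - g x
  rw [hg.pairing_eq hPg fun x => f x - g x, Finset.sum_add_distrib, Finset.sum_add_distrib,
    add_left_inj] at h1
  have h2 : ∑ e, (G.slopeFwd f e 0 - G.slopeFwd g e 0) ^ 2 * G.len e = 0 := by
    trans ∑ e, (G.slopeFwd g e 0 - G.slopeFwd f e 0) *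
      (f (.vertex (G.src e)) - g (.vertex (G.src e)) -
        (f (.vertex (G.tgt e)) - g (.vertex (G.tgt e))))
    · refine Finset.sum_congr rfl fun e _ => ?_
      have := hedge e (G.len e) ⟨(G.len_pos e).le, le_rfl⟩
      rw [pt_len] at this
      rw [this]
      ring
    · simp only [sub_mul _ _ (_ - _ : ℝ), Finset.sum_sub_distrib (f := fun e => _ * _)]
      rw [h1, sub_self]
  rw [Finset.sum_eq_zero_iff_of_nonneg fun e _ => by have := G.len_pos e; positivity] at h2
  have h3 := G.eq_of_forall_edge (f := fun x => f x - g x) fun e t ht => by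
    have h4 := h2 e (Finset.mem_univ e)
    rw [mul_eq_zero, or_iff_left (G.len_pos e).ne', sq_eq_zero_iff] at h4
    rw [hedge e t ht, h4]
    ring
  obtain ⟨x₀⟩ := (inferInstance : Nonempty G.Point)
  exact ⟨f x₀ - g x₀, fun x => by linarith [h3 x x₀]⟩

end WeightedGraph

end

/-! ### The topology of the symmetric product -/

noncomputable section

open Set Filter Topology

namespace WeightedGraph

variable {V E : Type*} (G : WeightedGraph V E)

theorem pairing_sumPoints {d : ℕ} (x : Fin d → G.Point) (φ : G.Point → ℝ) :
    G.pairing (G.sumPoints d x).toDiv φ = ∑ i, φ (x i) := by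
  simp [sumPoints, pairing_sum]

theorem continuous_sumPoints (d : ℕ) : Continuous (G.sumPoints d) := continuous_coinduced_rng

theorem sumPoints_surjective (d : ℕ) : Function.Surjective (G.sumPoints d) := by
  classical
  intro D
  set m : Multiset G.Point :=
    Finsupp.toMultiset (D.toDiv.mapRange Int.toNat (by simp)) with hm
  have hcast : ∀ x, ((m.count x : ℕ) : ℤ) = D.toDiv x := fun x => by
    rw [hm, Finsupp.count_toMultiset, Finsupp.mapRange_apply, Int.toNat_of_nonneg (D.nonneg x)]
  have hcard : m.toList.length = d := by
    rw [Multiset.length_toList, hm, Finsupp.card_toMultiset, ← Nat.cast_inj (R := ℤ),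
      ← D.degree_eq, Finsupp.sum_mapRange_index (by simp), Finsupp.sum, Finsupp.sum]
    push_cast
    exact Finset.sum_congr rfl fun x _ => Int.toNat_of_nonneg (D.nonneg x)
  refine ⟨fun i => m.toList.get (i.cast hcard.symm), ?_⟩
  ext x
  have h1 : (G.sumPoints d fun i => m.toList.get (i.cast hcard.symm)).toDiv x =
      ((List.ofFn fun i : Fin d => m.toList.get (i.cast hcard.symm)).map
        fun y => Finsupp.single y (1 : ℤ) x).sum := by
    simp [sumPoints, List.map_ofFn, List.sum_ofFn, Finsupp.finsetSum_apply]
  have h2 : (List.ofFn fun i : Fin d => m.toList.get (i.cast hcard.symm)) = m.toList := by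
    have : ∀ (n : ℕ) (l : List G.Point) (h : l.length = n),
        (List.ofFn fun i : Fin n => l.get (i.cast h.symm)) = l := by
      rintro n l rfl
      exact List.ofFn_get _
    exact this _ _ hcard
  rw [h1, h2, ← hcast, ← Multiset.coe_toList m, Multiset.coe_count, Multiset.coe_toList]
  induction m.toList with
  | nil => simp
  | cons a l ih =>
    rw [List.map_cons, List.sum_cons, ih, List.count_cons, Finsupp.single_apply]
    push_cast
    by_cases h : a = x <;> simp [h, add_comm]

theorem continuous_pairing (d : ℕ) {φ : G.Point → ℝ} (hφ : Continuous φ) :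
    Continuous fun D : G.EffDiv d => G.pairing D.toDiv φ := by
  rw [continuous_coinduced_dom]
  simp only [Function.comp_def, pairing_sumPoints]
  fun_prop

open Classical in
/-- The function supported on the edge `e`, affine apart from a change of slope by `-1` at `z`. -/
def hat (e : E) (z : ℝ) : G.Point → ℝ :=
  G.glue 0 fun e' t => if e' = e then (G.len e - z) / G.len e * t - max (t - z) 0 else 0

/-- The function with prescribed values at the vertices that is affine on the edges. -/
def interp (p : V → ℝ) : G.Point → ℝ :=
  G.glue p fun e t => p (G.src e) + (p (G.tgt e) - p (G.src e)) / G.len e * t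

theorem hat_vanish {e : E} {z : ℝ} (hz : z ∈ Ioo 0 (G.len e)) :
    (G.len e - z) / G.len e * 0 - max (0 - z) 0 = 0 ∧
    (G.len e - z) / G.len e * G.len e - max (G.len e - z) 0 = 0 := by
  constructor
  · rw [max_eq_right (by linarith [hz.1])]; ring
  · rw [max_eq_left (by linarith [hz.2]), div_mul_cancel₀ _ (G.len_pos e).ne']; ring

theorem continuous_hat {e : E} {z : ℝ} (hz : z ∈ Ioo 0 (G.len e)) : Continuous (G.hat e z) := by
  classical
  have hv := G.hat_vanish hz
  refine G.continuous_glue (fun e' => ?_) (fun e' => ?_) fun e' => ?_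
  · split_ifs
    · exact hv.1
    · rfl
  · split_ifs with h
    · subst h; exact hv.2
    · rfl
  · split_ifs
    · fun_prop
    · exact continuousOn_const

theorem continuous_interp (p : V → ℝ) : Continuous (G.interp p) :=
  G.continuous_glue (fun e => by ring) (fun e => by
    rw [div_mul_cancel₀ _ (G.len_pos e).ne']; ring) fun e => by fun_prop

theorem interp_pt (p : V → ℝ) (e : E) {t : ℝ} (ht : t ∈ Icc 0 (G.len e)) :
    G.interp p (G.pt e t) = p (G.src e) + (p (G.tgt e) - p (G.src e)) / G.len e * t :=
  G.glue_pt (by ring) (by rw [div_mul_cancel₀ _ (G.len_pos e).ne']; ring) ht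

variable [Fintype E]

variable {G} in
theorem IsTranslate.unique {d : ℕ} {D D₁ D₂ : G.EffDiv d} {f : G.Point → ℝ}
    (h₁ : IsTranslate D f D₁) (h₂ : IsTranslate D f D₂) : D₁ = D₂ := by
  ext x
  have := (h₁ x).trans (h₂ x).symm
  exact_mod_cast this

variable {G} in
theorem ord_const_add (c : ℝ) (f : G.Point → ℝ) : G.ord (fun x => c + f x) = G.ord f := by
  ext x
  rcases x with v | ⟨e, y, h0, h1⟩ <;>
  simp only [ord, slopeFwd, slopeBwd, derivWithin_const_add]

variable [Fintype V]

theorem pairing_hat (P : G.Divisor) {e : E} {z : ℝ} :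
    G.pairing P (G.hat e z) =
      G.edgePairing P e fun y => (G.len e - z) / G.len e * y - max (y - z) 0 := by
  rw [pairing_eq_sum]
  have h1 : ∀ v, G.hat e z (.vertex v) = 0 := fun v => rfl
  simp only [h1, mul_zero, Finset.sum_const_zero, zero_add]
  rw [Finset.sum_eq_single e]
  · refine G.edgePairing_congr fun y hy => ?_
    rw [G.pt_of_mem_Ioo e hy.1 hy.2]
    simp [hat, glue]
  · intro e' _ hne
    rw [G.edgePairing_congr (F' := fun _ => 0 * 0), edgePairing_const, zero_mul]
    intro y hy
    rw [G.pt_of_mem_Ioo e' hy.1 hy.2]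
    simp [hat, glue, hne]
  · simp

theorem pairing_interp (P : G.Divisor) (hP : ∀ e y h0 h1, P (.inner e y h0 h1) = 0) (p : V → ℝ) :
    G.pairing P (G.interp p) = ∑ v, (P (.vertex v) : ℝ) * p v := by
  have hv : ∀ v, G.interp p (.vertex v) = p v := fun v => rfl
  simp only [pairing_eq_sum, hv]
  rw [add_eq_left]
  · refine Finset.sum_eq_zero fun e _ => Finset.sum_eq_zero fun x _ => ?_
    rcases x with v | ⟨e', y, h0, h1⟩
    · simp [onEdge]
    · simp [hP]

variable {G}

/-- Symmetry of the Laplacian: `hat e z` bends only at `z` and at the ends of `e`, so pairing it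
with div f involves `f` only at these points. This is what makes the divisor depend continuously on
pointwise values. -/
theorem IsRational.pairing_hat_eq {f : G.Point → ℝ} (hf : G.IsRational f) {P : G.Divisor}
    (hP : IsDivOf P f) {e : E} {z : ℝ} (hz : z ∈ Ioo 0 (G.len e)) :
    G.pairing P (G.hat e z) =
      (G.len e - z) / G.len e * (f (.vertex (G.src e)) - f (.vertex (G.tgt e))) -
        (f (G.pt e z) - f (.vertex (G.tgt e))) := by
  have hL := G.len_pos e
  have h1 := hf.eq_on_edge hP e ⟨hz.1.le, hz.2.le⟩
  have h2 := hf.eq_on_edge hP e ⟨hL.le, le_rfl⟩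
  have h3 := G.edgePairing_linear P e (fun y => max (G.len e - y) 0) (fun y => max (z - y) 0)
    (z / G.len e) (-1)
  rw [pt_len] at h2
  rw [pairing_hat, h1, h2, G.edgePairing_congr
    (F' := fun y => z / G.len e * max (G.len e - y) 0 + -1 * max (z - y) 0), h3]
  · field_simp
    ring
  · intro y hy
    rw [max_eq_left (a := G.len e - y) (by linarith [hy.2])]
    rcases le_total y z with h | h
    · rw [max_eq_right (by linarith), max_eq_left (by linarith)]; field_simp; ring
    · rw [max_eq_left (by linarith), max_eq_right (by linarith)]; field_simp; ring

theorem IsRational.pairing_interp_eq {f : G.Point → ℝ} (hf : G.IsRational f) {P : G.Divisor}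
    (hP : IsDivOf P f) (p : V → ℝ) :
    G.pairing P (G.interp p) = ∑ e, (p (G.tgt e) - p (G.src e)) / G.len e *
      (f (.vertex (G.src e)) - f (.vertex (G.tgt e))) := by
  rw [hf.pairing_eq hP]
  refine Finset.sum_congr rfl fun e _ => ?_
  have hL := G.len_pos e
  have h2 := hf.eq_on_edge hP e ⟨hL.le, le_rfl⟩
  rw [pt_len] at h2
  set n := (p (G.tgt e) - p (G.src e)) / G.len e with hn
  have hn' : p (G.tgt e) - p (G.src e) = n * G.len e := by rw [hn]; field_simp
  have hv : ∀ v, G.interp p (.vertex v) = p v := fun v => rfl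
  rw [h2, G.edgePairing_congr (F' := fun y => -n * max (G.len e - y) 0), edgePairing_const, hv, hv]
  · linear_combination (- G.slopeFwd f e 0) * hn'
  · intro y hy
    rw [G.interp_pt p e ⟨hy.1.le, hy.2.le⟩, hv, ← hn, max_eq_left (by linarith [hy.2])]
    linear_combination -hn'

/-- As a function of `z`, the pairing with `hat e z` is piecewise linear and its changes of slope
are, up to sign, the coefficients of `P` inside `e`. Once these vanish, the interpolations of
indicator functions of vertices detect the rest. -/
theorem eq_zero_of_pairing_eq_zero {P : G.Divisor}
    (h1 : ∀ e, ∀ z ∈ Ioo 0 (G.len e), G.pairing P (G.hat e z) = 0)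
    (h2 : ∀ p, G.pairing P (G.interp p) = 0) : P = 0 := by
  classical
  have hin : ∀ e y h0 h1, P (.inner e y h0 h1) = 0 := by
    intro e t h0 hL
    have hr : HasRightSlope (fun z => G.pairing P (G.hat e z)) t 0 :=
      (hasRightSlope_affine 0 0 t).congr hL fun z hz => by
        rcases hz.2.eq_or_lt with rfl | hzL
        · rw [pairing_hat, G.edgePairing_congr (F' := fun _ => 0 * 0), edgePairing_const]
          · simp
          · intro y hy; rw [max_eq_right (by linarith [hy.2])]; simp
        · rw [h1 e z ⟨h0.trans_le hz.1, hzL⟩]; simp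
    have hl : HasLeftSlope (fun z => G.pairing P (G.hat e z)) t 0 :=
      (by simpa using hasLeftSlope_affine 0 0 t : HasLeftSlope (fun _ => (0 : ℝ)) t 0).congr
        (show t / 2 < t by linarith) fun z hz => by
        rw [h1 e z ⟨by linarith [hz.1], hz.2.trans_lt hL⟩]
    simp only [pairing_hat] at hr hl
    have hr' := G.edgePairing_hasRightSlope P e (t := t)
      (F := fun y z => (y + -y / G.len e * z) + (-1) * max (y - z) 0)
      (K := fun y => -y / G.len e + (-1) * -if t < y then 1 else 0) fun y _ =>
        (hasRightSlope_affine _ _ t).add ((hasRightSlope_posPart_rev y t).const_mul _)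
    have hl' := G.edgePairing_hasLeftSlope P e (t := t)
      (F := fun y z => (y + -y / G.len e * z) + (-1) * max (y - z) 0)
      (K := fun y => -(-y / G.len e) + (-1) * if t ≤ y then 1 else 0) fun y _ =>
        (hasLeftSlope_affine _ _ t).add ((hasLeftSlope_posPart_rev y t).const_mul _)
    have heq : (fun z => G.edgePairing P e fun y => (G.len e - z) / G.len e * y - max (y - z) 0) =
        fun z => G.edgePairing P e fun y => (y + -y / G.len e * z) + (-1) * max (y - z) 0 := by
      ext z
      refine G.edgePairing_congr fun y _ => ?_
      have := (G.len_pos e).ne'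
      field_simp
      ring
    rw [heq] at hr hl
    have e1 := hr'.unique hr
    have e2 := hl'.unique hl
    -- Minus the sum of the two outgoing slopes, where the affine parts cancel and the indicator of
    -- `y = t` remains.
    have e3 := G.edgePairing_linear P e (fun y => -y / G.len e + (-1) * -if t < y then 1 else 0)
      (fun y => -(-y / G.len e) + (-1) * if t ≤ y then 1 else 0) (-1) (-1)
    rw [e1, e2, G.edgePairing_congr (F' := fun y => if y = t then 1 else 0),
      G.edgePairing_eq_inner P e h0 hL] at e3
    · exact_mod_cast (by simpa using e3 : (P (.inner e t h0 hL) : ℝ) = 0)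
    · intro y _
      rcases lt_trichotomy y t with h | h | h
      · simp [h.ne, h.not_gt, h.not_ge]
      · simp [h]
      · simp [h, h.le, h.ne']
        ring
  ext x
  rcases x with v | ⟨e, y, h0, h1⟩
  · have := h2 (Pi.single v 1)
    rw [G.pairing_interp P hin] at this
    simpa [Pi.single_apply] using this
  · exact hin e y h0 h1

section Topology

variable [ConnectedSpace G.Point] [Nontrivial G.Point]

instance compactSpace_effDiv (d : ℕ) : CompactSpace (G.EffDiv d) := by
  have := G.compactSpace_point
  exact (G.sumPoints_surjective d).compactSpace (G.continuous_sumPoints d)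

variable (G) in
/-- The values of an effective divisor on the test functions `hat` and `interp`. -/
def testValues (d : ℕ) (D : G.EffDiv d) :
    ((Σ e : E, Ioo (0 : ℝ) (G.len e)) → ℝ) × ((V → ℝ) → ℝ) :=
  (fun q => G.pairing D.toDiv (G.hat q.1 q.2), fun p => G.pairing D.toDiv (G.interp p))

/-- A continuous injection of a compact space into a Hausdorff one. It replaces the quotient
topology by convergence of numbers, and yields the Hausdorff property and a criterion for continuity
into the symmetric product. -/
theorem isClosedEmbedding_testValues (d : ℕ) : IsClosedEmbedding (G.testValues d) := by
  refine Continuous.isClosedEmbedding ?_ ?_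
  · refine (continuous_pi fun q => ?_).prodMk (continuous_pi fun p => ?_)
    · exact G.continuous_pairing d (G.continuous_hat q.2.2)
    · exact G.continuous_pairing d (G.continuous_interp p)
  · intro D D' h
    have h1 := fun q => congrFun (congrArg Prod.fst h) q
    have h2 := fun p => congrFun (congrArg Prod.snd h) p
    simp only [testValues] at h1 h2
    have := eq_zero_of_pairing_eq_zero (P := D.toDiv - D'.toDiv)
      (fun e z hz => by rw [pairing_sub, h1 ⟨e, z, hz⟩, sub_self])
      (fun p => by rw [pairing_sub, h2 p, sub_self])
    exact EffDiv.ext (sub_eq_zero.1 this)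

instance t2Space_effDiv (d : ℕ) : T2Space (G.EffDiv d) :=
  (isClosedEmbedding_testValues d).isEmbedding.t2Space

/-- The divisor `D + div f` depends continuously on `f`, even for pointwise convergence. -/
theorem continuous_of_isTranslate {X : Type*} [TopologicalSpace X] {d : ℕ} {D : G.EffDiv d}
    {F : X → G.Point → ℝ} {Φ : X → G.EffDiv d} (hF : ∀ x, G.IsRational (F x))
    (hΦ : ∀ x, IsTranslate D (F x) (Φ x)) (hc : ∀ p, Continuous fun x => F x p) :
    Continuous Φ := by
  rw [(isClosedEmbedding_testValues d).isInducing.continuous_iff]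
  have h1 : ∀ x φ, G.pairing (Φ x).toDiv φ =
      G.pairing D.toDiv φ + G.pairing ((Φ x).toDiv - D.toDiv) φ := fun x φ => by
    rw [pairing_sub]; ring
  refine (continuous_pi fun q => ?_).prodMk (continuous_pi fun p => ?_)
  · simp only [h1]
    simp only [(hF _).pairing_hat_eq (isTranslate_iff.1 (hΦ _)) q.2.2]
    fun_prop
  · simp only [h1]
    simp only [(hF _).pairing_interp_eq (isTranslate_iff.1 (hΦ _))]
    fun_prop

end Topology

theorem ratSpace.exists_isTranslate {d : ℕ} {D : G.EffDiv d} {f : G.Point → ℝ}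
    (hf : f ∈ ratSpace D) : ∃ D' : G.EffDiv d, IsTranslate D f D' := by
  obtain ⟨P, hP⟩ := hf.1.exists_isDivOf
  refine ⟨⟨D.toDiv + P, fun x => ?_, ?_⟩, fun x => ?_⟩
  · have := hf.2 x
    rw [← hP x] at this
    rw [Finsupp.add_apply]
    exact_mod_cast this
  · rw [Finsupp.sum_add_index' (by simp) (by simp), D.degree_eq, hf.1.degree_eq_zero hP, add_zero]
  · simp [hP x]

theorem IsTranslate.eq_add_const [ConnectedSpace G.Point] {d : ℕ} {D D' : G.EffDiv d}
    {f g : G.Point → ℝ} (hf : G.IsRational f) (hg : G.IsRational g) (h : IsTranslate D f D')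
    (h' : IsTranslate D g D') : ∃ c, ∀ x, f x = c + g x :=
  hf.eq_add_const_of_isDivOf hg (isTranslate_iff.1 h) (isTranslate_iff.1 h')

end WeightedGraph

end

/-! ### Irredundant maxima and cubes in a tropical linear system -/

noncomputable section

open Set Filter Topology

/-- The pointwise maximum of a nonempty finite family of functions. -/
def maxFn {X ι : Type*} [Fintype ι] [Nonempty ι] (f : ι → X → ℝ) : X → ℝ :=
  Finset.univ.sup' Finset.univ_nonempty f

section MaxFn

variable {X ι : Type*} [Fintype ι] [Nonempty ι] {f : ι → X → ℝ}

theorem maxFn_apply (f : ι → X → ℝ) (x : X) :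
    maxFn f x = Finset.univ.sup' Finset.univ_nonempty fun i => f i x := Finset.sup'_apply _ _ _

theorem le_maxFn (f : ι → X → ℝ) (i : ι) (x : X) : f i x ≤ maxFn f x := by
  rw [maxFn_apply]
  exact Finset.le_sup' (fun i => f i x) (Finset.mem_univ i)

theorem maxFn_le_iff {x : X} {c : ℝ} : maxFn f x ≤ c ↔ ∀ i, f i x ≤ c := by
  simp [maxFn_apply]

theorem exists_eq_maxFn (f : ι → X → ℝ) (x : X) : ∃ i, maxFn f x = f i x := by
  obtain ⟨i, -, hi⟩ := Finset.univ.exists_mem_eq_sup' Finset.univ_nonempty fun i => f i x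
  exact ⟨i, (maxFn_apply f x).trans hi⟩

theorem maxFn_eq_of_forall_le {i : ι} {x : X} (h : ∀ j, f j x ≤ f i x) : maxFn f x = f i x :=
  le_antisymm (maxFn_le_iff.2 h) (le_maxFn f i x)

theorem IsTropicalModule.maxFn_mem {N : Set (X → ℝ)} (hN : WeightedGraph.IsTropicalModule N)
    (hf : ∀ i, f i ∈ N) : maxFn f ∈ N :=
  Finset.sup'_mem N (fun f hf g hg => hN.sup_mem f hf g hg) _ _ _ fun i _ => hf i

theorem continuous_maxFn_apply {Y : Type*} [TopologicalSpace Y] {F : ι → Y → X → ℝ} {x : X}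
    (hF : ∀ i, Continuous fun y => F i y x) : Continuous fun y => maxFn (fun i => F i y) x := by
  simp only [maxFn_apply]
  exact Continuous.finset_sup'_apply _ fun i _ => hF i

end MaxFn

namespace WeightedGraph

variable {V E : Type*} {G : WeightedGraph V E}

/-- A nonempty open set contains infinitely many points of some open edge, and `P` has finite
support. -/
theorem exists_inner_mem_of_isOpen [ConnectedSpace G.Point] [Nontrivial G.Point]
    {W : Set G.Point} (hW : IsOpen W) (hne : W.Nonempty) (P : G.Divisor) :
    ∃ e t, ∃ h0 : 0 < t, ∃ h1 : t < G.len e, .inner e t h0 h1 ∈ W ∧ P (.inner e t h0 h1) = 0 := by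
  obtain ⟨x, hx⟩ := hne
  obtain ⟨e, t, ht, rfl⟩ := G.exists_pt_eq x
  have ho : IsOpen (G.pt e ⁻¹' W) := hW.preimage (G.continuous_pt e)
  have hL := G.len_pos e
  have hcl : t ∈ closure (Ioo 0 (G.len e)) := by rwa [closure_Ioo hL.ne]
  obtain ⟨s, hsW, hs⟩ := mem_closure_iff.1 hcl _ ho hx
  have hinf : (G.pt e ⁻¹' W ∩ Ioo 0 (G.len e)).Infinite :=
    infinite_of_mem_nhds s ((ho.inter isOpen_Ioo).mem_nhds ⟨hsW, hs⟩)
  have hinj : InjOn (G.pt e) (G.pt e ⁻¹' W ∩ Ioo 0 (G.len e)) := by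
    rintro a ⟨-, ha⟩ b ⟨-, hb⟩ hab
    rw [G.pt_of_mem_Ioo e ha.1 ha.2, G.pt_of_mem_Ioo e hb.1 hb.2] at hab
    simpa using hab
  obtain ⟨_, ⟨a, ⟨haW, ha⟩, rfl⟩, haP⟩ := (hinf.image hinj).exists_notMem_finset P.support
  refine ⟨e, a, ha.1, ha.2, ?_, ?_⟩
  · rw [← G.pt_of_mem_Ioo]; exact haW
  · rw [← G.pt_of_mem_Ioo]; simpa using haP

variable [Fintype E]

theorem ord_inner_congr {f g : G.Point → ℝ} {e : E} {t : ℝ} {h0 : 0 < t} {h1 : t < G.len e}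
    {W : Set G.Point} (hW : IsOpen W) (ht : .inner e t h0 h1 ∈ W) (h : EqOn f g W) :
    G.ord f (.inner e t h0 h1) = G.ord g (.inner e t h0 h1) := by
  rw [← G.pt_of_mem_Ioo] at ht
  have hev : (fun z => f (G.pt e z)) =ᶠ[𝓝 t] fun z => g (G.pt e z) := by
    filter_upwards [(hW.preimage (G.continuous_pt e)).mem_nhds ht] with z hz
    exact h hz
  simp only [ord, slopeFwd, slopeBwd]
  rw [(hev.filter_mono nhdsWithin_le_nhds).derivWithin_eq hev.eq_of_nhds,
    (hev.filter_mono nhdsWithin_le_nhds).derivWithin_eq hev.eq_of_nhds]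

variable [Fintype V] [ConnectedSpace G.Point] [Nontrivial G.Point] {d : ℕ} {D₀ : G.EffDiv d}
  {N : Set (G.Point → ℝ)}

theorem continuous_divisor_family (hNR : N ⊆ ratSpace D₀) {Y : Type*} [TopologicalSpace Y]
    {F : Y → G.Point → ℝ} (hF : ∀ y, F y ∈ N) (hc : ∀ x, Continuous fun y => F y x) :
    ∃ Φ : Y → G.EffDiv d, Continuous Φ ∧ ∀ y, IsTranslate D₀ (F y) (Φ y) := by
  choose Φ hΦ using fun y => ratSpace.exists_isTranslate (hNR (hF y))
  exact ⟨Φ, continuous_of_isTranslate (fun y => (hNR (hF y)).1) hΦ hc, hΦ⟩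

/-- Close to any member of a tropical linear system with `𝔡(-F)` nonempty for all `F` of degree `r`,
there is one given by a maximum of `r + 1` functions, none of which is redundant. -/
theorem exists_irredundant_max (hN : IsTropicalModule N) (hNR : N ⊆ ratSpace D₀) {r : ℕ}
    (hr : ∀ F : G.EffDiv r, ∃ g ∈ N, ∃ D', IsTranslate D₀ g D' ∧ 0 ≤ D'.toDiv - F.toDiv)
    {U : Set (G.EffDiv d)} (hU : IsOpen U) (hne : ∃ f ∈ N, ∃ D ∈ U, IsTranslate D₀ f D) :
    ∀ s ≤ r, ∃ f : Fin (s + 1) → G.Point → ℝ, (∀ i, f i ∈ N) ∧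
      (∃ x : Fin (s + 1) → G.Point, ∀ i j, j ≠ i → f j (x i) < f i (x i)) ∧
      ∃ D ∈ U, IsTranslate D₀ (maxFn f) D := by
  intro s
  induction s with
  | zero =>
    intro _
    obtain ⟨f, hf, D, hD, hfD⟩ := hne
    refine ⟨fun _ => f, fun _ => hf, ⟨fun _ => Classical.arbitrary _, fun i j hij => ?_⟩, D, hD, ?_⟩
    · exact absurd (Fin.ext (by omega)) hij
    · have : maxFn (fun _ : Fin (0 + 1) => f) = f := by
        ext x; exact maxFn_eq_of_forall_le (i := 0) fun _ => le_rfl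
      rwa [this]
  | succ s ih =>
    intro hs
    obtain ⟨f, hf, ⟨x, hx⟩, D, hD, hFD⟩ := ih (by omega)
    have hFN := IsTropicalModule.maxFn_mem hN hf
    set F := maxFn f with hF
    set W : Fin (s + 1) → Set G.Point := fun i => {z | ∀ j, j ≠ i → f j z < f i z} with hW
    have hcont : ∀ i, Continuous (f i) := fun i => (hNR (hf i)).1.1
    have hWo : ∀ i, IsOpen (W i) := fun i => by
      have : W i = ⋂ j, {z | j ≠ i → f j z < f i z} := by ext; simp [hW]
      rw [this]
      refine isOpen_iInter_of_finite fun j => ?_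
      by_cases hj : j = i
      · simp [hj]
      · simpa [hj] using isOpen_lt (hcont j) (hcont i)
    have hWF : ∀ i, ∀ z ∈ W i, F z = f i z := fun i z hz =>
      maxFn_eq_of_forall_le fun j => by
        by_cases hj : j = i
        · rw [hj]
        · exact (hz j hj).le
    choose e t h0 h1 hyW hyD using fun i =>
      exists_inner_mem_of_isOpen (hWo i) ⟨x i, fun j hj => hx i j hj⟩ D.toDiv
    set y : Fin (s + 1) → G.Point := fun i => .inner (e i) (t i) (h0 i) (h1 i) with hy
    -- The `s + 1 ≤ r` chosen points are padded with copies of `y 0` to reach degree `r`.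
    obtain ⟨g', hg'N, D', hgD, hD'⟩ := hr (G.sumPoints r fun k =>
      if h : (k : ℕ) < s + 1 then y ⟨k, h⟩ else y 0)
    have hD'y : ∀ i, 1 ≤ D'.toDiv (y i) := by
      intro i
      have h2 := hD' (y i)
      simp only [Finsupp.coe_zero, Pi.zero_apply, Finsupp.sub_apply, sub_nonneg] at h2
      refine le_trans ?_ h2
      simp only [sumPoints, Finsupp.finsetSum_apply]
      refine le_trans ?_ (Finset.single_le_sum (fun k _ => ?_)
        (Finset.mem_univ (⟨i, by omega⟩ : Fin r)))
      · simp [i.2]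
      · classical
        rw [Finsupp.single_apply]; split_ifs <;> simp
    -- normalize `g'` so that it touches `F` from below
    have := G.compactSpace_point
    obtain ⟨w, -, hw⟩ := (isCompact_univ (X := G.Point)).exists_isMaxOn univ_nonempty
      (((hNR hg'N).1.1.sub (hNR hFN).1.1).continuousOn (s := univ))
    set g : G.Point → ℝ := fun z => (F w - g' w) + g' z with hg
    have hgN : g ∈ N := hN.shift_mem _ hg'N _
    have hgF : ∀ z, g z ≤ F z := fun z => by
      have : g' z - F z ≤ g' w - F w := hw (mem_univ z)
      simp only [hg]; linarith
    have hgw : g w = F w := by simp [hg]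
    -- If `g` agreed with `F` on `W i`, both would have the same order at `y i`, whereas `D` has
    -- coefficient 0 there and `D'` a positive one.
    have hz : ∀ i, ∃ z ∈ W i, g z < F z := by
      intro i
      by_contra! hcon
      have heq : EqOn g F (W i) := fun z hz => le_antisymm (hgF z) (hcon z hz)
      have h3 := ord_inner_congr (hWo i) (hyW i) heq
      have h4 := hgD (y i)
      have h5 := hFD (y i)
      rw [hg, ord_const_add] at h3
      have h6 := hyD i
      have h7 := hD'y i
      simp only [hy] at h4 h5 h7
      rw [h3, ← h5, h6] at h4
      have h8 : D'.toDiv (.inner (e i) (t i) (h0 i) (h1 i)) = 0 := by exact_mod_cast h4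
      omega
    choose z hzW hzlt using hz
    obtain ⟨Φ, hΦc, hΦ⟩ := continuous_divisor_family hNR
      (F := fun ε : ℝ => F ⊔ fun z => ε + g z)
      (fun ε => hN.sup_mem _ hFN _ (hN.shift_mem _ hgN ε))
      (fun z => by simp only [Pi.sup_apply]; fun_prop)
    have hΦ0 : Φ 0 = D := by
      refine IsTranslate.unique (hΦ 0) ?_
      convert hFD using 1
      ext z
      simpa using hgF z
    have hev1 : ∀ᶠ ε in 𝓝[>] (0 : ℝ), Φ ε ∈ U :=
      nhdsWithin_le_nhds (hΦc.continuousAt.eventually_mem (hU.mem_nhds (hΦ0 ▸ hD)))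
    have hev2 : ∀ᶠ ε in 𝓝[>] (0 : ℝ), ∀ i, ε + g (z i) < f i (z i) := by
      refine nhdsWithin_le_nhds (eventually_all.2 fun i => ?_)
      have hc : Continuous fun ε : ℝ => ε + g (z i) := by fun_prop
      refine hc.continuousAt.eventually_lt continuousAt_const ?_
      rw [zero_add, ← hWF i _ (hzW i)]
      exact hzlt i
    -- Any ε > 0 makes the new term win at the contact point `w`; a small ε lets `f i` still win at
    -- `z i` and keeps the divisor in `U`.
    obtain ⟨ε, ⟨hεU, hεz⟩, hε⟩ := ((hev1.and hev2).and self_mem_nhdsWithin).exists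
    refine ⟨Fin.cons (fun z => ε + g z) f, ?_, ⟨Fin.cons w z, ?_⟩, Φ ε, hεU, ?_⟩
    · refine Fin.cases ?_ fun i => ?_
      · exact hN.shift_mem _ hgN ε
      · exact hf i
    · intro i j
      refine Fin.cases ?_ (fun i => ?_) i <;> refine Fin.cases ?_ (fun j => ?_) j
      · simp
      · intro _
        simp only [Fin.cons_succ, Fin.cons_zero]
        have := le_maxFn f j w
        rw [← hF, ← hgw] at this
        have : 0 < ε := hε
        linarith
      · intro _
        simpa using hεz i
      · intro hne
        simpa using hzW i j fun h => hne (by rw [h])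
    · convert hΦ ε using 1
      ext z
      apply le_antisymm
      · refine maxFn_le_iff.2 (Fin.cases ?_ fun i => ?_)
        · simp
        · simpa using Or.inl (le_maxFn f i z)
      · refine sup_le ?_ ?_
        · exact maxFn_le_iff.2 fun i => le_maxFn (Fin.cons (fun z => ε + g z) f : Fin (s + 1 + 1) → _) i.succ z
        · exact le_maxFn (Fin.cons (fun z => ε + g z) f : Fin (s + 1 + 1) → G.Point → ℝ) 0 z

/-- Every nonempty open part of a tropical linear system with `𝔡(-F)` nonempty for all `F` of degree
`r` contains an `r`-dimensional cube. -/
theorem exists_cube (hN : IsTropicalModule N) (hNR : N ⊆ ratSpace D₀) {r : ℕ}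
    (hr : ∀ F : G.EffDiv r, ∃ g ∈ N, ∃ D', IsTranslate D₀ g D' ∧ 0 ≤ D'.toDiv - F.toDiv)
    {U : Set (G.EffDiv d)} (hU : IsOpen U) (hne : ∃ f ∈ N, ∃ D ∈ U, IsTranslate D₀ f D) :
    ∃ Φ : (Fin r → ℝ) → G.EffDiv d, Continuous Φ ∧
      (∀ t, Φ t ∈ U ∧ ∃ f ∈ N, IsTranslate D₀ f (Φ t)) ∧ InjOn Φ (Icc 0 1) := by
  obtain ⟨f, hf, ⟨x, hx⟩, D, hD, hFD⟩ := exists_irredundant_max hN hNR hr hU hne r le_rfl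
  -- The first coefficient stays 0, to remove the freedom of adding a constant to all terms.
  set c : (Fin r → ℝ) → Fin (r + 1) → ℝ := fun t => Fin.cons 0 t with hc
  have hcc : ∀ i, Continuous fun t => c t i := by
    refine Fin.cases ?_ fun i => ?_
    · simpa [hc] using continuous_const
    · simpa [hc] using continuous_apply i
  have hmem : ∀ t, maxFn (fun i z => c t i + f i z) ∈ N := fun t =>
    IsTropicalModule.maxFn_mem hN fun i => hN.shift_mem _ (hf i) _
  obtain ⟨Φ, hΦc, hΦ⟩ := continuous_divisor_family hNR hmem fun z =>
    continuous_maxFn_apply fun i => (hcc i).add continuous_const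
  have hc0 : ∀ i, c 0 i = 0 := Fin.cases (by simp [hc]) (by simp [hc])
  have hΦ0 : Φ 0 = D := by
    refine IsTranslate.unique (hΦ 0) ?_
    simpa only [hc0, zero_add] using! hFD
  have hev1 : ∀ᶠ t in 𝓝 (0 : Fin r → ℝ), Φ t ∈ U :=
    hΦc.continuousAt.eventually_mem (hU.mem_nhds (hΦ0 ▸ hD))
  have hev2 : ∀ᶠ t in 𝓝 (0 : Fin r → ℝ), ∀ i j, j ≠ i → c t j + f j (x i) < c t i + f i (x i) := by
    refine eventually_all.2 fun i => eventually_all.2 fun j => ?_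
    by_cases hij : j = i
    · simp [hij]
    · have h1 := ((hcc j).add (continuous_const (y := f j (x i)))).continuousAt.eventually_lt
        (x₀ := 0) ((hcc i).add (continuous_const (y := f i (x i)))).continuousAt
        (by simpa [hc0] using hx i j hij)
      filter_upwards [h1] with t ht _ using ht
  obtain ⟨ε, hε, hball⟩ := Metric.eventually_nhds_iff_ball.1 (hev1.and hev2)
  -- Clamping to the unit cube and scaling by ε / 2 keeps the coefficients of all parameters inside
  -- the ball where term `i` still dominates at `x i`.
  set cl : (Fin r → ℝ) → Fin r → ℝ := fun x i => (ε / 2) * projIcc 0 1 zero_le_one (x i) with hcl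
  have hclc : Continuous cl := continuous_pi fun i => continuous_const.mul
    (continuous_subtype_val.comp (continuous_projIcc.comp (continuous_apply i)))
  have hclb : ∀ t, cl t ∈ Metric.ball 0 ε := fun t => by
    rw [mem_ball_zero_iff, pi_norm_lt_iff hε]
    intro i
    have h1 := (projIcc (0 : ℝ) 1 zero_le_one (t i)).2
    rw [Real.norm_eq_abs, abs_of_nonneg (mul_nonneg (by linarith) h1.1)]
    nlinarith [h1.2]
  refine ⟨fun t => Φ (cl t), hΦc.comp hclc, fun t => ⟨(hball _ (hclb t)).1, _, hmem _, hΦ _⟩, ?_⟩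
  intro t ht t' ht' heq
  have h3 : IsTranslate D₀ (maxFn fun i z => c (cl t') i + f i z) (Φ (cl t)) := by
    rw [show Φ (cl t) = Φ (cl t') from heq]
    exact hΦ (cl t')
  obtain ⟨k, hk⟩ := (hΦ (cl t)).eq_add_const (hNR (hmem _)).1 (hNR (hmem _)).1 h3
  -- Values at the points `x i` recover the coefficients, so equal divisors give coefficients that
  -- differ by one constant, which is 0 by the first of them.
  have hval : ∀ t i, maxFn (fun i z => c (cl t) i + f i z) (x i) = c (cl t) i + f i (x i) :=
    fun t i => maxFn_eq_of_forall_le fun j => by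
      by_cases hj : j = i
      · rw [hj]
      · exact ((hball _ (hclb t)).2 i j hj).le
  have hci : ∀ i, c (cl t) i = k + c (cl t') i := fun i => by
    have := hk (x i)
    rw [hval, hval] at this
    linarith
  have hk0 : k = 0 := by simpa [hc] using (hci 0).symm
  ext i
  have := hci i.succ
  simp only [hc, Fin.cons_succ, hk0, zero_add, hcl] at this
  have h2 := mul_left_cancel₀ (by positivity : ε / 2 ≠ 0) this
  rwa [projIcc_of_mem zero_le_one ⟨ht.1 i, ht.2 i⟩,
    projIcc_of_mem zero_le_one ⟨ht'.1 i, ht'.2 i⟩] at h2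

end WeightedGraph

end

/-! ### Maximal faces and their dimension -/

noncomputable section

open Set Filter Topology

theorem IsRationalPolyhedron.convex {n : ℕ} {P : Set (EuclideanSpace ℝ (Fin n))}
    (hP : IsRationalPolyhedron P) : Convex ℝ P := by
  obtain ⟨m, a, b, rfl⟩ := hP
  intro x hx y hy s t hs ht hst i
  have h1 : ∑ j, (a i j : ℝ) * (s • x + t • y) j =
      s * ∑ j, (a i j : ℝ) * x j + t * ∑ j, (a i j : ℝ) * y j := by
    simp only [Finset.mul_sum, ← Finset.sum_add_distrib]
    refine Finset.sum_congr rfl fun j _ => ?_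
    simp
    ring
  rw [h1]
  have h2 := mul_le_mul_of_nonneg_left (hx i) hs
  have h3 := mul_le_mul_of_nonneg_left (hy i) ht
  have h4 : s * b i + t * b i = b i := by rw [← add_mul, hst, one_mul]
  linarith

/-- Average one point outside each face. If the average maximized the functional defining a face,
every averaged point would maximize it too, including the one chosen outside that face. -/
theorem Convex.exists_notMem_exposed {F ι : Type*} [NormedAddCommGroup F] [NormedSpace ℝ F]
    {P : Set F} (hP : Convex ℝ P) (hne : P.Nonempty) (T : Finset ι) (η : ι → Set F)
    (hη : ∀ i ∈ T, IsExposed ℝ P (η i)) (hηP : ∀ i ∈ T, ∃ p ∈ P, p ∉ η i) :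
    ∃ q ∈ P, ∀ i ∈ T, q ∉ η i := by
  classical
  rcases T.eq_empty_or_nonempty with rfl | hT
  · exact ⟨_, hne.some_mem, by simp⟩
  have : ∀ i, ∃ p ∈ P, i ∈ T → p ∉ η i := fun i => by
    by_cases hi : i ∈ T
    · obtain ⟨p, hp, h⟩ := hηP i hi
      exact ⟨p, hp, fun _ => h⟩
    · exact ⟨_, hne.some_mem, fun h => absurd h hi⟩
  choose p hp hpη using this
  have hT0 : (0 : ℝ) < T.card := by exact_mod_cast hT.card_pos
  set q := ∑ i ∈ T, (T.card : ℝ)⁻¹ • p i with hq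
  have hqP : q ∈ P := hP.sum_mem (fun _ _ => by positivity)
    (by rw [Finset.sum_const, nsmul_eq_mul, mul_inv_cancel₀ hT0.ne']) fun i _ => hp i
  refine ⟨q, hqP, fun i hi hqi => ?_⟩
  obtain ⟨l, hl⟩ := hη i hi ⟨q, hqi⟩
  have hpi := hpη i hi
  rw [hl] at hqi hpi
  obtain ⟨y, hy, hly⟩ : ∃ y ∈ P, l (p i) < l y := by
    by_contra! h
    exact hpi ⟨hp i, h⟩
  have h1 : l q = ∑ j ∈ T, (T.card : ℝ)⁻¹ * l (p j) := by simp [hq, map_sum]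
  have h2 : ∑ j ∈ T, (T.card : ℝ)⁻¹ * l (p j) < ∑ _j ∈ T, (T.card : ℝ)⁻¹ * l q := by
    refine Finset.sum_lt_sum (fun j _ => ?_) ⟨i, hi, ?_⟩
    · exact mul_le_mul_of_nonneg_left (hqi.2 _ (hp j)) (by positivity)
    · exact mul_lt_mul_of_pos_left (hly.trans_le (hqi.2 y hy)) (by positivity)
  rw [← h1, Finset.sum_const, nsmul_eq_mul, ← mul_assoc, mul_inv_cancel₀ hT0.ne', one_mul] at h2
  exact lt_irrefl _ h2

namespace AbstractPolyhedralComplex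

variable {X : Type*} [TopologicalSpace X] (K : AbstractPolyhedralComplex X)

/-- The open set is the complement of the union of all other faces. It is nonempty because each of
these meets σ in a face, proper by maximality, and such faces cannot exhaust the convex set |σ|. -/
theorem exists_isOpen_subset_of_isMaximalFace {σ : K.cells} (hσ : K.IsMaximalFace σ)
    (hne : (σ : Set X).Nonempty) : ∃ W : Set X, IsOpen W ∧ W.Nonempty ∧ W ⊆ σ := by
  classical
  set T : Set (Set X) := K.cells \ {(σ : Set X)} with hT
  have hTf : T.Finite := K.finite.subset sdiff_subset
  have hcl : IsClosed (⋃₀ T) := by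
    rw [sUnion_eq_biUnion]
    exact hTf.isClosed_biUnion fun τ hτ => K.isClosed τ hτ.1
  refine ⟨(⋃₀ T)ᶜ, hcl.isOpen_compl, ?_, ?_⟩
  · set η : Set X → Set (EuclideanSpace ℝ (Fin (K.amb σ))) := fun τ =>
      {p | ∃ x : (σ : Set X), (x : X) ∈ (σ : Set X) ∩ τ ∧
        (K.chart σ x : EuclideanSpace ℝ _) = p} with hη
    obtain ⟨x₀, hx₀⟩ := hne
    obtain ⟨q, hq, hqT⟩ := (K.isRational σ).convex.exists_notMem_exposed
      ⟨_, (K.chart σ ⟨x₀, hx₀⟩).2⟩ hTf.toFinset η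
      (fun τ hτ => by
        have hτ' := (hTf.mem_toFinset.1 hτ).1
        have : η τ ∈ {η | IsExposed ℝ (K.poly σ) η} := by
          rw [← K.faces σ]
          exact ⟨⟨_, K.inter σ σ.2 τ hτ'⟩, inter_subset_left, rfl⟩
        exact this)
      (fun τ hτ => by
        have hτ' := hTf.mem_toFinset.1 hτ
        have hns : ¬ (σ : Set X) ⊆ τ := fun h =>
          hτ'.2 (Subset.antisymm (hσ.2 hτ'.1 h) h)
        obtain ⟨x, hxσ, hxτ⟩ := not_subset.1 hns
        refine ⟨K.chart σ ⟨x, hxσ⟩, (K.chart σ ⟨x, hxσ⟩).2, ?_⟩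
        rintro ⟨y, hy, hyx⟩
        have := (K.chart σ).injective (Subtype.ext hyx)
        rw [this] at hy
        exact hxτ hy.2)
    refine ⟨(K.chart σ).symm ⟨q, hq⟩, ?_⟩
    rintro ⟨τ, hτ, hxτ⟩
    refine hqT τ (hTf.mem_toFinset.2 hτ) ⟨(K.chart σ).symm ⟨q, hq⟩, ⟨Subtype.coe_prop _, hxτ⟩, ?_⟩
    simp
  · intro x hx
    obtain ⟨τ, hτ, hxτ⟩ := (K.cover ▸ mem_univ x : x ∈ ⋃₀ K.cells)
    by_contra hxσ
    exact hx ⟨τ, ⟨hτ, fun h => hxσ (h ▸ hxτ)⟩, hxτ⟩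

/-- A lower bound for the dimension of a face that contains a cube. -/
theorem le_dim_of_cube {σ : K.cells} {r : ℕ} {Φ : (Fin r → ℝ) → X} (hΦ : Continuous Φ)
    (hσ : ∀ t, Φ t ∈ (σ : Set X)) (hinj : InjOn Φ (Icc 0 1)) : (r : ℤ) ≤ K.dim σ := by
  set q : (Fin r → ℝ) → EuclideanSpace ℝ (Fin (K.amb σ)) := fun t => K.chart σ ⟨Φ t, hσ t⟩ with hq
  have hqc : Continuous q :=
    continuous_subtype_val.comp ((K.chart σ).continuous.comp (hΦ.subtype_mk hσ))
  have hqm : ∀ t, q t ∈ affineSpan ℝ (K.poly σ) := fun t =>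
    subset_affineSpan ℝ _ (K.chart σ ⟨Φ t, hσ t⟩).2
  have hne : K.poly σ ≠ ∅ := fun h =>
    notMem_empty (q 0) (h ▸ (K.chart σ ⟨Φ 0, hσ 0⟩).2)
  set W := (affineSpan ℝ (K.poly σ)).direction with hW
  have L : W ≃L[ℝ] (Fin (Module.finrank ℝ W) → ℝ) :=
    ContinuousLinearEquiv.ofFinrankEq (by simp)
  have hqW : ∀ t, q t - q 0 ∈ W := fun t => AffineSubspace.vsub_mem_direction (hqm t) (hqm 0)
  have hdim : K.dim σ = Module.finrank ℝ W := by rw [dim, if_neg hne]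
  rw [hdim, Nat.cast_le]
  refine le_of_cube_map_disjoint_facets (fun t => L ⟨q t - q 0, hqW t⟩) ?_ ?_
  · exact (L.continuous.comp ((hqc.sub continuous_const).subtype_mk hqW)).continuousOn
  · intro i x hx y hy hx0 hy1 hxy
    have h1 := congrArg Subtype.val (L.injective hxy)
    simp only [sub_left_inj] at h1
    have h2 := congrArg Subtype.val ((K.chart σ).injective (Subtype.ext h1))
    have h3 := hinj hx hy h2
    rw [h3, hy1] at hx0
    exact one_ne_zero hx0

end AbstractPolyhedralComplex

namespace WeightedGraph

variable {V E : Type*} [Fintype V] [Fintype E] {G : WeightedGraph V E}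
  [ConnectedSpace G.Point] [Nontrivial G.Point] {d : ℕ} {D₀ : G.EffDiv d}

/-- The local dimension of a tropical linear system is at least its rank. -/
theorem rank_le_dim_of_isMaximalFace {𝔡 : Set (G.EffDiv d)} (h𝔡 : IsTropicalLinearSystem D₀ 𝔡)
    (K : AbstractPolyhedralComplex 𝔡) {σ : K.cells} (hσ : K.IsMaximalFace σ) :
    rank 𝔡 ≤ K.dim σ := by
  -- If the empty face is maximal, the complex and 𝔡 are empty, and both sides equal -1.
  rcases (σ : Set 𝔡).eq_empty_or_nonempty with hemp | hne
  · have h1 : ∀ x : 𝔡, False := fun x => by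
      obtain ⟨τ, hτ, hxτ⟩ := (K.cover ▸ mem_univ x : x ∈ ⋃₀ K.cells)
      have := hσ.2 hτ (by rw [hemp]; exact empty_subset _) hxτ
      rw [hemp] at this
      exact this
    have h2 : 𝔡 = ∅ := eq_empty_iff_forall_notMem.2 fun x hx => h1 ⟨x, hx⟩
    have h3 : K.poly σ = ∅ := eq_empty_iff_forall_notMem.2 fun p hp =>
      h1 ((K.chart σ).symm ⟨p, hp⟩)
    simp [rank, AbstractPolyhedralComplex.dim, h2, h3]
  obtain ⟨W, hWo, ⟨x, hxW⟩, hWσ⟩ := K.exists_isOpen_subset_of_isMaximalFace hσ hne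
  obtain ⟨U, hU, rfl⟩ := isOpen_induced_iff.1 hWo
  obtain ⟨N, hN, hNR, hN𝔡⟩ := h𝔡
  obtain ⟨r, hr, hgr⟩ := rank_isGreatest (𝔡 := 𝔡) ⟨x, x.2⟩
  rw [hr]
  obtain ⟨Φ, hΦc, hΦ, hΦi⟩ := exists_cube (r := r) hN hNR
    (fun F => by
      obtain ⟨D, hD, hDF⟩ := hgr.1 F
      rw [hN𝔡] at hD
      obtain ⟨f, hf, hfD⟩ := hD
      exact ⟨f, hf, D, hfD, hDF⟩) hU
    (by
      have h1 : (x : G.EffDiv d) ∈ {D' | ∃ f ∈ N, IsTranslate D₀ f D'} := hN𝔡 ▸ x.2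
      obtain ⟨f, hf, hfD⟩ := h1
      exact ⟨f, hf, x, hxW, hfD⟩)
  have hmem : ∀ t, Φ t ∈ 𝔡 := fun t => by rw [hN𝔡]; exact (hΦ t).2
  exact K.le_dim_of_cube (Φ := fun t => ⟨Φ t, hmem t⟩) (hΦc.subtype_mk hmem)
    (fun t => hWσ (hΦ t).1) fun s hs t ht hst => hΦi hs ht (congrArg Subtype.val hst)

end WeightedGraph

end

/-! ### Polyhedral complexes from hyperplane arrangements -/

noncomputable section

open Set Filter Topology

section SignCells

variable {n : ℕ} {κ : Type*}

/-- A closed cell of an arrangement of hyperplanes: prescribed weak signs for affine functions. -/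
def signCell (a : κ → (Fin n → ℤ) × ℝ) (s : κ → SignType) : Set (EuclideanSpace ℝ (Fin n)) :=
  {x | ∀ k, (s k ≤ 0 → affEval (a k) x.ofLp ≤ 0) ∧ (0 ≤ s k → 0 ≤ affEval (a k) x.ofLp)}

variable (a : κ → (Fin n → ℤ) × ℝ) (s : κ → SignType)

theorem signCell_inter (s' : κ → SignType) :
    signCell a s ∩ signCell a s' = signCell a fun k => if s k = s' k then s k else 0 := by
  ext x
  simp only [signCell, mem_inter_iff, mem_ofPred_eq, ← forall_and]
  refine forall_congr' fun k => ?_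
  rcases (s k).trichotomy with h | h | h <;> rcases (s' k).trichotomy with h' | h' | h' <;>
    rw [h, h'] <;> simp <;> grind

theorem signCell_restrict (I : Set κ) [DecidablePred (· ∈ I)] :
    signCell a (fun k => if k ∈ I then 0 else s k) =
      {x ∈ signCell a s | ∀ k ∈ I, affEval (a k) x.ofLp = 0} := by
  ext x
  simp only [signCell, mem_ofPred_eq]
  constructor
  · intro h
    refine ⟨fun k => ?_, fun k hk => ?_⟩
    · have := h k
      by_cases hk : k ∈ I
      · simp only [hk, if_true, le_refl, true_imp_iff] at this
        exact ⟨fun _ => this.1, fun _ => this.2⟩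
      · simpa [hk] using this
    · have := h k
      simp only [hk, if_true, le_refl, true_imp_iff] at this
      exact le_antisymm this.1 this.2
  · rintro ⟨h, hI⟩ k
    by_cases hk : k ∈ I
    · simp [hI k hk, hk]
    · simpa [hk] using h k

theorem isClosed_signCell : IsClosed (signCell a s) := by
  have : signCell a s = ⋂ k, {x | s k ≤ 0 → affEval (a k) x.ofLp ≤ 0} ∩
      {x | 0 ≤ s k → 0 ≤ affEval (a k) x.ofLp} := by
    ext x; simp [signCell]
  rw [this]
  refine isClosed_iInter fun k => IsClosed.inter ?_ ?_
  · by_cases h : s k ≤ 0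
    · simp only [h, true_imp_iff]
      exact isClosed_le (by fun_prop) continuous_const
    · simp [h]
  · by_cases h : 0 ≤ s k
    · simp only [h, true_imp_iff]
      exact isClosed_le continuous_const (by fun_prop)
    · simp [h]

theorem isRationalPolyhedron_affEval [Finite κ] :
    IsRationalPolyhedron {x : EuclideanSpace ℝ (Fin n) | ∀ k, affEval (a k) x.ofLp ≤ 0} := by
  have := Fintype.ofFinite κ
  refine ⟨Fintype.card κ, fun i => (a ((Fintype.equivFin κ).symm i)).1,
    fun i => (a ((Fintype.equivFin κ).symm i)).2, ?_⟩
  ext x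
  simp only [mem_ofPred_eq, affEval, sub_nonpos]
  exact ((Fintype.equivFin κ).symm.forall_congr fun _ => Iff.rfl).symm

theorem isRationalPolyhedron_empty :
    IsRationalPolyhedron (∅ : Set (EuclideanSpace ℝ (Fin n))) := by
  refine ⟨1, 0, -1, ?_⟩
  ext x
  simp only [mem_empty_iff_false, mem_ofPred_eq, false_iff, not_forall]
  exact ⟨0, by simp⟩

theorem isRationalPolyhedron_signCell [Finite κ] : IsRationalPolyhedron (signCell a s) := by
  classical
  convert isRationalPolyhedron_affEval (n := n) (κ := κ × Bool) fun p =>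
    if p.2 then (if s p.1 ≤ 0 then a p.1 else 0) else (if 0 ≤ s p.1 then -a p.1 else 0)
    using 1
  ext x
  have h0 : affEval (0 : (Fin n → ℤ) × ℝ) x.ofLp = 0 := by simp [affEval]
  have hneg : ∀ b : (Fin n → ℤ) × ℝ, affEval (-b) x.ofLp = -affEval b x.ofLp := fun b => by
    simpa using affEval_zsmul (-1) b x.ofLp
  simp only [signCell, mem_ofPred_eq, Prod.forall, Bool.forall_bool]
  refine forall_congr' fun k => ?_
  by_cases h1 : s k ≤ 0 <;> by_cases h2 : 0 ≤ s k <;>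
    simp [h1, h2, h0, hneg, and_comm]

theorem sign_mul_affEval_nonneg {x : EuclideanSpace ℝ (Fin n)} (hx : x ∈ signCell a s) (k : κ) :
    0 ≤ (s k : ℝ) * affEval (a k) x.ofLp := by
  have := hx k
  rcases (s k).trichotomy with h | h | h <;> rw [h] at this ⊢ <;> simp_all

theorem affEval_eq_zero_of_sign_mul {x : EuclideanSpace ℝ (Fin n)} (hx : x ∈ signCell a s) {k : κ}
    (h0 : (s k : ℝ) * affEval (a k) x.ofLp = 0) : affEval (a k) x.ofLp = 0 := by
  have := hx k
  rcases (s k).trichotomy with h | h | h <;> rw [h] at this h0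
  · simpa using h0
  · exact le_antisymm (this.1 le_rfl) (this.2 le_rfl)
  · simpa using h0

/-- The linear part of an affine function, as a functional. -/
def affLinear (b : (Fin n → ℤ) × ℝ) : EuclideanSpace ℝ (Fin n) →L[ℝ] ℝ :=
  ∑ j, (b.1 j : ℝ) • EuclideanSpace.proj j

theorem affLinear_apply (b : (Fin n → ℤ) × ℝ) (x : EuclideanSpace ℝ (Fin n)) :
    affLinear b x = affEval b x.ofLp + b.2 := by
  simp [affLinear, affEval]

/-- On the cell each product of `s k` with the affine function is nonnegative. The sum of these
products over `I` attains its minimum 0 exactly where every one of them vanishes. -/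
theorem isExposed_signCell_face [Finite κ] (I : Set κ) :
    IsExposed ℝ (signCell a s) {x ∈ signCell a s | ∀ k ∈ I, affEval (a k) x.ofLp = 0} := by
  classical
  have := Fintype.ofFinite κ
  rintro ⟨x₀, hx₀, hx₀I⟩
  refine ⟨∑ k ∈ I.toFinset, (-(s k : ℝ)) • affLinear (a k), ?_⟩
  have hl : ∀ x y : EuclideanSpace ℝ (Fin n),
      (∑ k ∈ I.toFinset, (-(s k : ℝ)) • affLinear (a k)) y ≤
        (∑ k ∈ I.toFinset, (-(s k : ℝ)) • affLinear (a k)) x ↔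
      ∑ k ∈ I.toFinset, (s k : ℝ) * affEval (a k) x.ofLp ≤
        ∑ k ∈ I.toFinset, (s k : ℝ) * affEval (a k) y.ofLp := fun x y => by
    simp only [sum_apply, smul_apply, affLinear_apply,
      smul_eq_mul, neg_mul, Finset.sum_neg_distrib, neg_le_neg_iff, mul_add, Finset.sum_add_distrib,
      add_le_add_iff_right]
  ext x
  simp only [mem_ofPred_eq, hl]
  refine and_congr_right fun hx => ⟨fun h y hy => ?_, fun h k hk => ?_⟩
  · rw [Finset.sum_eq_zero fun k hk => by rw [h k (mem_toFinset.1 hk), mul_zero]]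
    exact Finset.sum_nonneg fun k _ => sign_mul_affEval_nonneg a s hy k
  · have h1 := h x₀ hx₀
    rw [Finset.sum_eq_zero (f := fun k => (s k : ℝ) * affEval (a k) x₀.ofLp) fun k hk => by
      rw [hx₀I k (mem_toFinset.1 hk), mul_zero]] at h1
    have h2 := (Finset.sum_eq_zero_iff_of_nonneg
      fun k _ => sign_mul_affEval_nonneg a s hx k).1 (le_antisymm h1
        (Finset.sum_nonneg fun k _ => sign_mul_affEval_nonneg a s hx k)) k (mem_toFinset.2 hk)
    exact affEval_eq_zero_of_sign_mul a s hx h2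

/-- Take `x₀` in the face with the fewest vanishing constraints. The midpoint of `x₀` and another
point of the face has no more of them, so the constraints of `x₀` vanish on the whole face.
Conversely, if they vanish at `x`, the segment from `x` can be prolonged beyond `x₀` inside the
cell, so the functional is not smaller at `x` than at `x₀`. -/
theorem exists_face_of_isExposed [Finite κ] {η : Set (EuclideanSpace ℝ (Fin n))}
    (hη : IsExposed ℝ (signCell a s) η) (hne : η.Nonempty) :
    ∃ I : Set κ, η = {x ∈ signCell a s | ∀ k ∈ I, affEval (a k) x.ofLp = 0} := by
  classical
  have := Fintype.ofFinite κ
  obtain ⟨l, rfl⟩ := hη hne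
  set Z : EuclideanSpace ℝ (Fin n) → Finset κ :=
    fun x => Finset.univ.filter fun k => affEval (a k) x.ofLp = 0 with hZ
  obtain ⟨x₀, hx₀, hmin⟩ := (measure fun x => (Z x).card).wf.has_min _ hne
  refine ⟨{k | affEval (a k) x₀.ofLp = 0}, ?_⟩
  have hmem : ∀ x y : EuclideanSpace ℝ (Fin n), ∀ t : ℝ, ∀ k,
      affEval (a k) ((1 - t) • x + t • y).ofLp =
        (1 - t) * affEval (a k) x.ofLp + t * affEval (a k) y.ofLp := fun x y t k => by
    simpa using affEval_combo (a k) x.ofLp y.ofLp t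
  ext x
  constructor
  · rintro ⟨hx, hlx⟩
    refine ⟨hx, fun k hk => ?_⟩
    set z := (1 - (1 / 2 : ℝ)) • x₀ + (1 / 2 : ℝ) • x with hz
    have hzP : z ∈ signCell a s := fun k => by
      rw [hz, hmem]
      have h1 := hx₀.1 k
      have h2 := hx k
      exact ⟨fun h => by linarith [h1.1 h, h2.1 h], fun h => by linarith [h1.2 h, h2.2 h]⟩
    have hzη : z ∈ {x ∈ signCell a s | ∀ y ∈ signCell a s, l y ≤ l x} := by
      refine ⟨hzP, fun y hy => ?_⟩
      have h1 := hx₀.2 y hy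
      have h2 := hlx y hy
      simp only [hz, map_add, map_smul, smul_eq_mul]
      linarith
    have hsub : Z z ⊆ Z x₀ := fun k hk => by
      simp only [hZ, Finset.mem_filter, Finset.mem_univ, true_and] at hk ⊢
      have h1 := sign_mul_affEval_nonneg a s hx₀.1 k
      have h2 := sign_mul_affEval_nonneg a s hx k
      rw [hz, hmem] at hk
      have h3 : (s k : ℝ) * ((1 - 1 / 2) * affEval (a k) x₀.ofLp + 1 / 2 * affEval (a k) x.ofLp) = 0 := by
        rw [hk, mul_zero]
      refine affEval_eq_zero_of_sign_mul a s hx₀.1 ?_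
      linarith
    have heq : Z z = Z x₀ :=
      Finset.eq_of_subset_of_card_le hsub (not_lt.1 (hmin z hzη))
    have hkz : k ∈ Z z := heq ▸ (by simpa [hZ] using hk)
    simp only [hZ, Finset.mem_filter, Finset.mem_univ, true_and] at hkz
    rw [hz, hmem, show affEval (a k) x₀.ofLp = 0 from hk] at hkz
    linarith
  · rintro ⟨hx, hxI⟩
    have hev : ∀ᶠ t in 𝓝[>] (0 : ℝ), (1 - -t) • x₀ + -t • x ∈ signCell a s := by
      refine nhdsWithin_le_nhds (eventually_all.2 fun k => ?_)
      by_cases hk : affEval (a k) x₀.ofLp = 0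
      · refine .of_forall fun t => ?_
        rw [hmem, hk, hxI k hk]
        simp
      · have hcont : Continuous fun t : ℝ => affEval (a k) ((1 - -t) • x₀ + -t • x).ofLp := by
          simp only [hmem]; fun_prop
        have h1 := hx₀.1 k
        rcases lt_or_gt_of_ne hk with hneg | hpos
        · have h2 : ∀ᶠ t in 𝓝 (0 : ℝ), affEval (a k) ((1 - -t) • x₀ + -t • x).ofLp < 0 :=
            hcont.continuousAt.eventually_lt continuousAt_const (by simpa using hneg)
          filter_upwards [h2] with t ht
          exact ⟨fun _ => ht.le, fun h => absurd (h1.2 h) (not_le.2 hneg)⟩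
        · have h2 : ∀ᶠ t in 𝓝 (0 : ℝ), 0 < affEval (a k) ((1 - -t) • x₀ + -t • x).ofLp :=
            continuousAt_const.eventually_lt hcont.continuousAt (by simpa using hpos)
          filter_upwards [h2] with t ht
          exact ⟨fun h => absurd (h1.1 h) (not_le.2 hpos), fun _ => ht.le⟩
    obtain ⟨t, ht, ht0⟩ := (hev.and self_mem_nhdsWithin).exists
    have ht0 : 0 < t := ht0
    refine ⟨hx, fun y hy => (hx₀.2 y hy).trans ?_⟩
    have h1 := hx₀.2 _ ht
    simp only [map_add, map_smul, smul_eq_mul] at h1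
    nlinarith

theorem isExposed_signCell_iff [Finite κ] (η : Set (EuclideanSpace ℝ (Fin n))) :
    IsExposed ℝ (signCell a s) η ↔ η = ∅ ∨ ∃ s', η = signCell a s' ∧ η ⊆ signCell a s := by
  classical
  constructor
  · intro h
    rcases η.eq_empty_or_nonempty with h0 | h0
    · exact Or.inl h0
    · obtain ⟨I, hI⟩ := exists_face_of_isExposed a s h h0
      exact Or.inr ⟨_, hI.trans (signCell_restrict a s I).symm, hI ▸ sep_subset _ _⟩
  · rintro (rfl | ⟨s', rfl, hsub⟩)
    · rintro ⟨_, h⟩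
      exact absurd h (notMem_empty _)
    · have h1 := signCell_inter a s s'
      rw [inter_eq_right.2 hsub] at h1
      have h2 : (fun k => if s k = s' k then s k else 0) =
          fun k => if k ∈ {k | s k ≠ s' k} then 0 else s k := by
        ext k; by_cases h : s k = s' k <;> simp [h]
      rw [h1, h2, signCell_restrict]
      exact isExposed_signCell_face a s _

end SignCells

/-- The faces are the empty set and the closed sign cells contained in `C`. All charts are
restrictions of the one embedding `h`, so the isometries between faces are identities. -/
theorem IsSemilin.exists_polyhedralComplex {n : ℕ} {S : Set (Fin n → ℝ)} (hS : IsSemilin S)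
    {C : Set (EuclideanSpace ℝ (Fin n))} (hC : IsClosed C) (hCS : ∀ x, x ∈ C ↔ x.ofLp ∈ S)
    {X : Type*} [TopologicalSpace X] [T2Space X] (h : X ≃ₜ C) :
    ∃ K : AbstractPolyhedralComplex X, K.ChartsIsometric := by
  classical
  obtain ⟨A, hA⟩ := hS
  set a : A → (Fin n → ℤ) × ℝ := Subtype.val with ha
  set IsCell : Set (EuclideanSpace ℝ (Fin n)) → Prop := fun P => P = ∅ ∨ ∃ s, P = signCell a s
    with hIsCell
  set img : Set X → Set (EuclideanSpace ℝ (Fin n)) := fun Y => {p | ∃ x ∈ Y, (h x : _) = p} with himg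
  set cells : Set (Set X) := {Y | ∃ P, IsCell P ∧ P ⊆ C ∧ Y = {x | (h x : EuclideanSpace ℝ _) ∈ P}}
    with hcells
  have img_pre : ∀ P ⊆ C, img {x | (h x : EuclideanSpace ℝ _) ∈ P} = P := by
    intro P hP
    ext p
    constructor
    · rintro ⟨x, hx, rfl⟩; exact hx
    · intro hp
      exact ⟨h.symm ⟨p, hP hp⟩, by simpa using hp, by simp⟩
  have pre_img : ∀ Y : Set X, {x | (h x : EuclideanSpace ℝ _) ∈ img Y} = Y := by
    intro Y
    ext x
    constructor
    · rintro ⟨y, hy, hyx⟩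
      rwa [← h.injective (Subtype.ext hyx)]
    · intro hx; exact ⟨x, hx, rfl⟩
  have img_cell : ∀ Y ∈ cells, IsCell (img Y) ∧ img Y ⊆ C := by
    rintro _ ⟨P, hP, hPC, rfl⟩
    rw [img_pre P hPC]
    exact ⟨hP, hPC⟩
  let chart : (σ : Set X) → σ ≃ₜ img σ := fun σ =>
    { toFun := fun x => ⟨h x, x, x.2, rfl⟩
      invFun := fun p => ⟨h.symm ⟨p, by obtain ⟨x, _, hx⟩ := p.2; rw [← hx]; exact (h x).2⟩, by
        obtain ⟨x, hx, hxp⟩ := p.2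
        convert hx
        rw [Homeomorph.symm_apply_eq]
        exact Subtype.ext hxp.symm⟩
      left_inv := fun x => by simp
      right_inv := fun p => by simp
      continuous_toFun := by fun_prop
      continuous_invFun := by fun_prop }
  have chart_set : ∀ σ τ : Set X, τ ⊆ σ →
      {p | ∃ x : σ, (x : X) ∈ τ ∧ (chart σ x : EuclideanSpace ℝ (Fin n)) = p} = img τ := by
    intro σ τ hτ
    ext p
    constructor
    · rintro ⟨x, hx, rfl⟩; exact ⟨x, hx, rfl⟩
    · rintro ⟨x, hx, rfl⟩; exact ⟨⟨x, hτ hx⟩, hx, rfl⟩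
  have img_mono : ∀ σ τ : Set X, τ ⊆ σ → img τ ⊆ img σ := by
    rintro σ τ hτ _ ⟨x, hx, rfl⟩
    exact ⟨x, hτ hx, rfl⟩
  have hfin : cells.Finite := by
    refine ((finite_range fun s => {x | (h x : EuclideanSpace ℝ _) ∈ signCell a s}).union
      (finite_singleton ∅)).subset ?_
    rintro _ ⟨P, rfl | ⟨s, rfl⟩, -, rfl⟩
    · exact Or.inr (by ext; simp)
    · exact Or.inl ⟨s, rfl⟩
  have hinter : ∀ P Q, IsCell P → IsCell Q → IsCell (P ∩ Q) := by
    rintro _ _ (rfl | ⟨s, rfl⟩) (rfl | ⟨s', rfl⟩)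
    · exact Or.inl (by simp)
    · exact Or.inl (by simp)
    · exact Or.inl (by simp)
    · exact Or.inr ⟨_, signCell_inter a s s'⟩
  have hclosed : ∀ P, IsCell P → IsClosed P := by
    rintro _ (rfl | ⟨s, rfl⟩)
    · exact isClosed_empty
    · exact isClosed_signCell a s
  have hrat : ∀ P, IsCell P → IsRationalPolyhedron P := by
    rintro _ (rfl | ⟨s, rfl⟩)
    · exact isRationalPolyhedron_empty
    · exact isRationalPolyhedron_signCell a s
  have hexp : ∀ P, IsCell P → ∀ η, IsExposed ℝ P η ↔ IsCell η ∧ η ⊆ P := by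
    rintro _ (rfl | ⟨s, rfl⟩) η
    · constructor
      · intro hη
        have := subset_empty_iff.1 hη.subset
        exact ⟨Or.inl this, hη.subset⟩
      · rintro ⟨-, hη⟩
        rintro ⟨x, hx⟩
        exact absurd (hη hx) (notMem_empty x)
    · rw [isExposed_signCell_iff]
      constructor
      · rintro (rfl | ⟨s', rfl, hsub⟩)
        · exact ⟨Or.inl rfl, empty_subset _⟩
        · exact ⟨Or.inr ⟨s', rfl⟩, hsub⟩
      · rintro ⟨rfl | ⟨s', rfl⟩, hsub⟩
        · exact Or.inl rfl
        · exact Or.inr ⟨s', rfl, hsub⟩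
  -- In the closed cell given by the signs at `x`, the points of the segment from any `y` to `x`,
  -- other than `y`, have exactly the signs of `x` and so belong to `C`; then `y` does because `C`
  -- is closed.
  have hcover : ∀ x ∈ C, ∃ s, x ∈ signCell a s ∧ signCell a s ⊆ C := by
    intro x hx
    refine ⟨fun k => SignType.sign (affEval (a k) x.ofLp), fun k => ⟨?_, ?_⟩, fun y hy => ?_⟩
    · intro h1
      change SignType.sign (affEval (a k) x.ofLp) ≤ 0 at h1
      by_contra! h2
      rw [sign_pos h2] at h1
      exact absurd h1 (by decide)
    · intro h1
      change 0 ≤ SignType.sign (affEval (a k) x.ofLp) at h1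
      by_contra! h2
      rw [sign_neg h2] at h1
      exact absurd h1 (by decide)
    · have hlim : Tendsto (fun t : ℝ => (1 - t) • y + t • x) (𝓝[>] 0) (𝓝 y) := by
        have : Continuous fun t : ℝ => (1 - t) • y + t • x := by fun_prop
        have h2 := (this.tendsto 0).mono_left (nhdsWithin_le_nhds (s := Ioi 0))
        simpa using h2
      refine hC.mem_of_tendsto hlim ?_
      filter_upwards [Ioo_mem_nhdsGT (one_pos (α := ℝ))] with t ht
      rw [hCS]
      refine hA _ _ (fun b hb => ?_) ((hCS x).1 hx)
      have h2 := hy ⟨b, hb⟩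
      have h3 : affEval b ((1 - t) • y + t • x).ofLp =
          (1 - t) * affEval b y.ofLp + t * affEval b x.ofLp := by
        simpa using affEval_combo b y.ofLp x.ofLp t
      have ht1 : 0 < 1 - t := by linarith [ht.2]
      rw [h3]
      simp only [ha] at h2
      rcases lt_trichotomy (affEval b x.ofLp) 0 with h4 | h4 | h4
      · rw [sign_neg h4] at h2 ⊢
        have h5 := h2.1 (by decide)
        rw [sign_neg (by nlinarith [mul_neg_of_pos_of_neg ht.1 h4])]
      · rw [h4, sign_zero] at h2
        have h5 := le_antisymm (h2.1 le_rfl) (h2.2 le_rfl)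
        rw [h4, h5]
        simp
      · rw [sign_pos h4] at h2 ⊢
        have h5 := h2.2 (by decide)
        rw [sign_pos (by nlinarith [mul_pos ht.1 h4])]
  refine ⟨{
    t2 := inferInstance
    cells := cells
    finite := hfin
    cover := ?_
    isClosed := ?_
    amb := fun _ => n
    poly := fun σ => img σ
    isRational := fun σ => hrat _ (img_cell σ σ.2).1
    chart := fun σ => chart σ
    faces := ?_
    isometric := ?_
    inter := ?_ }, ?_⟩
  · refine eq_univ_of_forall fun x => ?_
    obtain ⟨s, hxs, hsC⟩ := hcover (h x) (h x).2
    exact ⟨_, ⟨_, Or.inr ⟨s, rfl⟩, hsC, rfl⟩, hxs⟩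
  · rintro _ ⟨P, hP, -, rfl⟩
    exact (hclosed P hP).preimage (continuous_subtype_val.comp h.continuous)
  · intro σ
    ext η
    change (∃ τ : cells, _) ↔ IsExposed ℝ (img σ) η
    rw [hexp _ (img_cell σ σ.2).1]
    constructor
    · rintro ⟨τ, hτ, rfl⟩
      rw [chart_set σ τ hτ]
      exact ⟨(img_cell τ τ.2).1, img_mono _ _ hτ⟩
    · rintro ⟨hη, hsub⟩
      have hηC := hsub.trans (img_cell σ σ.2).2
      have hτσ : {x | (h x : EuclideanSpace ℝ _) ∈ η} ⊆ (σ : Set X) := by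
        intro x hx
        rw [← pre_img σ]
        exact hsub hx
      refine ⟨⟨{x | (h x : EuclideanSpace ℝ _) ∈ η}, η, hη, hηC, rfl⟩, hτσ, ?_⟩
      rw [chart_set σ _ hτσ, img_pre η hηC]
  · intro σ τ hτ
    exact ⟨⟨Equiv.setCongr (chart_set σ τ hτ).symm, fun _ _ => rfl⟩⟩
  · rintro _ ⟨P, hP, hPC, rfl⟩ _ ⟨Q, hQ, -, rfl⟩
    exact ⟨P ∩ Q, hinter P Q hP hQ, inter_subset_left.trans hPC, by ext; simp⟩
  · intro σ τ hτ x y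
    rfl

end

/-! ### Coefficients of finitely generated tropical linear systems -/

noncomputable section

open Set Filter Topology

namespace WeightedGraph

variable {V E : Type*} {G : WeightedGraph V E}

/-! ### Rational functions on an edge as piecewise affine functions -/

/-- The function of the parameter `t` of the edge `e` with value `a` at `0`, initial slope `m`, and
changes of slope prescribed by a divisor. -/
def edgeFn (P : G.Divisor) (e : E) (a : ℝ) (m : ℤ) (t : ℝ) : ℝ :=
  a + m * t + G.edgePairing P e fun y => max (t - y) 0

theorem IsPiecewiseAff.edgePairing {ι : Type*} [Fintype ι] {T : (ι → ℝ) → ℝ}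
    (hT : IsPiecewiseAff T) (P : G.Divisor) (e : E) :
    IsPiecewiseAff fun w => G.edgePairing P e fun y => max (T w - y) 0 := by
  refine IsPiecewiseAff.sum _ fun x _ => IsPiecewiseAff.zmul ?_ _
  rcases x with v | ⟨e', y, h0, h1⟩
  · exact isPiecewiseAff_const 0
  · simp only [onEdge]
    split_ifs
    · simpa only [sub_eq_add_neg] using (hT.add (isPiecewiseAff_const (-y))).posPart
    · exact isPiecewiseAff_const 0

theorem IsPiecewiseAff.edgeFn {ι : Type*} [Fintype ι] {T : (ι → ℝ) → ℝ}
    (hT : IsPiecewiseAff T) (P : G.Divisor) (e : E) (a : ℝ) (m : ℤ) :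
    IsPiecewiseAff fun w => edgeFn P e a m (T w) :=
  ((isPiecewiseAff_const a).add (hT.zmul m)).add (IsPiecewiseAff.edgePairing hT P e)

theorem IsRational.exists_edgeFn [Fintype V] [Fintype E] {f : G.Point → ℝ} (hf : G.IsRational f)
    (e : E) : ∃ P : G.Divisor, ∃ a : ℝ, ∃ m : ℤ, ∀ t ∈ Icc 0 (G.len e),
      f (G.pt e t) = edgeFn P e a m t := by
  obtain ⟨P, hP⟩ := hf.exists_isDivOf
  obtain ⟨m, hm⟩ := hf.exists_int_slopeFwd e (t := 0) ⟨le_rfl, G.len_pos e⟩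
  exact ⟨P, f (.vertex (G.src e)), m, fun t ht => by rw [hf.eq_on_edge hP e ht, hm]; rfl⟩

/-! ### Finitely generated tropical modules -/

/-- The tropical linear combination of functions `g i` with coefficients `c i`. -/
def tropComb {n : ℕ} {X : Type*} (g : Fin (n + 1) → X → ℝ) (c : Fin (n + 1) → ℝ) : X → ℝ :=
  maxFn fun i x => c i + g i x

section TropComb

variable {n : ℕ} {X : Type*} {g : Fin (n + 1) → X → ℝ} {c c' : Fin (n + 1) → ℝ}

theorem le_tropComb (g : Fin (n + 1) → X → ℝ) (c : Fin (n + 1) → ℝ) (i : Fin (n + 1)) (x : X) :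
    c i + g i x ≤ tropComb g c x := le_maxFn (fun i x => c i + g i x) i x

theorem tropComb_le_iff {x : X} {a : ℝ} : tropComb g c x ≤ a ↔ ∀ i, c i + g i x ≤ a :=
  maxFn_le_iff

theorem exists_eq_tropComb (g : Fin (n + 1) → X → ℝ) (c : Fin (n + 1) → ℝ) (x : X) :
    ∃ i, tropComb g c x = c i + g i x := exists_eq_maxFn _ x

theorem eq_tropComb_iff {x : X} {a : ℝ} :
    a = tropComb g c x ↔ (∀ i, c i + g i x ≤ a) ∧ ∃ i, a ≤ c i + g i x := by
  constructor
  · rintro rfl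
    obtain ⟨i, hi⟩ := exists_eq_tropComb g c x
    exact ⟨fun i => le_tropComb g c i x, i, hi.le⟩
  · rintro ⟨h1, i, hi⟩
    exact le_antisymm (hi.trans (le_tropComb g c i x)) (tropComb_le_iff.2 h1)

theorem tropComb_shift (g : Fin (n + 1) → X → ℝ) (c : Fin (n + 1) → ℝ) (k : ℝ) :
    tropComb g (fun i => k + c i) = fun x => k + tropComb g c x := by
  ext x
  symm
  rw [eq_tropComb_iff]
  obtain ⟨i, hi⟩ := exists_eq_tropComb g c x
  exact ⟨fun i => by linarith [le_tropComb g c i x], i, by linarith⟩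

theorem tropComb_sup (g : Fin (n + 1) → X → ℝ) (c c' : Fin (n + 1) → ℝ) :
    tropComb g c ⊔ tropComb g c' = tropComb g (c ⊔ c') := by
  ext x
  apply le_antisymm
  · refine sup_le (tropComb_le_iff.2 fun i => ?_) (tropComb_le_iff.2 fun i => ?_)
    · exact le_trans (by gcongr; exact le_sup_left) (le_tropComb g (c ⊔ c') i x)
    · exact le_trans (by gcongr; exact le_sup_right) (le_tropComb g (c ⊔ c') i x)
  · refine tropComb_le_iff.2 fun i => ?_
    rw [Pi.sup_apply, Pi.sup_apply, max_add]
    exact sup_le_sup (le_tropComb g c i x) (le_tropComb g c' i x)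

/-- The coefficient -∞ is not available, so a generator is a combination only when the other terms
can be pushed below it by finite coefficients; this is what `hg` provides. -/
theorem tropicalSpan_range (hg : ∀ i j, ∃ b, ∀ x, g i x ≤ b + g j x) :
    tropicalSpan (range g) = range (tropComb g) := by
  apply Subset.antisymm
  · refine sInter_subset_of_mem ⟨⟨?_, ?_⟩, ?_⟩
    · rintro _ ⟨c, rfl⟩ _ ⟨c', rfl⟩
      exact ⟨c ⊔ c', (tropComb_sup g c c').symm⟩
    · rintro _ ⟨c, rfl⟩ k
      exact ⟨fun i => k + c i, tropComb_shift g c k⟩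
    · rintro _ ⟨j, rfl⟩
      choose b hb using fun i => hg i j
      refine ⟨fun i => if i = j then 0 else -b i, ?_⟩
      ext x
      symm
      rw [eq_tropComb_iff]
      refine ⟨fun i => ?_, j, by simp⟩
      split_ifs with h
      · simp [h]
      · linarith [hb i x]
  · rintro _ ⟨c, rfl⟩ N ⟨hN, hgN⟩
    exact IsTropicalModule.maxFn_mem hN fun i => hN.shift_mem _ (hgN ⟨i, rfl⟩) _

theorem tropicalSpan_empty : tropicalSpan (∅ : Set (X → ℝ)) = ∅ :=
  subset_empty_iff.1 (sInter_subset_of_mem ⟨⟨by simp, by simp⟩, Subset.rfl⟩)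

/-- The tropical combinations with first coefficient `0` in which every term attains the maximum
somewhere. -/
def normalizedCoeffs (g : Fin (n + 1) → X → ℝ) : Set (Fin (n + 1) → ℝ) :=
  {c | c 0 = 0 ∧ ∀ i, ∃ x, ∀ j, c j + g j x ≤ c i + g i x}

/-- A coefficient whose term attains the maximum somewhere is the largest one compatible with the
function, so the function determines it. The first coordinates then force `k = 0`. -/
theorem eq_of_tropComb_eq (hc : c ∈ normalizedCoeffs g)
    (hc' : c' ∈ normalizedCoeffs g) {k : ℝ} (h : ∀ x, tropComb g c x = k + tropComb g c' x) :
    c = c' := by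
  have h1 : ∀ i, c i = k + c' i := by
    intro i
    apply le_antisymm
    · obtain ⟨x, hx⟩ := hc'.2 i
      have h2 : tropComb g c' x = c' i + g i x :=
        (eq_tropComb_iff.2 ⟨hx, i, le_rfl⟩).symm
      linarith [h x, le_tropComb g c i x]
    · obtain ⟨x, hx⟩ := hc.2 i
      have h2 : tropComb g c x = c i + g i x :=
        (eq_tropComb_iff.2 ⟨hx, i, le_rfl⟩).symm
      linarith [h x, le_tropComb g c' i x]
  have h0 := h1 0
  rw [hc.1, hc'.1, add_zero] at h0
  ext i
  rw [h1 i, ← h0, zero_add]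

end TropComb

variable [Fintype E] {d : ℕ} {D₀ : G.EffDiv d}

/-- The functions `g i` generate the cone over the tropical linear system `𝔡`. -/
structure Generates {n : ℕ} (D₀ : G.EffDiv d) (𝔡 : Set (G.EffDiv d))
    (g : Fin (n + 1) → G.Point → ℝ) : Prop where
  mem_ratSpace : ∀ i, g i ∈ ratSpace D₀
  tropComb_mem : ∀ c, tropComb g c ∈ ratSpace D₀
  mem_iff : ∀ D, D ∈ 𝔡 ↔ ∃ c, IsTranslate D₀ (tropComb g c) D

theorem Generates.continuous {n : ℕ} {𝔡 : Set (G.EffDiv d)} {g : Fin (n + 1) → G.Point → ℝ}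
    (hg : Generates D₀ 𝔡 g) (i : Fin (n + 1)) : Continuous (g i) :=
  (hg.mem_ratSpace i).1.1

variable [ConnectedSpace G.Point] [Nontrivial G.Point]

theorem IsFinGen.exists_generates {𝔡 : Set (G.EffDiv d)} (h𝔡 : IsTropicalLinearSystem D₀ 𝔡)
    (hfg : IsFinGen D₀ 𝔡) (hne : 𝔡.Nonempty) :
    ∃ (n : ℕ) (g : Fin (n + 1) → G.Point → ℝ), Generates D₀ 𝔡 g := by
  obtain ⟨S, hS, hspan⟩ := hfg
  obtain ⟨N, hN, hNR, hN𝔡⟩ := h𝔡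
  have hmem : ∀ D, D ∈ 𝔡 ↔ ∃ f ∈ cone D₀ 𝔡, IsTranslate D₀ f D := by
    intro D
    constructor
    · intro hD
      have h1 : D ∈ {D' | ∃ f ∈ N, IsTranslate D₀ f D'} := hN𝔡 ▸ hD
      obtain ⟨f, hf, hfD⟩ := h1
      exact ⟨f, ⟨hNR hf, D, hD, hfD⟩, hfD⟩
    · rintro ⟨f, ⟨-, D', hD', hfD'⟩, hfD⟩
      rwa [hfD.unique hfD']
  have hSne : S.Nonempty := by
    rw [nonempty_iff_ne_empty]
    rintro rfl
    obtain ⟨D, hD⟩ := hne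
    obtain ⟨f, hf, -⟩ := (hmem D).1 hD
    rw [← hspan, tropicalSpan_empty] at hf
    exact hf
  have := hS.to_subtype
  have := hSne.to_subtype
  obtain ⟨k, ⟨e⟩⟩ := Finite.exists_equiv_fin S
  obtain ⟨n, rfl⟩ : ∃ n, k = n + 1 := Nat.exists_eq_succ_of_ne_zero fun hk => by
    subst hk; exact (e (Classical.arbitrary S)).elim0
  set g : Fin (n + 1) → G.Point → ℝ := fun i => (e.symm i).1 with hg
  have hrange : range g = S := by
    ext f
    constructor
    · rintro ⟨i, rfl⟩; exact (e.symm i).2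
    · intro hf; exact ⟨e ⟨f, hf⟩, by simp [hg]⟩
  have hgc : ∀ i, g i ∈ cone D₀ 𝔡 := fun i => by
    rw [← hspan]
    exact fun M hM => hM.2 (e.symm i).2
  have hspan' : range (tropComb g) = cone D₀ 𝔡 := by
    rw [← hspan, ← hrange, tropicalSpan_range]
    intro i j
    have := G.compactSpace_point
    obtain ⟨b, hb⟩ := (isCompact_univ (X := G.Point)).exists_bound_of_continuousOn
      ((hgc i).1.1.1.sub (hgc j).1.1.1).continuousOn
    refine ⟨b, fun x => ?_⟩
    have := (le_abs_self _).trans (hb x (mem_univ x))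
    simp only [Pi.sub_apply] at this
    linarith
  refine ⟨n, g, fun i => (hgc i).1, fun c => ?_, fun D => ?_⟩
  · have : tropComb g c ∈ cone D₀ 𝔡 := hspan' ▸ mem_range_self c
    exact this.1
  · rw [hmem, ← hspan']
    simp

namespace Generates

variable {n : ℕ} {𝔡 : Set (G.EffDiv d)} {g : Fin (n + 1) → G.Point → ℝ}

/-- Closed, since the conditions are projections along the compact graph of closed sets. Bounded, by
comparing term `i` with term 0 at a point where one or the other is maximal. -/
theorem isCompact_normalizedCoeffs (hg : Generates D₀ 𝔡 g) : IsCompact (normalizedCoeffs g) := by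
  have := G.compactSpace_point
  have hgc := hg.continuous
  choose b hb using fun i => (isCompact_univ (X := G.Point)).exists_bound_of_continuousOn
    ((hg.continuous 0).sub (hg.continuous i)).continuousOn
  refine IsCompact.of_isClosed_subset (isCompact_Icc (a := -b) (b := b)) ?_ ?_
  · have : normalizedCoeffs g = {c | c 0 = 0} ∩ ⋂ i, Prod.fst '' {q : (Fin (n + 1) → ℝ) × G.Point |
        ∀ j, q.1 j + g j q.2 ≤ q.1 i + g i q.2} := by
      ext c
      simp [normalizedCoeffs]
    rw [this]
    refine (isClosed_eq (continuous_apply 0) continuous_const).inter (isClosed_iInter fun i => ?_)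
    refine isClosedMap_fst_of_compactSpace _ ?_
    have : {q : (Fin (n + 1) → ℝ) × G.Point | ∀ j, q.1 j + g j q.2 ≤ q.1 i + g i q.2} =
        ⋂ j, {q | q.1 j + g j q.2 ≤ q.1 i + g i q.2} := by ext; simp
    rw [this]
    refine isClosed_iInter fun j => isClosed_le ?_ ?_
    · exact ((continuous_apply j).comp continuous_fst).add ((hgc j).comp continuous_snd)
    · exact ((continuous_apply i).comp continuous_fst).add ((hgc i).comp continuous_snd)
  · rintro c ⟨hc0, hc⟩
    refine ⟨fun i => ?_, fun i => ?_⟩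
    · obtain ⟨x, hx⟩ := hc i
      have h1 := hx 0
      have h2 := (neg_abs_le _).trans' (neg_le_neg (hb i x (mem_univ x)))
      simp only [Pi.sub_apply, Pi.neg_apply] at h2 ⊢
      linarith
    · obtain ⟨x, hx⟩ := hc 0
      have h1 := hx i
      have h2 := (le_abs_self _).trans (hb i x (mem_univ x))
      simp only [Pi.sub_apply] at h2
      linarith

/-- The canonical coefficients of a tropical combination. -/
theorem exists_canonical (hg : Generates D₀ 𝔡 g) (c : Fin (n + 1) → ℝ) :
    ∃ c', tropComb g c' = tropComb g c ∧ ∀ i, ∃ x, ∀ j, c' j + g j x ≤ c' i + g i x := by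
  have := G.compactSpace_point
  choose x hx using fun i => (isCompact_univ (X := G.Point)).exists_isMinOn univ_nonempty
    (((hg.tropComb_mem c).1.1.sub (hg.continuous i)).continuousOn (s := univ))
  have hmin : ∀ i z, tropComb g c (x i) - g i (x i) ≤ tropComb g c z - g i z :=
    fun i z => (hx i).2 (mem_univ z)
  -- The minimum of `tropComb g c - g i`: the largest coefficient that keeps term `i` below the
  -- function, so the term touches it at `x i`.
  set c' : Fin (n + 1) → ℝ := fun i => tropComb g c (x i) - g i (x i) with hc'
  have heq : tropComb g c' = tropComb g c := by
    ext z
    symm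
    rw [eq_tropComb_iff]
    obtain ⟨i, hi⟩ := exists_eq_tropComb g c z
    exact ⟨fun i => by linarith [hmin i z],
      i, by simp only [hc']; linarith [le_tropComb g c i (x i)]⟩
  refine ⟨c', heq, fun i => ⟨x i, fun j => ?_⟩⟩
  have := le_tropComb g c' j (x i)
  rw [heq] at this
  simpa [hc'] using this

variable [Fintype V]

/-- A point of the graph is an edge, from a finite set, together with one real parameter, in which
the generators are piecewise affine. The parameter is then eliminated. -/
theorem isSemilin_normalizedCoeffs (hg : Generates D₀ 𝔡 g) : IsSemilin (normalizedCoeffs g) := by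
  choose P a m hP using fun i => (hg.mem_ratSpace i).1.exists_edgeFn
  set S : Fin (n + 1) → E → Set (Fin (n + 1) ⊕ Unit → ℝ) := fun i e =>
    {w | (0 ≤ w (.inr ()) ∧ w (.inr ()) ≤ G.len e) ∧
      ∀ j, w (.inl j) + edgeFn (P j e) e (a j e) (m j e) (w (.inr ())) ≤
        w (.inl i) + edgeFn (P i e) e (a i e) (m i e) (w (.inr ()))} with hS
  have hT : IsPiecewiseAff fun w : Fin (n + 1) ⊕ Unit → ℝ => w (.inr ()) := isPiecewiseAff_apply _
  have hSs : ∀ i e, IsSemilin (S i e) := fun i e => by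
    refine (((isPiecewiseAff_const 0).setOf_le hT).and
      (hT.setOf_le (isPiecewiseAff_const _))).and (IsSemilin.forall_fintype fun j => ?_)
    exact ((isPiecewiseAff_apply _).add (IsPiecewiseAff.edgeFn hT _ _ _ _)).setOf_le
      ((isPiecewiseAff_apply _).add (IsPiecewiseAff.edgeFn hT _ _ _ _))
  convert ((isPiecewiseAff_apply (0 : Fin (n + 1))).setOf_eq (isPiecewiseAff_const 0)).and
    (IsSemilin.forall_fintype fun i => IsSemilin.exists_fintype fun e => (hSs i e).exists_elim)
    using 1
  ext c
  simp only [normalizedCoeffs, mem_ofPred_eq]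
  refine and_congr_right fun _ => forall_congr' fun i => ?_
  constructor
  · rintro ⟨x, hx⟩
    obtain ⟨e, t, ht, rfl⟩ := G.exists_pt_eq x
    refine ⟨e, fun _ => t, ⟨ht.1, ht.2⟩, fun j => ?_⟩
    have := hx j
    rw [hP j e t ht, hP i e t ht] at this
    exact this
  · rintro ⟨e, z, hz, hj⟩
    replace hz : z () ∈ Icc 0 (G.len e) := hz
    refine ⟨G.pt e (z ()), fun j => ?_⟩
    rw [hP j e _ hz, hP i e _ hz]
    exact hj j

/-- A finitely generated tropical linear system is homeomorphic to a compact semilinear set. -/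
theorem exists_homeomorph (hg : Generates D₀ 𝔡 g) : Nonempty (normalizedCoeffs g ≃ₜ 𝔡) := by
  have hNR : range (tropComb g) ⊆ ratSpace D₀ := by
    rintro _ ⟨c, rfl⟩; exact hg.tropComb_mem c
  obtain ⟨Φ, hΦc, hΦ⟩ := continuous_divisor_family hNR
    (F := fun c : Fin (n + 1) → ℝ => tropComb g c) (fun c => mem_range_self c) fun x =>
      continuous_maxFn_apply fun i => (continuous_apply i).add continuous_const
  have hm : ∀ c, Φ c ∈ 𝔡 := fun c => (hg.mem_iff _).2 ⟨c, hΦ c⟩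
  have hcomp := isCompact_iff_compactSpace.1 hg.isCompact_normalizedCoeffs
  have hcont : Continuous fun c : normalizedCoeffs g => (⟨Φ c, hm c⟩ : 𝔡) := by fun_prop
  have hbij : Function.Bijective fun c : normalizedCoeffs g => (⟨Φ c, hm c⟩ : 𝔡) := by
    constructor
    · intro c c' h
      have h1 : Φ c = Φ c' := congrArg Subtype.val h
      obtain ⟨k, hk⟩ := (hΦ c).eq_add_const (hg.tropComb_mem c).1 (hg.tropComb_mem c').1
        (h1 ▸ hΦ c')
      exact Subtype.ext (eq_of_tropComb_eq c.2 c'.2 hk)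
    · rintro ⟨D, hD⟩
      obtain ⟨c, hc⟩ := (hg.mem_iff D).1 hD
      obtain ⟨c', hc', hx⟩ := hg.exists_canonical c
      -- Subtracting `c' 0` makes the first coefficient 0 and does not affect the divisor.
      refine ⟨⟨fun i => -c' 0 + c' i, by simp, fun i => ?_⟩, Subtype.ext ?_⟩
      · obtain ⟨x, hx⟩ := hx i
        exact ⟨x, fun j => by linarith [hx j]⟩
      · refine IsTranslate.unique (hΦ _) ?_
        simp only
        rw [tropComb_shift, hc']
        intro x
        rw [ord_const_add]
        exact hc x
  exact ⟨hcont.homeoOfEquivCompactToT2 (f := Equiv.ofBijective _ hbij)⟩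

theorem isCompact (hg : Generates D₀ 𝔡 g) : IsCompact 𝔡 := by
  obtain ⟨h⟩ := hg.exists_homeomorph
  have := isCompact_iff_compactSpace.1 hg.isCompact_normalizedCoeffs
  exact isCompact_iff_compactSpace.2 h.compactSpace

theorem exists_polyhedralComplex (hg : Generates D₀ 𝔡 g) :
    ∃ K : AbstractPolyhedralComplex 𝔡, K.ChartsIsometric := by
  obtain ⟨h⟩ := hg.exists_homeomorph
  set C : Set (EuclideanSpace ℝ (Fin (n + 1))) := {x | x.ofLp ∈ normalizedCoeffs g} with hC
  have hCc : IsClosed C :=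
    hg.isCompact_normalizedCoeffs.isClosed.preimage (PiLp.continuous_ofLp 2 _)
  let h' : C ≃ₜ normalizedCoeffs g :=
    { toFun := fun x => ⟨x.1.ofLp, x.2⟩
      invFun := fun c => ⟨WithLp.toLp 2 c.1, c.2⟩
      left_inv := fun x => rfl
      right_inv := fun c => rfl
      continuous_toFun := by fun_prop
      continuous_invFun := by fun_prop }
  exact hg.isSemilin_normalizedCoeffs.exists_polyhedralComplex hCc (fun x => Iff.rfl)
    (h'.trans h).symm

end Generates

end WeightedGraph

end

/-! ### Functions attached to the cells of the symmetric product -/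

noncomputable section

open Set Filter Topology

theorem HasRightSlope.sub {u v : ℝ → ℝ} {t k l : ℝ} (hu : HasRightSlope u t k)
    (hv : HasRightSlope v t l) : HasRightSlope (fun z => u z - v z) t (k - l) := by
  simpa [sub_eq_add_neg] using hu.add (hv.const_mul (-1))

theorem HasLeftSlope.sub {u v : ℝ → ℝ} {t k l : ℝ} (hu : HasLeftSlope u t k)
    (hv : HasLeftSlope v t l) : HasLeftSlope (fun z => u z - v z) t (k - l) := by
  simpa [sub_eq_add_neg] using hu.add (hv.const_mul (-1))

theorem max_sub_zero_eq_of_notMem_Ioo {a b t y : ℝ} (hy : y ∉ Ioo a b) (ht : t ∈ Icc a b) :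
    max (t - y) 0 = max (a - y) 0 + (t - a) * if y ≤ a then 1 else 0 := by
  split_ifs with h
  · rw [max_eq_left (by linarith [ht.1]), max_eq_left (by linarith)]; ring
  · have : b ≤ y := by
      by_contra! hb
      exact hy ⟨not_le.1 h, hb⟩
    rw [max_eq_right (by linarith [ht.2]), max_eq_right (by linarith [ht.1, ht.2])]; ring

namespace WeightedGraph

variable {V E : Type*} {G : WeightedGraph V E}

theorem edgePairing_congr_support {P : G.Divisor} {e : E} {F F' : ℝ → ℝ}
    (h : ∀ y h0 h1, P (.inner e y h0 h1) ≠ 0 → F y = F' y) :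
    G.edgePairing P e F = G.edgePairing P e F' := by
  refine Finset.sum_congr rfl fun x hx => ?_
  rcases x with v | ⟨e', y, h0, h1⟩
  · rfl
  · simp only [onEdge]
    split_ifs with he
    · subst he
      simp only [h y h0 h1 (Finsupp.mem_support_iff.1 hx)]
    · rfl

theorem exists_int_edgePairing (P : G.Divisor) (e : E) {F : ℝ → ℝ} (hF : ∀ y, ∃ k : ℤ, F y = k) :
    ∃ k : ℤ, G.edgePairing P e F = k := by
  rw [edgePairing, pairing, Finsupp.sum]
  refine Finset.sum_induction (fun a => (P a : ℝ) * G.onEdge e F a) (fun r => ∃ k : ℤ, r = k) ?_ ⟨0, by simp⟩ ?_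
  · rintro _ _ ⟨k, rfl⟩ ⟨l, rfl⟩
    exact ⟨k + l, by push_cast; rfl⟩
  · rintro (v | ⟨e', y, h0, h1⟩) _
    · exact ⟨0, by simp [onEdge]⟩
    · simp only [onEdge]
      split_ifs
      · obtain ⟨k, hk⟩ := hF y
        exact ⟨P (.inner e' y h0 h1) * k, by simp [hk]⟩
      · exact ⟨0, by simp⟩

namespace CellType

variable (c : CellType V E)

/-- The closure of the open cell. -/
def closedCell (G : WeightedGraph V E) : Set c.Coord :=
  {y | ∀ e, Monotone (fun j : Fin (c.num e) => y ⟨e, j⟩) ∧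
    ∀ j : Fin (c.num e), 0 ≤ y ⟨e, j⟩ ∧ y ⟨e, j⟩ ≤ G.len e}

/-- On the edge `e`, the function with value `0` and initial slope `m e` at the source whose divisor
on the open edge is that of the cell minus `P`. -/
def edgeVal (P : G.Divisor) (m : E → ℤ) (y : (Σ e : E, Fin (c.num e)) → ℝ) (e : E) (t : ℝ) : ℝ :=
  m e * t + ∑ j, (c.multE e j : ℝ) * max (t - y ⟨e, j⟩) 0 -
    G.edgePairing P e fun z => max (t - z) 0

variable {c} {P : G.Divisor} {m : E → ℤ} {y : (Σ e : E, Fin (c.num e)) → ℝ} {p : V → ℝ}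

theorem edgeVal_zero (hy : ∀ e j, 0 ≤ y ⟨e, j⟩) (e : E) : c.edgeVal P m y e 0 = 0 := by
  have h1 : (G.edgePairing P e fun z => max (0 - z) 0) = 0 := by
    rw [G.edgePairing_congr (F' := fun _ => 0 * 0), edgePairing_const, zero_mul]
    intro z hz
    rw [max_eq_right (by linarith [hz.1])]; simp
  have h2 : ∑ j, (c.multE e j : ℝ) * max (0 - y ⟨e, j⟩) 0 = 0 :=
    Finset.sum_eq_zero fun j _ => by rw [max_eq_right (by linarith [hy e j]), mul_zero]
  rw [edgeVal, h1, h2]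
  ring

theorem edgeVal_hasRightSlope (e : E) (t : ℝ) : HasRightSlope (c.edgeVal P m y e) t
    (m e + ∑ j, (c.multE e j : ℝ) * (if y ⟨e, j⟩ ≤ t then 1 else 0) -
      G.edgePairing P e fun z => if z ≤ t then 1 else 0) := by
  refine HasRightSlope.sub (HasRightSlope.add ?_ (HasRightSlope.sum _ fun j _ =>
    (hasRightSlope_posPart _ t).const_mul _))
    (G.edgePairing_hasRightSlope P e fun z _ => hasRightSlope_posPart z t)
  simpa using hasRightSlope_affine 0 (m e) t

theorem edgeVal_hasLeftSlope (e : E) (t : ℝ) : HasLeftSlope (c.edgeVal P m y e) t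
    (-m e + ∑ j, (c.multE e j : ℝ) * (-if y ⟨e, j⟩ < t then 1 else 0) -
      G.edgePairing P e fun z => -if z < t then 1 else 0) := by
  refine HasLeftSlope.sub (HasLeftSlope.add ?_ (HasLeftSlope.sum _ fun j _ =>
    (hasLeftSlope_posPart _ t).const_mul _))
    (G.edgePairing_hasLeftSlope P e fun z _ => hasLeftSlope_posPart z t)
  simpa using hasLeftSlope_affine 0 (m e) t

theorem continuous_edgeVal (e : E) : Continuous (c.edgeVal P m y e) := by
  have h := G.continuous_edgePairing P e (F := fun z t => max (t - z) 0) (by fun_prop)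
  unfold edgeVal
  exact (by fun_prop : Continuous fun t => m e * t + ∑ j, (c.multE e j : ℝ) *
    max (t - y ⟨e, j⟩) 0).sub h

variable (c) in
/-- The compatibility of the initial slopes `m` with the multiplicities at the vertices. -/
def VertexCond [Fintype E] (P : G.Divisor) (m : E → ℤ) : Prop :=
  open Classical in
  ∀ v, (c.multV v : ℝ) = P (.vertex v) + ∑ e, ((if G.src e = v then (m e : ℝ) else 0) +
    if G.tgt e = v then -(m e + ∑ j, (c.multE e j : ℝ) - G.edgePairing P e fun _ => 1) else 0)

variable (c) in
/-- The compatibility of the values `p` at the vertices with the initial slopes `m`. -/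
def EdgeCond (P : G.Divisor) (m : E → ℤ) (p : V → ℝ) (y : (Σ e : E, Fin (c.num e)) → ℝ) : Prop :=
  ∀ e, p (G.tgt e) = p (G.src e) + c.edgeVal P m y e (G.len e)

variable (c) in
/-- The function with values `p` at the vertices and initial slopes `m` on the edges whose divisor is
that of the cell minus `P`. -/
def cellFn (P : G.Divisor) (m : E → ℤ) (p : V → ℝ) (y : (Σ e : E, Fin (c.num e)) → ℝ) :
    G.Point → ℝ :=
  G.glue p fun e t => p (G.src e) + c.edgeVal P m y e t

theorem cellFn_pt (hy : ∀ e j, 0 ≤ y ⟨e, j⟩) (hp : c.EdgeCond P m p y) (e : E) {t : ℝ}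
    (ht : t ∈ Icc 0 (G.len e)) :
    c.cellFn P m p y (G.pt e t) = p (G.src e) + c.edgeVal P m y e t :=
  G.glue_pt (by rw [edgeVal_zero hy, add_zero]) (hp e).symm ht

/-- The parameter of a point in the interior of an edge. -/
def _root_.WeightedGraph.Point.param : G.Point → ℝ
  | .vertex _ => 0
  | .inner _ y _ _ => y

/-- On an edge the function can bend only at the coordinates of the cell and at the points of `P`;
the slopes in between are integral combinations of multiplicities. -/
theorem isRational_cellFn (hy : ∀ e j, 0 ≤ y ⟨e, j⟩) (hp : c.EdgeCond P m p y) :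
    G.IsRational (c.cellFn P m p y) := by
  classical
  refine ⟨G.continuous_glue (fun e => by rw [edgeVal_zero hy, add_zero]) (fun e => (hp e).symm)
    fun e => (continuous_const.add (continuous_edgeVal e)).continuousOn, fun e => ?_⟩
  refine ⟨Finset.univ.image (fun j => y ⟨e, j⟩) ∪ P.support.image Point.param,
    fun a b ha hab hb hB => ?_⟩
  obtain ⟨k, hk⟩ := exists_int_edgePairing P e (F := fun z => if z ≤ a then 1 else 0)
    fun z => ⟨if z ≤ a then 1 else 0, by split_ifs <;> simp⟩
  refine ⟨m e + ∑ j, (c.multE e j : ℤ) * (if y ⟨e, j⟩ ≤ a then 1 else 0) - k, fun t ht => ?_⟩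
  rw [cellFn_pt hy hp e ⟨ha.trans ht.1, ht.2.trans hb⟩, cellFn_pt hy hp e ⟨ha, hab.le.trans hb⟩]
  have h1 : (G.edgePairing P e fun z => max (t - z) 0) =
      (G.edgePairing P e fun z => max (a - z) 0) + (t - a) * k := by
    rw [edgePairing_congr_support
      (F' := fun z => 1 * max (a - z) 0 + (t - a) * if z ≤ a then 1 else 0),
      edgePairing_linear, hk, one_mul]
    intro z h0 h1 hz
    rw [one_mul]
    refine max_sub_zero_eq_of_notMem_Ioo (hB z (Finset.mem_union_right _ ?_)) ht
    exact Finset.mem_image.2 ⟨_, Finsupp.mem_support_iff.2 hz, rfl⟩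
  have h2 : ∑ j, (c.multE e j : ℝ) * max (t - y ⟨e, j⟩) 0 =
      ∑ j, (c.multE e j : ℝ) * max (a - y ⟨e, j⟩) 0 +
        (t - a) * ∑ j, (c.multE e j : ℝ) * (if y ⟨e, j⟩ ≤ a then 1 else 0) := by
    rw [Finset.mul_sum, ← Finset.sum_add_distrib]
    refine Finset.sum_congr rfl fun j _ => ?_
    rw [max_sub_zero_eq_of_notMem_Ioo (hB (y ⟨e, j⟩) (Finset.mem_union_left _
      (Finset.mem_image_of_mem _ (Finset.mem_univ j)))) ht]
    ring
  simp only [edgeVal, h1, h2]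
  push_cast
  ring

variable [Fintype V] [Fintype E]

theorem divisor_inner {y : c.Coord} (hy : ∀ e j, 0 ≤ y ⟨e, j⟩ ∧ y ⟨e, j⟩ ≤ G.len e) (e : E) {t : ℝ}
    (h0 : 0 < t) (h1 : t < G.len e) : (c.divisor G y (.inner e t h0 h1) : ℝ) =
      ∑ j, (c.multE e j : ℝ) * if y ⟨e, j⟩ = t then 1 else 0 := by
  classical
  have hpt : ∀ e' j, G.pt e' (y ⟨e', j⟩) = .inner e t h0 h1 ↔ e' = e ∧ y ⟨e', j⟩ = t := by
    intro e' j
    rcases (hy e' j).1.eq_or_lt with h | h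
    · rw [← h, pt_zero]
      simp only [reduceCtorEq, false_iff, not_and]
      intro _ h'
      exact h0.ne h'
    rcases (hy e' j).2.eq_or_lt with h' | h'
    · rw [h', pt_len]
      simp only [reduceCtorEq, false_iff, not_and]
      rintro rfl h''
      exact h1.ne h''.symm
    · rw [G.pt_of_mem_Ioo e' h h']
      simp
  simp only [divisor, Finsupp.add_apply, Finsupp.finsetSum_apply, Finsupp.single_apply, hpt,
    reduceCtorEq, if_false, Finset.sum_const_zero, zero_add]
  rw [Finset.sum_eq_single e]
  · push_cast
    exact Finset.sum_congr rfl fun j _ => by simp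
  · intro e' _ he'
    simp [he']
  · simp

theorem divisor_vertex {y : c.Coord} (hy : ∀ e j, 0 ≤ y ⟨e, j⟩ ∧ y ⟨e, j⟩ ≤ G.len e) (v : V) :
    open Classical in
    (c.divisor G y (.vertex v) : ℝ) = c.multV v + ∑ e,
      ((if G.src e = v then ∑ j, (c.multE e j : ℝ) * (if y ⟨e, j⟩ ≤ 0 then 1 else 0) else 0) +
       (if G.tgt e = v then ∑ j, (c.multE e j : ℝ) *
          (1 - if y ⟨e, j⟩ < G.len e then 1 else 0) else 0)) := by
  classical
  simp only [divisor, Finsupp.add_apply, Finsupp.finsetSum_apply, Finsupp.single_apply,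
    Point.vertex.injEq, Finset.sum_ite_eq', Finset.mem_univ, if_true]
  push_cast
  congr 1
  refine Finset.sum_congr rfl fun e _ => ?_
  have hite : ∀ (q : Prop) [Decidable q] (F : Fin (c.num e) → ℝ),
      (if q then ∑ j, F j else 0) = ∑ j, if q then F j else 0 := by
    intro q _ F
    split_ifs <;> simp
  rw [hite, hite, ← Finset.sum_add_distrib]
  refine Finset.sum_congr rfl fun j _ => ?_
  have hL := G.len_pos e
  rcases (hy e j).1.eq_or_lt with h | h
  · rw [← h, pt_zero]
    simp [hL]
  rcases (hy e j).2.eq_or_lt with h' | h'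
  · rw [h', pt_len]
    simp [hL]
  · rw [G.pt_of_mem_Ioo e h h']
    simp [h.not_ge, h']

/-- Valid on the whole closed cell. `VertexCond` describes chips in the interior of the edges, and a
chip that has reached an endpoint changes the outgoing slope there by its multiplicity. -/
theorem add_ord_cellFn {y : c.Coord} (hy : ∀ e j, 0 ≤ y ⟨e, j⟩ ∧ y ⟨e, j⟩ ≤ G.len e)
    (hm : c.VertexCond P m) (hp : c.EdgeCond P m p y.ofLp) (x : G.Point) :
    (P x : ℝ) + G.ord (c.cellFn P m p y.ofLp) x = c.divisor G y x := by
  classical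
  have hy0 : ∀ e j, 0 ≤ y.ofLp ⟨e, j⟩ := fun e j => (hy e j).1
  set f := c.cellFn P m p y.ofLp with hf
  have hfr := isRational_cellFn hy0 hp
  have hR : ∀ e, ∀ t ∈ Ico 0 (G.len e), G.slopeFwd f e t =
      m e + ∑ j, (c.multE e j : ℝ) * (if y ⟨e, j⟩ ≤ t then 1 else 0) -
        G.edgePairing P e fun z => if z ≤ t then 1 else 0 := by
    intro e t ht
    have h1 : HasRightSlope (fun z => p (G.src e) + c.edgeVal P m y.ofLp e z) t _ :=
      (by simpa using hasRightSlope_affine (p (G.src e)) 0 t :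
        HasRightSlope (fun _ => p (G.src e)) t 0).add (edgeVal_hasRightSlope e t)
    rw [zero_add] at h1
    exact (hfr.hasRightSlope e ht).unique (h1.congr ht.2 fun z hz =>
      cellFn_pt hy0 hp e ⟨ht.1.trans hz.1, hz.2⟩)
  have hL : ∀ e, ∀ t ∈ Ioc 0 (G.len e), G.slopeBwd f e t =
      -m e - ∑ j, (c.multE e j : ℝ) * (if y ⟨e, j⟩ < t then 1 else 0) +
        G.edgePairing P e fun z => if z < t then 1 else 0 := by
    intro e t ht
    have h1 : HasLeftSlope (fun z => p (G.src e) + c.edgeVal P m y.ofLp e z) t _ :=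
      (by simpa using hasLeftSlope_affine (p (G.src e)) 0 t :
        HasLeftSlope (fun _ => p (G.src e)) t 0).add (edgeVal_hasLeftSlope e t)
    rw [zero_add] at h1
    rw [(hfr.hasLeftSlope e ht).unique (h1.congr ht.1 fun z hz =>
      cellFn_pt hy0 hp e ⟨hz.1, hz.2.trans ht.2⟩)]
    have h2 := edgePairing_const P e (fun z => if z < t then (1 : ℝ) else 0) (-1)
    simp only [neg_one_mul] at h2
    simp only [h2, mul_neg, Finset.sum_neg_distrib]
    ring
  rcases x with v | ⟨e, t, h0, h1⟩
  · rw [divisor_vertex hy, hm v, ord]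
    have hz : ∀ e, (G.edgePairing P e fun z => if z ≤ 0 then (1 : ℝ) else 0) = 0 := fun e => by
      rw [G.edgePairing_congr (F' := fun _ => 0 * 0), edgePairing_const, zero_mul]
      intro z hz
      rw [if_neg (not_le.2 hz.1), zero_mul]
    have hz' : ∀ e, (G.edgePairing P e fun z => if z < G.len e then (1 : ℝ) else 0) =
        G.edgePairing P e fun _ => 1 := fun e => by
      refine G.edgePairing_congr fun z hz => ?_
      rw [if_pos hz.2]
    rw [add_assoc, ← Finset.sum_add_distrib]
    congr 1
    refine Finset.sum_congr rfl fun e _ => ?_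
    rw [hR e 0 ⟨le_rfl, G.len_pos e⟩, hL e (G.len e) ⟨G.len_pos e, le_rfl⟩, hz, hz']
    simp only [mul_sub, Finset.sum_sub_distrib, mul_one]
    split_ifs <;> ring
  · rw [divisor_inner hy, ord, hR e t ⟨h0.le, h1⟩, hL e t ⟨h0, h1.le⟩]
    have h2 := G.edgePairing_linear P e (fun z => if z ≤ t then 1 else 0)
      (fun z => if z < t then 1 else 0) 1 (-1)
    rw [G.edgePairing_congr (F' := fun z => if z = t then 1 else 0), G.edgePairing_eq_inner P e h0 h1]
      at h2
    · have h3 : ∑ j, (c.multE e j : ℝ) * (if y ⟨e, j⟩ = t then 1 else 0) =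
          ∑ j, (c.multE e j : ℝ) * (if y ⟨e, j⟩ ≤ t then 1 else 0) -
            ∑ j, (c.multE e j : ℝ) * (if y ⟨e, j⟩ < t then 1 else 0) := by
        rw [← Finset.sum_sub_distrib]
        refine Finset.sum_congr rfl fun j _ => ?_
        rcases lt_trichotomy (y ⟨e, j⟩) t with h | h | h
        · simp [h, h.le, h.ne]
        · simp [h]
        · simp [h.not_gt, h.not_ge, h.ne']
      rw [h3, h2]
      ring
    · intro z _
      rcases lt_trichotomy z t with h | h | h
      · simp [h, h.le, h.ne]
      · simp [h]
      · simp [h.not_gt, h.not_ge, h.ne']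

theorem edgePairing_divisor {y : c.Coord} (hy : y ∈ c.openCell G) (e : E) (F : ℝ → ℝ) :
    G.edgePairing (c.divisor G y) e F = ∑ j, (c.multE e j : ℝ) * F (y ⟨e, j⟩) := by
  classical
  have h1 : ∀ e' j, G.onEdge e F (G.pt e' (y ⟨e', j⟩)) = if e' = e then F (y ⟨e', j⟩) else 0 := by
    intro e' j
    have := (hy e').2 j
    rw [G.pt_of_mem_Ioo e' this.1 this.2]
    rfl
  have h2 : ∀ v, G.onEdge e F (.vertex v) = 0 := fun v => rfl
  simp only [edgePairing, divisor, pairing_add, pairing_sum, pairing_single, h1, h2, mul_zero,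
    Finset.sum_const_zero, zero_add]
  rw [Finset.sum_eq_single e]
  · simp
  · intro e' _ he'
    simp [he']
  · simp

/-- The initial slopes and the values at the vertices of a function whose divisor is the difference
of two given ones. -/
theorem exists_conds {d : ℕ} {D₀ : G.EffDiv d} {y : c.Coord} (hy : y ∈ c.openCell G)
    (hyt : y ∈ c.trace (linSystem D₀)) :
    ∃ m p, c.VertexCond D₀.toDiv m ∧ c.EdgeCond D₀.toDiv m p y.ofLp := by
  classical
  obtain ⟨D, ⟨f, hf, hfD⟩, hDy⟩ := hyt
  have hP := isTranslate_iff.1 hfD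
  choose m hm using fun e => hf.exists_int_slopeFwd e (t := 0) ⟨le_rfl, G.len_pos e⟩
  refine ⟨m, fun v => f (.vertex v), fun v => ?_, fun e => ?_⟩
  · have h1 := hfD (.vertex v)
    have h2 := divisor_vertex (c := c) (G := G) (y := y)
      (fun e j => ⟨((hy e).2 j).1.le, ((hy e).2 j).2.le⟩) v
    rw [Finset.sum_eq_zero, add_zero] at h2
    · rw [← h2, ← hDy, h1, ord]
      congr 1
      refine Finset.sum_congr rfl fun e _ => ?_
      rw [hm, hf.slopeBwd_len hP, hm, edgePairing_sub, hDy, edgePairing_divisor hy]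
      simp only [mul_one, add_sub_assoc]
    · intro e _
      have h3 : ∀ j, (if y ⟨e, j⟩ ≤ 0 then (1 : ℝ) else 0) = 0 :=
        fun j => if_neg (not_le.2 ((hy e).2 j).1)
      have h4 : ∀ j, (if y ⟨e, j⟩ < G.len e then (1 : ℝ) else 0) = 1 :=
        fun j => if_pos ((hy e).2 j).2
      simp [h3, h4]
  · have h1 := hf.eq_on_edge hP e ⟨(G.len_pos e).le, le_rfl⟩
    rw [pt_len, hm, edgePairing_sub, hDy, edgePairing_divisor hy] at h1
    change f (.vertex (G.tgt e)) = f (.vertex (G.src e)) + _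
    rw [h1, edgeVal]
    ring

end CellType

end WeightedGraph

end

/-! ### The cells of the complete linear system, and definability -/

noncomputable section

open Set Filter Topology

namespace WeightedGraph

variable {V E : Type*} {G : WeightedGraph V E}

/-- The differences of the values at the endpoints of the edges, for a function on the vertices. -/
def coboundary (G : WeightedGraph V E) : (V → ℝ) →ₗ[ℝ] (E → ℝ) :=
  LinearMap.funLeft ℝ ℝ G.tgt - LinearMap.funLeft ℝ ℝ G.src

namespace CellType

variable (c : CellType V E)

/-- On the closed cell, the values at the targets of the edges of the functions `edgeVal`. -/
def edgeRise (P : G.Divisor) (m : E → ℤ) (y : (Σ e : E, Fin (c.num e)) → ℝ) (e : E) : ℝ :=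
  m e * G.len e + ∑ j, (c.multE e j : ℝ) * (G.len e - y ⟨e, j⟩) -
    G.edgePairing P e fun z => max (G.len e - z) 0

variable {c} {P : G.Divisor} {m : E → ℤ}

theorem edgeVal_len {y : (Σ e : E, Fin (c.num e)) → ℝ} (hy : ∀ e j, y ⟨e, j⟩ ≤ G.len e) (e : E) :
    c.edgeVal P m y e (G.len e) = c.edgeRise P m y e := by
  rw [edgeVal, edgeRise]
  congr 2
  exact Finset.sum_congr rfl fun j _ => by rw [max_eq_left (sub_nonneg.2 (hy e j))]

theorem edgeRise_combo (y y' : (Σ e : E, Fin (c.num e)) → ℝ) (s : ℝ) :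
    c.edgeRise P m ((1 - s) • y + s • y') =
      (1 - s) • c.edgeRise P m y + s • c.edgeRise P m y' := by
  ext e
  simp only [edgeRise, Pi.add_apply, Pi.smul_apply, smul_eq_mul]
  have h : ∑ j, (c.multE e j : ℝ) * (G.len e - ((1 - s) * y ⟨e, j⟩ + s * y' ⟨e, j⟩)) =
      (1 - s) * ∑ j, (c.multE e j : ℝ) * (G.len e - y ⟨e, j⟩) +
        s * ∑ j, (c.multE e j : ℝ) * (G.len e - y' ⟨e, j⟩) := by
    rw [Finset.mul_sum, Finset.mul_sum, ← Finset.sum_add_distrib]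
    exact Finset.sum_congr rfl fun j _ => by ring
  rw [h]
  ring

theorem continuous_edgeRise : Continuous (c.edgeRise P m) := by
  unfold edgeRise
  fun_prop

theorem edgeRise_sub (m' : E → ℤ) (y : (Σ e : E, Fin (c.num e)) → ℝ) :
    c.edgeRise P m y - c.edgeRise P m' y = fun e => ((m e - m' e : ℤ) : ℝ) * G.len e := by
  ext e
  simp only [edgeRise, Pi.sub_apply]
  push_cast
  ring

/-- Prescribed rises along the edges come from values at the vertices exactly when they form a
coboundary. As `edgeRise` is affine in `y`, this is an affine condition on the closed cell. -/
theorem exists_edgeCond_iff {y : (Σ e : E, Fin (c.num e)) → ℝ} (hy : ∀ e j, y ⟨e, j⟩ ≤ G.len e) :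
    (∃ p, c.EdgeCond P m p y) ↔ c.edgeRise P m y ∈ LinearMap.range G.coboundary := by
  refine exists_congr fun p => ?_
  rw [funext_iff]
  refine forall_congr' fun e => ?_
  rw [edgeVal_len hy, coboundary]
  simp only [LinearMap.sub_apply, Pi.sub_apply, LinearMap.funLeft_apply]
  rw [sub_eq_iff_eq_add']

theorem openCell_subset_closedCell : c.openCell G ⊆ c.closedCell G :=
  fun _ hy e => ⟨(hy e).1.monotone, fun j => ⟨((hy e).2 j).1.le, ((hy e).2 j).2.le⟩⟩

theorem combo_mem_openCell {y y' : c.Coord} (hy : y ∈ c.closedCell G) (hy' : y' ∈ c.openCell G)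
    {s : ℝ} (hs : 0 < s) (hs1 : s ≤ 1) : (1 - s) • y + s • y' ∈ c.openCell G := by
  intro e
  refine ⟨fun i j hij => ?_, fun j => ?_⟩
  · have h1 := mul_le_mul_of_nonneg_left ((hy e).1 hij.le) (sub_nonneg.2 hs1)
    have h2 := mul_lt_mul_of_pos_left ((hy' e).1 hij) hs
    simp only [PiLp.add_apply, PiLp.smul_apply, smul_eq_mul] at h1 h2 ⊢
    linarith
  · have h1 := mul_le_mul_of_nonneg_left ((hy e).2 j).2 (sub_nonneg.2 hs1)
    have h2 := mul_lt_mul_of_pos_left ((hy' e).2 j).2 hs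
    have h3 := mul_nonneg (sub_nonneg.2 hs1) ((hy e).2 j).1
    have h4 := mul_pos hs ((hy' e).2 j).1
    simp only [PiLp.add_apply, PiLp.smul_apply, smul_eq_mul]
    constructor <;> linarith

theorem isClosed_closedCell : IsClosed (c.closedCell G) := by
  simp only [closedCell, Monotone, ofPred_forall, ofPred_and]
  refine isClosed_iInter fun e => IsClosed.inter ?_ ?_
  · refine isClosed_iInter fun i => isClosed_iInter fun j => isClosed_iInter fun _ => ?_
    exact isClosed_le (by fun_prop) (by fun_prop)
  · refine isClosed_iInter fun j => ?_
    exact (isClosed_le (by fun_prop) (by fun_prop)).inter (isClosed_le (by fun_prop) (by fun_prop))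

variable (c P m) in
/-- The points of the coordinate space at which the function with initial slopes `m` closes up along
the cycles of the graph. -/
def closedLocus : Set c.Coord :=
  {y | c.edgeRise P m y.ofLp ∈ LinearMap.range G.coboundary}

theorem combo_mem_closedLocus {y y' : c.Coord} (hy : y ∈ c.closedLocus P m)
    (hy' : y' ∈ c.closedLocus P m) (s : ℝ) : (1 - s) • y + s • y' ∈ c.closedLocus P m := by
  have := edgeRise_combo (P := P) (m := m) y.ofLp y'.ofLp s
  change c.edgeRise P m ((1 - s) • y.ofLp + s • y'.ofLp) ∈ LinearMap.range G.coboundary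
  rw [this]
  exact add_mem (Submodule.smul_mem _ _ hy) (Submodule.smul_mem _ _ hy')

theorem convex_openCell_inter_closedLocus :
    Convex ℝ (c.openCell G ∩ c.closedLocus P m) := by
  refine convex_iff_forall_pos.2 fun y hy y' hy' a b ha hb hab => ?_
  obtain rfl : a = 1 - b := by linarith
  exact ⟨combo_mem_openCell (openCell_subset_closedCell hy.1) hy'.1 hb (by linarith),
    combo_mem_closedLocus hy.2 hy'.2 b⟩

variable [Fintype E]

theorem isClosed_closedLocus : IsClosed (c.closedLocus P m) :=
  (Submodule.closed_of_finiteDimensional (LinearMap.range G.coboundary)).preimage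
    (continuous_edgeRise.comp (PiLp.continuous_ofLp 2 _))

/-- A point of the closed cell in the affine locus is a limit of points of the segment to `y₀`, and
these lie in the open cell. -/
theorem closure_openCell_inter_closedLocus {y₀ : c.Coord}
    (hy₀ : y₀ ∈ c.openCell G ∩ c.closedLocus P m) :
    closure (c.openCell G ∩ c.closedLocus P m) = c.closedCell G ∩ c.closedLocus P m := by
  apply Subset.antisymm
  · exact closure_minimal (inter_subset_inter_left _ openCell_subset_closedCell)
      (isClosed_closedCell.inter isClosed_closedLocus)
  · rintro y ⟨hy, hy'⟩
    have hc : Tendsto (fun s : ℝ => (1 - s) • y + s • y₀) (𝓝[>] 0) (𝓝 y) := by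
      have : Continuous fun s : ℝ => (1 - s) • y + s • y₀ := by fun_prop
      simpa [ContinuousWithinAt] using this.continuousWithinAt (s := Ioi 0) (x := 0)
    refine mem_closure_of_tendsto hc ?_
    filter_upwards [Ioc_mem_nhdsGT (zero_lt_one' ℝ)] with s hs
    exact ⟨combo_mem_openCell hy hy₀.1 hs.1 hs.2, combo_mem_closedLocus hy' hy₀.2 s⟩

variable [Fintype V] {d : ℕ} {D₀ : G.EffDiv d}

theorem exists_isTranslate_cellFn {y : c.Coord} {p : V → ℝ} (hy : y ∈ c.closedCell G)
    (hm : c.VertexCond D₀.toDiv m) (hp : c.EdgeCond D₀.toDiv m p y.ofLp) :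
    ∃ D : G.EffDiv d, D.toDiv = c.divisor G y ∧
      IsTranslate D₀ (c.cellFn D₀.toDiv m p y.ofLp) D := by
  have h := add_ord_cellFn (fun e => (hy e).2) hm hp
  have hpos : 0 ≤ c.divisor G y :=
    add_nonneg (Finset.sum_nonneg fun v _ => by simp)
      (Finset.sum_nonneg fun e _ => Finset.sum_nonneg fun j _ => by simp)
  obtain ⟨D, hD⟩ := ratSpace.exists_isTranslate (D := D₀)
    (f := c.cellFn D₀.toDiv m p y.ofLp) ⟨isRational_cellFn (fun e j => ((hy e).2 j).1) hp,
      fun x => by rw [h]; exact_mod_cast hpos x⟩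
  refine ⟨D, Finsupp.ext fun x => ?_, hD⟩
  have := (hD x).trans (h x)
  exact_mod_cast this

/-- The set on the right is convex, hence connected. Conversely, changing the integral initial
slopes moves the affine condition through only countably many translates, and a connected set cannot
pass from one to another. -/
theorem connectedComponentIn_eq {y₀ : c.Coord} (hm : c.VertexCond D₀.toDiv m)
    (hy₀ : y₀ ∈ c.openCell G ∩ c.closedLocus D₀.toDiv m) :
    connectedComponentIn (c.openCell G ∩ c.trace (linSystem D₀)) y₀ =
      c.openCell G ∩ c.closedLocus D₀.toDiv m := by
  have hsub : c.openCell G ∩ c.closedLocus D₀.toDiv m ⊆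
      c.openCell G ∩ c.trace (linSystem D₀) := by
    rintro y ⟨hy, hy'⟩
    have hyc := openCell_subset_closedCell hy
    obtain ⟨p, hp⟩ := (exists_edgeCond_iff fun e j => ((hyc e).2 j).2).2 hy'
    obtain ⟨D, hD, hD'⟩ := exists_isTranslate_cellFn hyc hm hp
    exact ⟨hy, D, ⟨_, isRational_cellFn (fun e j => ((hyc e).2 j).1) hp, hD'⟩, hD⟩
  apply Subset.antisymm
  · intro y hy
    refine ⟨(connectedComponentIn_subset _ _ hy).1, ?_⟩
    by_contra hyl
    -- A functional killing all coboundaries but not the rises at `y`. On the trace of |D₀| it takes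
    -- only the countably many values coming from differences of integral slopes, so it is constant
    -- on the component, and it is 0 at `y₀`.
    obtain ⟨ψ, hψ, hψW⟩ := Submodule.exists_le_ker_of_notMem
      (p := LinearMap.range G.coboundary) hyl
    have hcont : Continuous fun z : c.Coord => ψ (c.edgeRise D₀.toDiv m z.ofLp) :=
      (LinearMap.continuous_of_finiteDimensional ψ).comp
        (continuous_edgeRise.comp (PiLp.continuous_ofLp 2 _))
    have himg := (isPreconnected_connectedComponentIn
      (x := y₀) (F := c.openCell G ∩ c.trace (linSystem D₀))).image _ hcont.continuousOn
    have hct : (range fun k : E → ℤ => ψ fun e => (k e : ℝ) * G.len e).Countable :=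
      countable_range _
    have hss := hct.isTotallyDisconnected _ (by
      rintro _ ⟨z, hz, rfl⟩
      have hz' := connectedComponentIn_subset _ _ hz
      obtain ⟨m', p', -, hp'⟩ := exists_conds hz'.1 hz'.2
      have h1 := hψW ((exists_edgeCond_iff fun e j => ((hz'.1 e).2 j).2.le).1 ⟨p', hp'⟩)
      refine ⟨fun e => m e - m' e, ?_⟩
      rw [LinearMap.mem_ker] at h1
      have h2 := congrArg ψ (edgeRise_sub (P := D₀.toDiv) (m := m) m' z.ofLp)
      rw [map_sub, h1, sub_zero] at h2
      exact h2.symm) himg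
    have := hss (mem_image_of_mem _ hy)
      (mem_image_of_mem _ (mem_connectedComponentIn (hsub hy₀)))
    exact hψ (this.trans (hψW hy₀.2))
  · exact convex_openCell_inter_closedLocus.isPreconnected.subset_connectedComponentIn hy₀ hsub

variable [ConnectedSpace G.Point] [Nontrivial G.Point]

/-- The function with the divisor of `y` is unique up to a constant, so membership in 𝔡 can be
tested on the explicit `cellFn`; the constant is absorbed in the coefficients `a`. -/
theorem mem_trace_iff {n : ℕ} {𝔡 : Set (G.EffDiv d)} {g : Fin (n + 1) → G.Point → ℝ}
    (hg : Generates D₀ 𝔡 g) (hm : c.VertexCond D₀.toDiv m) {y : c.Coord}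
    (hy : y ∈ c.closedCell G) (hyl : y ∈ c.closedLocus D₀.toDiv m) :
    y ∈ c.trace 𝔡 ↔ ∃ p, c.EdgeCond D₀.toDiv m p y.ofLp ∧ ∃ a, ∀ e, ∀ t ∈ Icc 0 (G.len e),
      p (G.src e) + c.edgeVal D₀.toDiv m y.ofLp e t = tropComb g a (G.pt e t) := by
  have hy0 : ∀ e j, 0 ≤ y.ofLp ⟨e, j⟩ := fun e j => ((hy e).2 j).1
  constructor
  · rintro ⟨D, hD, hDy⟩
    obtain ⟨p, hp⟩ := (exists_edgeCond_iff fun e j => ((hy e).2 j).2).2 hyl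
    obtain ⟨D', hD', hf⟩ := exists_isTranslate_cellFn hy hm hp
    obtain rfl : D = D' := EffDiv.ext (hDy.trans hD'.symm)
    obtain ⟨a, ha⟩ := (hg.mem_iff D).1 hD
    obtain ⟨k, hk⟩ := hf.eq_add_const (isRational_cellFn hy0 hp) (hg.tropComb_mem a).1 ha
    refine ⟨p, hp, fun i => k + a i, fun e t ht => ?_⟩
    rw [← cellFn_pt hy0 hp e ht, hk, tropComb_shift]
  · rintro ⟨p, hp, a, ha⟩
    obtain ⟨D, hD, hf⟩ := exists_isTranslate_cellFn hy hm hp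
    refine ⟨D, (hg.mem_iff D).2 ⟨a, ?_⟩, hD⟩
    convert hf using 1
    ext x
    obtain ⟨e, t, ht, rfl⟩ := G.exists_pt_eq x
    rw [← ha e t ht, cellFn_pt hy0 hp e ht]

end CellType

theorem IsPiecewiseAff.edgeVal {ι : Type*} [Fintype ι] {c : CellType V E} {P : G.Divisor}
    {m : E → ℤ} {e : E} {Y : (Σ e : E, Fin (c.num e)) → (ι → ℝ) → ℝ} {T : (ι → ℝ) → ℝ}
    (hY : ∀ i, IsPiecewiseAff (Y i)) (hT : IsPiecewiseAff T) :
    IsPiecewiseAff fun w => c.edgeVal P m (fun i => Y i w) e (T w) := by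
  have h1 : IsPiecewiseAff fun w => ∑ j, (c.multE e j : ℝ) * max (T w - Y ⟨e, j⟩ w) 0 := by
    refine IsPiecewiseAff.sum _ fun j _ => ?_
    have := (hT.add ((hY ⟨e, j⟩).zmul (-1))).posPart.zmul (c.multE e j)
    simpa [sub_eq_add_neg] using this
  have h2 := ((hT.zmul (m e)).add h1).add ((IsPiecewiseAff.edgePairing hT P e).zmul (-1))
  simpa [CellType.edgeVal, sub_eq_add_neg] using h2

theorem isSemilin_closedCell [Fintype E] (c : CellType V E) :
    IsSemilin {y : (Σ e : E, Fin (c.num e)) → ℝ | WithLp.toLp 2 y ∈ c.closedCell G} := by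
  refine IsSemilin.forall_fintype fun e => IsSemilin.and ?_ (IsSemilin.forall_fintype fun j => ?_)
  · refine IsSemilin.forall_fintype fun i => IsSemilin.forall_fintype fun j => ?_
    by_cases hij : i ≤ j
    · simpa [hij] using (isPiecewiseAff_apply _).setOf_le (isPiecewiseAff_apply _)
    · simpa [hij] using IsSemilin.univ
  · exact ((isPiecewiseAff_const 0).setOf_le (isPiecewiseAff_apply _)).and
      ((isPiecewiseAff_apply _).setOf_le (isPiecewiseAff_const _))

section Definable

variable [Fintype E] [Fintype V] {d : ℕ}
  {D₀ : G.EffDiv d} {c : CellType V E} {m : E → ℤ}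

theorem Generates.isSemilin_exists_tropComb {n : ℕ} {𝔡 : Set (G.EffDiv d)}
    {g : Fin (n + 1) → G.Point → ℝ} (hg : Generates D₀ 𝔡 g) :
    IsSemilin {y : (Σ e : E, Fin (c.num e)) → ℝ | ∃ p, c.EdgeCond D₀.toDiv m p y ∧
      ∃ a, ∀ e, ∀ t ∈ Icc 0 (G.len e),
        p (G.src e) + c.edgeVal D₀.toDiv m y e t = tropComb g a (G.pt e t)} := by
  choose P b k hP using fun i => (hg.mem_ratSpace i).1.exists_edgeFn
  set ι := Σ e : E, Fin (c.num e)
  set S : E → Set ((ι ⊕ (V ⊕ Fin (n + 1))) ⊕ Unit → ℝ) := fun e => {w |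
    (0 ≤ w (.inr ()) ∧ w (.inr ()) ≤ G.len e) →
      (∀ i, w (.inl (.inr (.inr i))) + edgeFn (P i e) e (b i e) (k i e) (w (.inr ())) ≤
        w (.inl (.inr (.inl (G.src e)))) +
          c.edgeVal D₀.toDiv m (fun i => w (.inl (.inl i))) e (w (.inr ()))) ∧
      ∃ i, w (.inl (.inr (.inl (G.src e)))) +
          c.edgeVal D₀.toDiv m (fun i => w (.inl (.inl i))) e (w (.inr ())) ≤
        w (.inl (.inr (.inr i))) + edgeFn (P i e) e (b i e) (k i e) (w (.inr ()))} with hS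
  have hT : IsPiecewiseAff fun w : (ι ⊕ (V ⊕ Fin (n + 1))) ⊕ Unit → ℝ => w (.inr ()) :=
    isPiecewiseAff_apply _
  have hSs : ∀ e, IsSemilin (S e) := fun e => by
    refine IsSemilin.imp (((isPiecewiseAff_const 0).setOf_le hT).and
      (hT.setOf_le (isPiecewiseAff_const _)))
      (IsSemilin.and (IsSemilin.forall_fintype fun i => ?_) (IsSemilin.exists_fintype fun i => ?_))
    · exact ((isPiecewiseAff_apply _).add (IsPiecewiseAff.edgeFn hT _ _ _ _)).setOf_le
        ((isPiecewiseAff_apply _).add (IsPiecewiseAff.edgeVal (fun i => isPiecewiseAff_apply _) hT))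
    · exact ((isPiecewiseAff_apply _).add
        (IsPiecewiseAff.edgeVal (fun i => isPiecewiseAff_apply _) hT)).setOf_le
        ((isPiecewiseAff_apply _).add (IsPiecewiseAff.edgeFn hT _ _ _ _))
  have hC : ∀ e, IsSemilin {w : ι ⊕ (V ⊕ Fin (n + 1)) → ℝ | w (.inr (.inl (G.tgt e))) =
      w (.inr (.inl (G.src e))) + c.edgeVal D₀.toDiv m (fun i => w (.inl i)) e (G.len e)} :=
    fun e => (isPiecewiseAff_apply _).setOf_eq ((isPiecewiseAff_apply _).add
      (IsPiecewiseAff.edgeVal (fun i => isPiecewiseAff_apply _) (isPiecewiseAff_const _)))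
  convert IsSemilin.exists_elim ((IsSemilin.forall_fintype hC).and
    (IsSemilin.forall_fintype fun e => (hSs e).forall_elim)) using 1
  ext y
  simp only [mem_ofPred_eq]
  -- Equality with the tropical combination is expressed by inequalities between piecewise affine
  -- functions, for all values of the edge parameter; the parameter sits in the `Unit` coordinate.
  have key : ∀ (p : V → ℝ) (a : Fin (n + 1) → ℝ) (e : E),
      (∀ t ∈ Icc 0 (G.len e),
        p (G.src e) + c.edgeVal D₀.toDiv m y e t = tropComb g a (G.pt e t)) ↔
      ∀ z : Unit → ℝ, Sum.elim (Sum.elim y (Sum.elim p a)) z ∈ S e := by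
    intro p a e
    constructor
    · intro h z hz
      replace hz : z () ∈ Icc 0 (G.len e) := hz
      have := eq_tropComb_iff.1 (h (z ()) hz)
      simp only [hP _ e (z ()) hz] at this
      exact this
    · intro h t ht
      have := h (fun _ => t) ht
      rw [eq_tropComb_iff]
      simp only [hP _ e t ht]
      exact this
  constructor
  · rintro ⟨p, hp, a, ha⟩
    exact ⟨Sum.elim p a, hp, fun e => (key p a e).1 (ha e)⟩
  · rintro ⟨z, hz, hz'⟩
    refine ⟨fun v => z (.inl v), hz, fun i => z (.inr i), fun e =>
      (key (fun v => z (.inl v)) (fun i => z (.inr i)) e).2 ?_⟩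
    have : Sum.elim (fun v => z (.inl v)) (fun i => z (.inr i)) = z := Sum.elim_comp_inl_inr z
    rw [this]
    exact hz' e

variable [ConnectedSpace G.Point] [Nontrivial G.Point]

theorem Generates.isDefinableIn {n : ℕ} {𝔡 : Set (G.EffDiv d)}
    {g : Fin (n + 1) → G.Point → ℝ} (hg : Generates D₀ 𝔡 g) : IsDefinableIn D₀ 𝔡 := by
  intro c y₀ hy₀
  obtain ⟨m, p₀, hm, hp₀⟩ := CellType.exists_conds hy₀.1 hy₀.2
  have hy₀' : y₀ ∈ c.openCell G ∩ c.closedLocus D₀.toDiv m :=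
    ⟨hy₀.1, (CellType.exists_edgeCond_iff fun e j => ((hy₀.1 e).2 j).2.le).1 ⟨p₀, hp₀⟩⟩
  rw [CellType.connectedComponentIn_eq hm hy₀', CellType.closure_openCell_inter_closedLocus hy₀']
  -- The affine locus, whose equations need not have integral coefficients, is not listed: on the
  -- closed cell it is implied by the existence of `p`.
  convert IsSemilin.isDefinable ((isSemilin_closedCell (G := G) c).and
    (hg.isSemilin_exists_tropComb (c := c) (m := m))) using 1
  ext y
  constructor
  · rintro ⟨⟨hy, hyl⟩, hyt⟩
    exact ⟨hy, (CellType.mem_trace_iff hg hm hy hyl).1 hyt⟩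
  · rintro ⟨hy, p, hp, ha⟩
    replace hy : y ∈ c.closedCell G := hy
    have hyl : y ∈ c.closedLocus D₀.toDiv m :=
      (CellType.exists_edgeCond_iff fun e j => ((hy e).2 j).2).1 ⟨p, hp⟩
    exact ⟨⟨hy, hyl⟩, (CellType.mem_trace_iff hg hm hy hyl).2 ⟨p, hp, ha⟩⟩

end Definable

end WeightedGraph

end

theorem mainTheorem2 {V E : Type*} [Fintype V] [Fintype E] (G : WeightedGraph V E)
    [ConnectedSpace G.Point] [Nontrivial G.Point] {d : ℕ} (D₀ : G.EffDiv d)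
    (𝔡 : Set (G.EffDiv d)) (h𝔡 : WeightedGraph.IsTropicalLinearSystem D₀ 𝔡) :
    (∀ K : AbstractPolyhedralComplex 𝔡, ∀ σ : K.cells, K.IsMaximalFace σ →
      WeightedGraph.rank 𝔡 ≤ K.dim σ) ∧
    (WeightedGraph.IsFinGen D₀ 𝔡 →
      IsClosed ((↑) ⁻¹' 𝔡 : Set (WeightedGraph.linSystem D₀)) ∧
      WeightedGraph.IsDefinableIn D₀ 𝔡 ∧
      ∃ K : AbstractPolyhedralComplex 𝔡, K.ChartsIsometric ∧
        ∀ σ : K.cells, K.IsMaximalFace σ → WeightedGraph.rank 𝔡 ≤ K.dim σ) := by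
  refine ⟨fun K σ hσ => WeightedGraph.rank_le_dim_of_isMaximalFace h𝔡 K hσ, fun hfg => ?_⟩
  suffices h : IsClosed 𝔡 ∧ WeightedGraph.IsDefinableIn D₀ 𝔡 ∧
      ∃ K : AbstractPolyhedralComplex 𝔡, K.ChartsIsometric by
    obtain ⟨h1, h2, K, hK⟩ := h
    exact ⟨h1.preimage continuous_subtype_val, h2, K, hK,
      fun σ hσ => WeightedGraph.rank_le_dim_of_isMaximalFace h𝔡 K hσ⟩
  -- The empty system has no generators to index by `Fin (n + 1)`, so it is treated apart.
  rcases 𝔡.eq_empty_or_nonempty with rfl | hne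
  · refine ⟨isClosed_empty, fun c y₀ _ => ?_, ?_⟩
    · have h : c.trace (∅ : Set (G.EffDiv d)) = ∅ := by
        ext y
        simp [WeightedGraph.CellType.trace]
      rw [h, Set.inter_empty, ← Set.compl_univ]
      exact WeightedGraph.IsDefinable.univ.compl
    · exact (IsSemilin.empty (ι := Fin 0)).exists_polyhedralComplex isClosed_empty
        (fun _ => Iff.rfl) (Homeomorph.empty (X := (∅ : Set (G.EffDiv d))))
  · obtain ⟨n, g, hg⟩ := hfg.exists_generates h𝔡 hne
    exact ⟨hg.isCompact.isClosed, hg.isDefinableIn, hg.exists_polyhedralComplex⟩
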